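/- Let $X$ be a compact connected smooth surface with nonempty boundary $\partial X$, and let $v$ be a smooth nowhere vanishing vector field on $X$. Suppose that: (i) $v$ is gradient-like: there is a Morse function $f : X \to \mathbb R$ (a smooth function all of whose critical points, if there are any, are nondegenerate) such that $df(v) > 0$ at every point outside the set of critical points of $f$; (ii) $v$ is boundary convex, in the following sense. Let $\partial_1^{+}X(v)$, respectively $\partial_1^{-}X(v)$, be the closed set of points of $\partial X$ at which $v$ points inside $X$ or is tangent to $\partial X$, respectively points outside $X$ or is tangent to $\partial X$, and let $\partial_2X(v) = \partial_1^{+}X(v) \cap \partial_1^{-}X(v)$ be the set of points at which $v$ is tangent to $\partial X$. Then $v$ is boundary generic, that is, $v|_{\partial X}$, viewed as a section of the normal line bundle $T(X)|_{\partial X}/T(\partial X)$, is transversal to the zero section, and $v|_{\partial_2X(v)}$, viewed as a section of the line bundle $T(\partial X)|_{\partial_2X(v)}$, is transversal to the zero section (i.e. has no zeros); and the set $\partial_2^{+}X(v)$ of those points $z \in \partial_2X(v)$ at which $v(z)$ points inside $\partial_1^{+}X(v)$ is empty. Then $X$ is diffeomorphic to the closed disk $\{y \in \mathbb R^2 : \|y\|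 \le 1\}$ or to the closed annulus $\{y \in \mathbb R^2 : 1 \le \|y\| \le 2\}$. -/

import Mathlib

open scoped Manifold ContDiff Topology

noncomputable section

/-! Surfaces are smooth manifolds with boundary modelled on the half-plane
`EuclideanHalfSpace 2 = {y : ℝ² | 0 ≤ y 0}`.  In a chart, coordinate `0` is the inward normal
coordinate along the boundary and coordinate `1` is the coordinate along the boundary.
Mathlib's `TangentSpace (𝓡∂ 2) x` is `ℝ²`, through the preferred chart `extChartAt (𝓡∂ 2) x`;
so for a boundary point `x` a tangent vector `w` at `x` points inside the surface, is tangent to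
the boundary, or points outside, as `w 0` is positive, zero, or negative. -/

/-- The coordinate `i` of a vector `w` of the plane. It is applied to tangent vectors `w` of a surface,
since `TangentSpace (𝓡∂ 2) x` is `ℝ²` by definition. -/
def tangentCoord (w : EuclideanSpace ℝ (Fin 2)) (i : Fin 2) : ℝ := w i

section Surface

variable {X : Type*} [TopologicalSpace X] [ChartedSpace (EuclideanHalfSpace 2) X]

/-- `v` is a smooth (`C^∞`) vector field on the surface `X`. -/
def IsSmoothField [IsManifold (𝓡∂ 2) ∞ X] (v : ∀ x : X, TangentSpace (𝓡∂ 2) x) : Prop :=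
  ContMDiff (𝓡∂ 2) (𝓡∂ 2).tangent ∞
    (fun x => (⟨x, v x⟩ : TangentBundle (𝓡∂ 2) X))

/-- `x` is a critical point of `f`: the differential of `f` vanishes at `x`. -/
def IsCritical (f : X → ℝ) (x : X) : Prop :=
  mfderiv (𝓡∂ 2) 𝓘(ℝ, ℝ) f x = 0

/-- The Hessian (second derivative) of `f` at `x` in the preferred chart at `x`. -/
def chartHessian (f : X → ℝ) (x : X) :
    EuclideanSpace ℝ (Fin 2) →L[ℝ] EuclideanSpace ℝ (Fin 2) →L[ℝ] ℝ :=
  fderivWithin ℝ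
    (fderivWithin ℝ (f ∘ (extChartAt (𝓡∂ 2) x).symm) (Set.range (𝓡∂ 2)))
    (Set.range (𝓡∂ 2)) (extChartAt (𝓡∂ 2) x x)

/-- `f` is a Morse function: it is smooth, and its Hessian is nondegenerate at each of its critical
points (if there are any). -/
def IsMorse (f : X → ℝ) : Prop :=
  ContMDiff (𝓡∂ 2) 𝓘(ℝ, ℝ) ∞ f ∧
    ∀ x, IsCritical f x → ∀ u, (∀ w, chartHessian f x u w = 0) → u = 0

/-- `v` is gradient-like: for some Morse function `f`, one has `df(v) > 0` everywhere outside of the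
set of critical points of `f`. -/
def IsGradientLike (v : ∀ x : X, TangentSpace (𝓡∂ 2) x) : Prop :=
  ∃ f : X → ℝ, IsMorse f ∧
    ∀ x, ¬ IsCritical f x → (0 : ℝ) < mfderiv (𝓡∂ 2) 𝓘(ℝ, ℝ) f x (v x)

/-- The closed locus `∂₁⁺X(v)` of boundary points where `v` points inside `X` or is tangent to
the boundary. -/
def inwardLocus (v : ∀ x : X, TangentSpace (𝓡∂ 2) x) : Set X :=
  {x | x ∈ (𝓡∂ 2).boundary X ∧ 0 ≤ tangentCoord (v x) 0}

/-- The closed locus `∂₁⁻X(v)` of boundary points where `v` points outside `X` or is tangent to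
the boundary. -/
def outwardLocus (v : ∀ x : X, TangentSpace (𝓡∂ 2) x) : Set X :=
  {x | x ∈ (𝓡∂ 2).boundary X ∧ tangentCoord (v x) 0 ≤ 0}

/-- The locus `∂₂X(v)` of boundary points where `v` is tangent to the boundary. -/
def tangencyLocus (v : ∀ x : X, TangentSpace (𝓡∂ 2) x) : Set X :=
  inwardLocus v ∩ outwardLocus v

/-- For a boundary point `p`: the point at signed distance `s` from `p` along the boundary, in the
preferred chart at `p` (meaningful for small `s`). -/
def boundaryPoint (p : X) (s : ℝ) : X :=
  (extChartAt (𝓡∂ 2) p).symm (extChartAt (𝓡∂ 2) p p + s • EuclideanSpace.single (1 : Fin 2) (1 : ℝ))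

/-- For a boundary point `p`: the normal component of `v` along the boundary in the preferred chart
at `p`, as a function of the boundary coordinate `s` centred at `p`. This is the section of
the normal line bundle `TX|_{∂X} / T(∂X)` induced by `v`, in the local trivialization that
the chart at `p` gives. -/
def normalComponent (v : ∀ x : X, TangentSpace (𝓡∂ 2) x) (p : X) (s : ℝ) : ℝ :=
  tangentCoord
    (mfderiv (𝓡∂ 2) 𝓘(ℝ, EuclideanSpace ℝ (Fin 2)) (extChartAt (𝓡∂ 2) p) (boundaryPoint p s)
      (v (boundaryPoint p s))) 0

/-- `v` is boundary generic:
* the section of the normal bundle `TX|_{∂X} / T(∂X)` induced by `v` is transversal to the zero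
  section, i.e. its derivative along the boundary is nonzero wherever it vanishes;
* the section of the line bundle `T(∂X)` over the zero-dimensional locus `∂₂X(v)` given by `v` is
  transversal to the zero section, i.e. it vanishes nowhere. -/
def IsBoundaryGeneric (v : ∀ x : X, TangentSpace (𝓡∂ 2) x) : Prop :=
  (∀ p ∈ tangencyLocus v, deriv (normalComponent v p) 0 ≠ 0) ∧
    ∀ p ∈ tangencyLocus v, tangentCoord (v p) 1 ≠ 0

/-- The locus `∂₂⁺X(v)` of those points of `∂₂X(v)` at which `v`, which is tangent to the boundary
there, points inside the locus `∂₁⁺X(v)`. -/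
def tangencyPlus (v : ∀ x : X, TangentSpace (𝓡∂ 2) x) : Set X :=
  {p | p ∈ tangencyLocus v ∧
    ∀ᶠ t : ℝ in 𝓝[>] 0, boundaryPoint p (t * tangentCoord (v p) 1) ∈ inwardLocus v}

/-- `v` is boundary convex: it is boundary generic and `∂₂⁺X(v)` is empty. -/
def IsBoundaryConvex (v : ∀ x : X, TangentSpace (𝓡∂ 2) x) : Prop :=
  IsBoundaryGeneric v ∧ tangencyPlus v = ∅

variable (X) in
/-- `X` is diffeomorphic to the subset `S` of the plane: there are smooth maps from `X` to `S` and
from `S` to `X` that are inverse to each other. -/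
def IsDiffeomorphicTo (S : Set (EuclideanSpace ℝ (Fin 2))) : Prop :=
  ∃ (φ : X → EuclideanSpace ℝ (Fin 2)) (ψ : EuclideanSpace ℝ (Fin 2) → X),
    ContMDiff (𝓡∂ 2) 𝓘(ℝ, EuclideanSpace ℝ (Fin 2)) ∞ φ ∧
    ContMDiffOn 𝓘(ℝ, EuclideanSpace ℝ (Fin 2)) (𝓡∂ 2) ∞ ψ S ∧
    (∀ x, φ x ∈ S) ∧ (∀ x, ψ (φ x) = x) ∧ ∀ y ∈ S, φ (ψ y) = y

end Surface

/-- The closed unit disk in the plane. -/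
def closedDisk : Set (EuclideanSpace ℝ (Fin 2)) := {y | ‖y‖ ≤ 1}

/-- A closed round annulus in the plane. -/
def closedAnnulus : Set (EuclideanSpace ℝ (Fin 2)) := {y | 1 ≤ ‖y‖ ∧ ‖y‖ ≤ 2}

end

section

open Set Filter MeasureTheory

/-! ### Integrals depending on a parameter -/

/-! The surface is swept out by the trajectories of `v`, and its shape is read off from the space of
trajectories.

Every point has a flow box (`nonempty_flowBox`): coordinates `(t, σ)` with `σ` constant and `t`
increasing along `v`, whose image is an open square, a square cut off where trajectories enter or
leave, or, at a tangency, the parabolic region `t ^ 2 ≤ σ < ε`. The last shape is what convexity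
means: a tangency is a trajectory reduced to one point, and the nearby trajectories are short arcs
`|t| ≤ √σ`.

Near its finitely many critical points the Morse function is corrected by box times, which gives a
function `f` increasing strictly along `v` everywhere (`exists_lyapunov`). There is then no
recurrence, and by compactness every trajectory (a leaf, parametrized by the values of `f`) has an
upper and a lower end point, `top x` and `bot x`. In box coordinates the end points depend smoothly
on the leaf, away from the one-point leaves (`FlowSystem.topSmooth`).

The space of leaves, realized as the set `Tops` of upper end points, is therefore a compact
connected curve whose end points are exactly the tangencies (`FlowSystem.topAtlas`). Gluing a length
element makes all changes of chart isometries (`CurveAtlas.exists_geodesicAtlas`). A unit speed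
curve then runs forever, fills the space, and must return; it closes up to a circle, or bounces
between two end points of an arc (`exists_closed_geodesic`, `exists_geodesic_arc`).

If there are no tangencies, the angle of the leaf on the circle and the relative height on the leaf
are polar coordinates on an annulus. If there is a tangency, the leaf parameter rescaled to `[-1,
1]` is the abscissa `a`, and the leaf is mapped onto the vertical chord of the unit disk over `a`.
Smoothness at the two tips holds once the height has been normalized to be the box time there: both
the leaf and the chord then have half length of the order of the square root of the leaf parameter.
Both maps are injective immersions onto their targets, hence diffeomorphisms
(`isDiffeomorphicTo_of_immersion`). -/

theorem contDiff_intervalIntegral_param {E : Type} [NormedAddCommGroup E] [NormedSpace ℝ E]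
    [ProperSpace E] (n : ℕ) : ∀ {F : Type} [NormedAddCommGroup F] [NormedSpace ℝ F]
    [CompleteSpace F] {H : E → ℝ → F},
    ContDiff ℝ n (fun z : E × ℝ => H z.1 z.2) →
      ContDiff ℝ n (fun x => ∫ θ in (0 : ℝ)..1, H x θ) := by
  induction n with
  | zero =>
    intro F _ _ _ H hH
    have hc : Continuous (Function.uncurry H) := hH.continuous
    simp [intervalIntegral.continuous_parametric_intervalIntegral_of_continuous' hc 0 1]
  | succ n ih =>
    intro F _ _ _ H hH
    have hdiff : Differentiable ℝ (fun z : E × ℝ => H z.1 z.2) := hH.differentiable (by simp)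
    have hH' : ContDiff ℝ n (fun z : E × ℝ =>
        (fderiv ℝ (fun z : E × ℝ => H z.1 z.2) z).comp (ContinuousLinearMap.inl ℝ E ℝ)) := by
      have := hH.fderiv_right (m := n) (by norm_cast)
      exact this.clm_comp contDiff_const
    have hd : ∀ x θ, HasFDerivAt (fun x => H x θ)
        ((fderiv ℝ (fun z : E × ℝ => H z.1 z.2) (x, θ)).comp (ContinuousLinearMap.inl ℝ E ℝ)) x := by
      intro x θ
      have h1 := (hdiff (x, θ)).hasFDerivAt
      have h2 : HasFDerivAt (fun x : E => (x, θ)) (ContinuousLinearMap.inl ℝ E ℝ) x :=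
        hasFDerivAt_prodMk_left x θ
      exact HasFDerivAt.comp x h1 h2
    push_cast
    rw [contDiff_succ_iff_hasFDerivAt]
    -- The derivative takes values in `E →L[ℝ] F`, so the induction hypothesis must be available for
    -- all target spaces.
    refine ⟨_, ih (H := fun x θ =>
      (fderiv ℝ (fun z : E × ℝ => H z.1 z.2) (x, θ)).comp (ContinuousLinearMap.inl ℝ E ℝ)) hH', ?_⟩
    intro x₀
    obtain ⟨C, hC⟩ := ((isCompact_closedBall x₀ 1).prod (isCompact_Icc (a := (0 : ℝ)) (b := 1))
      ).exists_bound_of_continuousOn hH'.continuous.continuousOn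
    refine (intervalIntegral.hasFDerivAt_integral_of_dominated_of_fderiv_le
      (F' := fun x θ => (fderiv ℝ (fun z : E × ℝ => H z.1 z.2) (x, θ)).comp
        (ContinuousLinearMap.inl ℝ E ℝ)) (bound := fun _ => C) (s := Metric.closedBall x₀ 1)
      (Metric.closedBall_mem_nhds x₀ one_pos) ?_ ?_ ?_ ?_ ?_ ?_)
    · refine Eventually.of_forall fun x => ?_
      exact (hH.continuous.comp (by fun_prop : Continuous fun θ : ℝ => (x, θ))).aestronglyMeasurable
    · exact (hH.continuous.comp (by fun_prop : Continuous fun θ : ℝ => (x₀, θ))).intervalIntegrable _ _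
    · exact (hH'.continuous.comp
        (by fun_prop : Continuous fun θ : ℝ => (x₀, θ))).aestronglyMeasurable
    · refine Eventually.of_forall fun θ hθ x hx => hC (x, θ) ⟨hx, ?_⟩
      rw [uIoc_of_le zero_le_one] at hθ
      exact ⟨hθ.1.le, hθ.2⟩
    · exact intervalIntegrable_const
    · exact Eventually.of_forall fun θ _ x _ => hd x θ

theorem intervalIntegral_eq_mul_unit (h : ℝ → ℝ) (t : ℝ) :
    ∫ r in (0 : ℝ)..t, h r = t * ∫ θ in (0 : ℝ)..1, h (t * θ) := by
  simp

/-- The substitution `r = z.1 * θ` moves the variable end point into the integrand and leaves the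
fixed interval `[0, 1]`. -/
theorem contDiff_primitive {n : ℕ} {h : ℝ → ℝ → ℝ}
    (hh : ContDiff ℝ n (fun z : ℝ × ℝ => h z.1 z.2)) :
    ContDiff ℝ n (fun z : ℝ × ℝ => ∫ r in (0 : ℝ)..z.1, h r z.2) := by
  have : (fun z : ℝ × ℝ => ∫ r in (0 : ℝ)..z.1, h r z.2) =
      fun z : ℝ × ℝ => z.1 * ∫ θ in (0 : ℝ)..1, h (z.1 * θ) z.2 := by
    funext z
    exact intervalIntegral_eq_mul_unit (fun r => h r z.2) z.1
  rw [this]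
  refine contDiff_fst.mul (contDiff_intervalIntegral_param n (H := fun (z : ℝ × ℝ) θ =>
    h (z.1 * θ) z.2) ?_)
  exact hh.comp (f := fun w : (ℝ × ℝ) × ℝ => (w.1.1 * w.2, w.1.2)) (by fun_prop)

/-- **Hadamard's lemma** on the line. -/
theorem exists_smooth_factor {b : ℝ → ℝ} (hb : ContDiff ℝ ∞ b) (h0 : b 0 = 0) :
    ∃ m : ℝ → ℝ, ContDiff ℝ ∞ m ∧ (∀ t, b t = t * m t) ∧ m 0 = deriv b 0 := by
  have hb' : ContDiff ℝ ∞ (deriv b) := (contDiff_infty_iff_deriv.1 hb).2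
  refine ⟨fun t => ∫ θ in (0 : ℝ)..1, deriv b (t * θ), ?_, ?_, by simp⟩
  · rw [contDiff_infty]
    intro n
    refine contDiff_intervalIntegral_param n (H := fun (t : ℝ) θ => deriv b (t * θ)) ?_
    exact (hb'.of_le (by exact_mod_cast le_top)).comp
      (f := fun w : ℝ × ℝ => w.1 * w.2) (by fun_prop)
  · intro t
    rw [← intervalIntegral_eq_mul_unit (deriv b) t, intervalIntegral.integral_deriv_eq_sub]
    · simp [h0]
    · exact fun x _ => hb.differentiable (by simp) x
    · exact hb'.continuous.intervalIntegrable _ _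

/-! ### Scalar differential equations -/

/-- The global bounds on `g` allow Picard-Lindelöf on every `[-T, T]`. The solutions agree where
they overlap, and at time `t` the one for `T = |t| + 1` is used. -/
theorem exists_global_solution {g : ℝ × ℝ → ℝ} (hg : Continuous g) {K M : NNReal}
    (hK : ∀ t, LipschitzWith K (fun y => g (t, y))) (hM : ∀ z, ‖g z‖ ≤ M) (s : ℝ) :
    ∃ y : ℝ → ℝ, y 0 = s ∧ ∀ t, HasDerivAt y (g (t, y t)) t := by
  have key : ∀ T : ℝ, 0 < T → ∃ y : ℝ → ℝ, y 0 = s ∧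
      ∀ t ∈ Ioo (-T) T, HasDerivAt y (g (t, y t)) t := by
    intro T hT
    have hP : IsPicardLindelof (fun t y => g (t, y)) (tmin := -T) (tmax := T)
        ⟨0, by constructor <;> linarith⟩ s (M * T.toNNReal) 0 M K := by
      refine ⟨fun t _ => (hK t).lipschitzOnWith, fun y _ => ?_, fun t _ y _ => hM _, ?_⟩
      · exact (hg.comp (by fun_prop)).continuousOn
      · simp [hT.le]
    obtain ⟨y, hy0, hy⟩ := hP.exists_eq_forall_mem_Icc_hasDerivWithinAt₀
    exact ⟨y, hy0, fun t ht => (hy t (Ioo_subset_Icc_self ht)).hasDerivAt (Icc_mem_nhds ht.1 ht.2)⟩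
  choose! y hy0 hy using key
  have huniq : ∀ T T', 0 < T → T ≤ T' → ∀ t ∈ Ioo (-T) T, y T t = y T' t := by
    intro T T' hT hTT' t ht
    refine ODE_solution_unique_of_mem_Ioo (v := fun t y => g (t, y)) (s := fun _ => univ) (K := K)
      (a := -T) (b := T) (t₀ := 0) (fun t _ => (hK t).lipschitzOnWith) (by constructor <;> linarith)
      (fun t ht => ⟨hy T hT t ht, trivial⟩) (fun t ht => ⟨hy T' (by linarith) t
        ⟨by linarith [ht.1], by linarith [ht.2]⟩, trivial⟩) ?_ ht
    rw [hy0 T hT, hy0 T' (by linarith)]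
  refine ⟨fun t => y (|t| + 1) t, by simpa using hy0 1 one_pos, fun t => ?_⟩
  have hT : (0 : ℝ) < |t| + 2 := by positivity
  have h1 : ∀ t' : ℝ, |t'| ≤ |t| + 1 → y (|t'| + 1) t' = y (|t| + 2) t' := by
    intro t' ht'
    exact huniq _ _ (by positivity) (by linarith) t'
      ⟨by linarith [neg_abs_le t'], by linarith [le_abs_self t']⟩
  have h2 : (fun t' => y (|t'| + 1) t') =ᶠ[𝓝 t] y (|t| + 2) := by
    have : ∀ᶠ t' in 𝓝 t, |t'| < |t| + 1 :=
      (continuous_abs.tendsto t).eventually (gt_mem_nhds (by linarith))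
    filter_upwards [this] with t' ht' using h1 t' ht'.le
  beta_reduce
  rw [h1 t (by linarith)]
  exact (hy _ hT t ⟨by linarith [neg_abs_le t], by linarith [le_abs_self t]⟩).congr_of_eventuallyEq h2

/-- The solution map of a scalar differential equation with a compactly supported right hand side
of class `C^(k+1)` is a diffeomorphism of class `C^(k+1)`. -/
theorem exists_solution_map (k : ℕ) {g : ℝ × ℝ → ℝ} (hg : ContDiff ℝ (k + 1) g)
    (hgs : HasCompactSupport g) :
    ∃ Y : ℝ × ℝ → ℝ, ContDiff ℝ (k + 1) Y ∧ (∀ s, Y (0, s) = s) ∧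
      (∀ t s, HasDerivAt (fun t => Y (t, s)) (g (t, Y (t, s))) t) ∧
      ∃ D : ℝ × ℝ → ℝ, (∀ z, 0 < D z) ∧ Continuous D ∧ (∀ s, D (0, s) = 1) ∧
        ∀ t s, HasDerivAt (fun s => Y (t, s)) (D (t, s)) s := by
  have hgc : Continuous g := hg.continuous
  have hgd : Differentiable ℝ g := hg.differentiable (by simp)
  obtain ⟨M₀, hM₀⟩ := hgs.exists_bound_of_continuous hgc
  obtain ⟨K, hK⟩ := hg.lipschitzWith_of_hasCompactSupport hgs (by simp)
  have hKt : ∀ t, LipschitzWith K (fun y => g (t, y)) := fun t => by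
    have := hK.comp (LipschitzWith.prodMk_left t)
    simpa using! this
  have hM : ∀ z, ‖g z‖ ≤ (M₀.toNNReal : ℝ) := fun z =>
    (hM₀ z).trans (Real.le_coe_toNNReal M₀)
  choose y hy0 hy using exists_global_solution hgc hKt hM
  set Y : ℝ × ℝ → ℝ := fun z => y z.2 z.1 with hY
  set g₂ : ℝ × ℝ → ℝ := fun z => fderiv ℝ g z (0, 1) with hg₂
  have hg₂k : ContDiff ℝ k g₂ := (hg.fderiv_right (m := k) le_rfl).clm_apply contDiff_const
  have hg₂d : ∀ t a, HasDerivAt (fun a => g (t, a)) (g₂ (t, a)) a := fun t a => by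
    have h2 : HasDerivAt (fun a : ℝ => (t, a)) ((0 : ℝ), (1 : ℝ)) a :=
      (hasDerivAt_const a t).prodMk (hasDerivAt_id a)
    exact (hgd (t, a)).hasFDerivAt.comp_hasDerivAt a h2
  have hg₂K : ∀ z, |g₂ z| ≤ K := fun z => by
    have := norm_deriv_le_of_lipschitz (hKt z.1) (x₀ := z.2)
    rwa [(hg₂d z.1 z.2).deriv] at this
  -- The mean of `∂g/∂y` between `a` and `b`. It turns the difference of two solutions into a
  -- solution of a linear equation, without any prior differentiability in the initial value.
  set G : ℝ → ℝ → ℝ → ℝ := fun t a b => ∫ θ in (0 : ℝ)..1, g₂ (t, a + (b - a) * θ) with hG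
  have hGc : Continuous (fun w : ℝ × ℝ × ℝ => G w.1 w.2.1 w.2.2) := by
    refine intervalIntegral.continuous_parametric_intervalIntegral_of_continuous'
      (f := fun (w : ℝ × ℝ × ℝ) θ => g₂ (w.1, w.2.1 + (w.2.2 - w.2.1) * θ)) ?_ 0 1
    exact hg₂k.continuous.comp (f := fun p : (ℝ × ℝ × ℝ) × ℝ =>
      (p.1.1, p.1.2.1 + (p.1.2.2 - p.1.2.1) * p.2)) (by fun_prop)
  have hGeq : ∀ t a b, g (t, b) - g (t, a) = G t a b * (b - a) := by
    intro t a b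
    have h := intervalIntegral_eq_mul_unit (fun x => g₂ (t, a + x)) (b - a)
    have h3 : ∫ x in (0 : ℝ)..(b - a), g₂ (t, a + x) = g (t, b) - g (t, a) := by
      rw [intervalIntegral.integral_eq_sub_of_hasDerivAt (f := fun x => g (t, a + x))]
      · simp
      · intro x _
        simpa using (hg₂d t (a + x)).comp_const_add a x
      · exact (hg₂k.continuous.comp (by fun_prop)).intervalIntegrable _ _
    rw [← h3, h, mul_comm]
  have hGK : ∀ t a b, |G t a b| ≤ K := by
    intro t a b
    have := intervalIntegral.norm_integral_le_of_norm_le_const (a := (0 : ℝ)) (b := 1) (C := K)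
      (f := fun θ => g₂ (t, a + (b - a) * θ)) (fun θ _ => hg₂K _)
    simpa using this
  have hyc : ∀ s, Continuous (y s) := fun s =>
    continuous_iff_continuousAt.2 fun t => (hy s t).continuousAt
  have hqc : ∀ s s', Continuous (fun r => G r (y s r) (y s' r)) := fun s s' =>
    hGc.comp (f := fun r => (r, y s r, y s' r)) (by have := hyc s; have := hyc s'; fun_prop)
  -- The difference `u` of two solutions satisfies `u' = G u`, hence is its initial value times an
  -- exponential. Continuity of `Y` and, letting `s'` tend to `s`, the derivative `D` in the initial
  -- value both come from this formula.
  have hdiv : ∀ t s s', y s' t - y s t =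
      (s' - s) * Real.exp (∫ r in (0 : ℝ)..t, G r (y s r) (y s' r)) := by
    intro t s s'
    set Q : ℝ → ℝ := fun t => ∫ r in (0 : ℝ)..t, G r (y s r) (y s' r) with hQ
    have hQ' : ∀ t, HasDerivAt Q (G t (y s t) (y s' t)) t := fun t =>
      intervalIntegral.integral_hasDerivAt_right ((hqc s s').intervalIntegrable _ _)
        ((hqc s s').stronglyMeasurableAtFilter _ _) (hqc s s').continuousAt
    have hconst : ∀ t, HasDerivAt (fun t => (y s' t - y s t) * Real.exp (-Q t)) 0 t := by
      intro t
      refine (((hy s' t).sub (hy s t)).mul ((hQ' t).neg.exp)).congr_deriv ?_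
      simp only [Pi.sub_apply, Pi.neg_apply]
      linear_combination (Real.exp (-Q t)) * hGeq t (y s t) (y s' t)
    have h5 := is_const_of_deriv_eq_zero (fun t => (hconst t).differentiableAt)
      (fun t => (hconst t).deriv) t 0
    have h6 : Q 0 = 0 := by simp [hQ]
    beta_reduce at h5
    rw [h6, hy0, hy0, neg_zero, Real.exp_zero, mul_one] at h5
    rw [← h5, mul_assoc, ← Real.exp_add, neg_add_cancel, Real.exp_zero, mul_one]
  have hexp : ∀ t s s', Real.exp (∫ r in (0 : ℝ)..t, G r (y s r) (y s' r)) ≤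
      Real.exp (K * |t|) := by
    intro t s s'
    refine Real.exp_le_exp.2 ?_
    have := intervalIntegral.norm_integral_le_of_norm_le_const (a := (0 : ℝ)) (b := t) (C := K)
      (f := fun r => G r (y s r) (y s' r)) (fun r _ => hGK _ _ _)
    simp only [sub_zero] at this
    exact (le_abs_self _).trans this
  have hYc : Continuous Y := by
    rw [continuous_iff_continuousAt]
    rintro ⟨t₀, s₀⟩
    have hb : ∀ z : ℝ × ℝ, ‖Y z - Y (t₀, s₀)‖ ≤
        |z.2 - s₀| * Real.exp (K * |z.1|) + |y s₀ z.1 - y s₀ t₀| := by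
      intro z
      have : Y z - Y (t₀, s₀) = (y z.2 z.1 - y s₀ z.1) + (y s₀ z.1 - y s₀ t₀) := by simp [hY]
      rw [this]
      refine (norm_add_le _ _).trans (add_le_add ?_ le_rfl)
      rw [hdiv z.1 s₀ z.2, norm_mul, Real.norm_eq_abs, Real.norm_eq_abs, Real.abs_exp]
      exact mul_le_mul_of_nonneg_left (hexp _ _ _) (abs_nonneg _)
    have hlim : Tendsto (fun z : ℝ × ℝ =>
        |z.2 - s₀| * Real.exp (K * |z.1|) + |y s₀ z.1 - y s₀ t₀|) (𝓝 (t₀, s₀)) (𝓝 0) := by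
      have hc : Continuous (fun z : ℝ × ℝ =>
        |z.2 - s₀| * Real.exp (K * |z.1|) + |y s₀ z.1 - y s₀ t₀|) := by
        have := hyc s₀
        fun_prop
      simpa using hc.tendsto (t₀, s₀)
    rw [ContinuousAt, tendsto_iff_norm_sub_tendsto_zero]
    exact squeeze_zero (fun _ => norm_nonneg _) hb hlim
  set D : ℝ × ℝ → ℝ := fun z => Real.exp (∫ r in (0 : ℝ)..z.1, g₂ (r, Y (r, z.2))) with hD
  have hDs : ∀ t s, HasDerivAt (fun s => Y (t, s)) (D (t, s)) s := by
    intro t s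
    have hcont : Continuous (fun s' => Real.exp (∫ r in (0 : ℝ)..t, G r (y s r) (y s' r))) := by
      refine Real.continuous_exp.comp ?_
      refine intervalIntegral.continuous_parametric_intervalIntegral_of_continuous'
        (f := fun s' r => G r (y s r) (y s' r)) ?_ 0 t
      have h1 : Continuous fun p : ℝ × ℝ => y p.1 p.2 := hYc.comp (continuous_swap)
      have h2 := hyc s
      exact hGc.comp (f := fun p : ℝ × ℝ => (p.2, y s p.2, y p.1 p.2)) (by fun_prop)
    have hval : Real.exp (∫ r in (0 : ℝ)..t, G r (y s r) (y s r)) = D (t, s) := by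
      simp [hD, hG, hY]
    rw [hasDerivAt_iff_tendsto_slope]
    have h3 : Tendsto (fun s' => Real.exp (∫ r in (0 : ℝ)..t, G r (y s r) (y s' r))) (𝓝[≠] s)
        (𝓝 (D (t, s))) := hval ▸ (hcont.tendsto s).mono_left nhdsWithin_le_nhds
    refine h3.congr' ?_
    filter_upwards [self_mem_nhdsWithin] with s' hs'
    have hs'' : s' - s ≠ 0 := sub_ne_zero.2 hs'
    rw [slope_def_field]
    change _ = (y s' t - y s t) / _
    rw [hdiv t s s']
    field_simp
  have hDc : ∀ m : ℕ, m ≤ k → ContDiff ℝ m Y → ContDiff ℝ m D := by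
    intro m hm hYm
    refine (contDiff_primitive (h := fun r s => g₂ (r, Y (r, s))) ?_).exp
    exact (hg₂k.of_le (by exact_mod_cast hm)).comp (contDiff_fst.prodMk hYm)
  have hYf : ∀ z : ℝ × ℝ, HasFDerivAt Y (((1 : ℝ →L[ℝ] ℝ).smulRight (g (z.1, Y z))).coprod
      ((1 : ℝ →L[ℝ] ℝ).smulRight (D z))) z := by
    intro z
    have hDcont : Continuous D := (hDc 0 (Nat.zero_le _) (by simpa using hYc)).continuous
    have := hasStrictFDerivAt_uncurry_coprod (𝕜 := ℝ) (u := z) (f := fun t s => Y (t, s))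
      (f₁ := fun t s => (1 : ℝ →L[ℝ] ℝ).smulRight (g (t, Y (t, s))))
      (f₂ := fun t s => (1 : ℝ →L[ℝ] ℝ).smulRight (D (t, s)))
      (Eventually.of_forall fun v => (hy v.2 v.1).hasFDerivAt)
      (Eventually.of_forall fun v => (hDs v.1 v.2).hasFDerivAt)
      (by
        refine Continuous.continuousAt ?_
        change Continuous fun z : ℝ × ℝ => (1 : ℝ →L[ℝ] ℝ).smulRight (g (z.1, Y z))
        exact (ContinuousLinearMap.smulRightL ℝ ℝ ℝ 1).continuous.comp
          (hgc.comp (continuous_fst.prodMk hYc)))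
      (by
        refine Continuous.continuousAt ?_
        change Continuous fun z : ℝ × ℝ => (1 : ℝ →L[ℝ] ℝ).smulRight (D z)
        exact (ContinuousLinearMap.smulRightL ℝ ℝ ℝ 1).continuous.comp hDcont)
    exact this.hasFDerivAt
  -- Bootstrap: the partial derivatives of `Y` are `g (t, Y)` and the exponential of an integral of
  -- `g₂` along `Y`, so both are `C^m` when `Y` is.
  have hYm : ∀ m : ℕ, m ≤ k + 1 → ContDiff ℝ m Y := by
    intro m
    induction m with
    | zero => intro _; simpa using hYc
    | succ m ih =>
      intro hm
      have hm1 := ih (by omega)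
      push_cast
      rw [contDiff_succ_iff_hasFDerivAt]
      refine ⟨_, ?_, hYf⟩
      have h1 : ContDiff ℝ m fun z : ℝ × ℝ => g (z.1, Y z) :=
        (hg.of_le (by exact_mod_cast (by omega : m ≤ k + 1))).comp (contDiff_fst.prodMk hm1)
      have h2 := hDc m (by omega) hm1
      have h3 : ∀ z : ℝ × ℝ, ((1 : ℝ →L[ℝ] ℝ).smulRight (g (z.1, Y z))).coprod
          ((1 : ℝ →L[ℝ] ℝ).smulRight (D z)) = g (z.1, Y z) • ContinuousLinearMap.fst ℝ ℝ ℝ +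
            D z • ContinuousLinearMap.snd ℝ ℝ ℝ := by
        intro z
        ext <;> simp
      simp only [h3]
      exact (h1.smul contDiff_const).add (h2.smul contDiff_const)
  refine ⟨Y, by exact_mod_cast hYm (k + 1) le_rfl, hy0, fun t s => hy s t, D,
    fun z => Real.exp_pos _, (hDc 0 (Nat.zero_le _) (by simpa using hYc)).continuous,
    fun s => by simp [hD], hDs⟩

end

section

open Set Filter MeasureTheory

/-! ### Extension across a line -/

/-- The coefficients are the Lagrange basis polynomials for the nodes `-(j + 1)` evaluated at `1`:
interpolation at `k + 1` nodes reproduces `X ^ i` for `i ≤ k`. -/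
theorem exists_reflection_coefficients (k : ℕ) :
    ∃ a : ℕ → ℝ, ∀ i ≤ k, ∑ j ∈ Finset.range (k + 1), a j * (-((j : ℝ) + 1)) ^ i = 1 := by
  set v : ℕ → ℝ := fun j => -((j : ℝ) + 1)
  have hv : Set.InjOn v (Finset.range (k + 1) : Finset ℕ) := by
    intro i _ j _ h
    have : (i : ℝ) = j := by simpa [v] using h
    exact_mod_cast this
  refine ⟨fun j => (Lagrange.basis (Finset.range (k + 1)) v j).eval 1, fun i hi => ?_⟩
  have h := Lagrange.eq_interpolate_of_eval_eq (s := Finset.range (k + 1)) (v := v)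
    (fun j => (v j) ^ i) (f := Polynomial.X ^ i) hv
    (by rw [Polynomial.degree_X_pow, Finset.card_range]; exact_mod_cast Nat.lt_succ_of_le hi) (by simp)
  have h1 := congrArg (Polynomial.eval 1) h
  rw [Lagrange.interpolate_apply, Polynomial.eval_finsetSum] at h1
  simp only [Polynomial.eval_pow, Polynomial.eval_X, one_pow, Polynomial.eval_mul,
    Polynomial.eval_C] at h1
  exact (Finset.sum_congr rfl fun j _ => mul_comm _ _).trans h1.symm

/-- The closed right half plane. -/
def rightHalfPlane : Set (ℝ × ℝ) := {z | 0 ≤ z.1}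

/-- Extension of a function on the right half plane by a combination of reflections. -/
noncomputable def reflectionExtension {W : Type} [AddCommGroup W] [Module ℝ W] (N : ℕ) (a : ℕ → ℝ)
    (f : ℝ × ℝ → W) (z : ℝ × ℝ) : W :=
  open scoped Classical in
  if 0 ≤ z.1 then f z else ∑ j ∈ Finset.range N, a j • f (-((j : ℝ) + 1) * z.1, z.2)

section Reflection

variable {W : Type} [NormedAddCommGroup W] [NormedSpace ℝ W]

theorem reflectionExtension_of_nonneg {N : ℕ} {a : ℕ → ℝ} {f : ℝ × ℝ → W} {z : ℝ × ℝ}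
    (hz : 0 ≤ z.1) : reflectionExtension N a f z = f z := if_pos hz

theorem reflectionExtension_of_nonpos {N : ℕ} {a : ℕ → ℝ}
    (ha : ∑ j ∈ Finset.range N, a j = 1) {f : ℝ × ℝ → W} {z : ℝ × ℝ} (hz : z.1 ≤ 0) :
    reflectionExtension N a f z =
      ∑ j ∈ Finset.range N, a j • f (-((j : ℝ) + 1) * z.1, z.2) := by
  rcases hz.lt_or_eq with h | h
  · exact if_neg (not_le.2 h)
  · rw [reflectionExtension_of_nonneg h.ge]
    have : ∀ j : ℕ, ((-((j : ℝ) + 1) * z.1, z.2) : ℝ × ℝ) = z := fun j => by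
      rw [h]; ext <;> simp [h]
    simp only [this, ← Finset.sum_smul, ha, one_smul]

theorem uniqueDiffOn_rightHalfPlane : UniqueDiffOn ℝ rightHalfPlane := by
  have : rightHalfPlane = Ici (0 : ℝ) ×ˢ (univ : Set ℝ) := by
    ext z; simp [rightHalfPlane]
  rw [this]
  exact (uniqueDiffOn_Ici 0).prod uniqueDiffOn_univ

/-- The moment conditions on `a` match the normal derivatives up to order `k` on the axis.
Differentiating across the axis replaces `a j` by `a j * -(j + 1)`, which shifts the conditions by
one, while differentiating along the axis keeps `a`; this is an induction on `k`. The number `N` of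
reflections stays fixed as `k` drops. -/
theorem contDiff_reflectionExtension (k N : ℕ) : ∀ {W : Type} [NormedAddCommGroup W]
    [NormedSpace ℝ W] {a : ℕ → ℝ} {f : ℝ × ℝ → W},
    (∀ i ≤ k, ∑ j ∈ Finset.range N, a j * (-((j : ℝ) + 1)) ^ i = 1) →
    ContDiffOn ℝ k f rightHalfPlane → ContDiff ℝ k (reflectionExtension N a f) := by
  have hL : ∀ (j : ℕ), MapsTo (fun z : ℝ × ℝ => (-((j : ℝ) + 1) * z.1, z.2)) {z | z.1 ≤ 0}
      rightHalfPlane := fun j z hz => by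
    have hz' : z.1 ≤ 0 := hz
    have : (0 : ℝ) ≤ (j : ℝ) + 1 := by positivity
    simp only [rightHalfPlane, mem_ofPred_eq]
    nlinarith
  have hclosed : IsClosed {z : ℝ × ℝ | z.1 ≤ 0} := isClosed_le continuous_fst continuous_const
  have hclosed' : IsClosed rightHalfPlane := isClosed_le continuous_const continuous_fst
  have hunion : rightHalfPlane ∪ {z : ℝ × ℝ | z.1 ≤ 0} = univ := by
    ext z; simp [rightHalfPlane, le_total]
  induction k with
  | zero =>
    intro W _ _ a f ha hf
    have ha0 : ∑ j ∈ Finset.range N, a j = 1 := by simpa using ha 0 le_rfl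
    simp only [Nat.cast_zero, contDiff_zero, contDiffOn_zero] at hf ⊢
    rw [← continuousOn_univ, ← hunion]
    refine ContinuousOn.union_of_isClosed ?_ ?_ hclosed' hclosed
    · exact hf.congr fun z hz => reflectionExtension_of_nonneg hz
    · refine ContinuousOn.congr (f := fun z =>
        ∑ j ∈ Finset.range N, a j • f (-((j : ℝ) + 1) * z.1, z.2)) ?_
        fun z hz => reflectionExtension_of_nonpos ha0 hz
      refine continuousOn_finsetSum _ fun j _ => ContinuousOn.const_smul ?_ _
      exact hf.comp (by fun_prop) (hL j)
  | succ k ih =>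
    intro W _ _ a f ha hf
    have ha0 : ∑ j ∈ Finset.range N, a j = 1 := by simpa using ha 0 (Nat.zero_le _)
    set A := fderivWithin ℝ f rightHalfPlane with hA
    have hAk : ContDiffOn ℝ k A rightHalfPlane :=
      hf.fderivWithin uniqueDiffOn_rightHalfPlane (by norm_cast)
    have hA' : ∀ z ∈ rightHalfPlane, HasFDerivWithinAt f (A z) rightHalfPlane z := fun z hz =>
      ((hf.differentiableOn (by simp)) z hz).hasFDerivWithinAt
    set a' : ℕ → ℝ := fun j => a j * (-((j : ℝ) + 1)) with ha'
    have h1 := ih (a := a') (f := fun z => A z (1, 0)) (by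
      intro i hi
      exact (Finset.sum_congr rfl fun j _ => by simp only [ha']; ring).trans (ha (i + 1) (by omega)))
      (hAk.clm_apply contDiffOn_const)
    have h2 := ih (a := a) (f := fun z => A z (0, 1)) (fun i hi => ha i (by omega))
      (hAk.clm_apply contDiffOn_const)
    set D : ℝ × ℝ → (ℝ × ℝ →L[ℝ] W) := fun z =>
      (ContinuousLinearMap.fst ℝ ℝ ℝ).smulRight (reflectionExtension N a' (fun z => A z (1, 0)) z) +
      (ContinuousLinearMap.snd ℝ ℝ ℝ).smulRight (reflectionExtension N a (fun z => A z (0, 1)) z)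
      with hD
    have ha'0 : ∑ j ∈ Finset.range N, a' j = 1 := by simpa [ha'] using ha 1 (by omega)
    push_cast
    rw [contDiff_succ_iff_hasFDerivAt]
    refine ⟨D, ?_, ?_⟩
    · exact (contDiff_const.smulRight h1).add (contDiff_const.smulRight h2)
    have hlin : ∀ (B : ℝ × ℝ →L[ℝ] W) (w : ℝ × ℝ), B w = w.1 • B (1, 0) + w.2 • B (0, 1) := by
      intro B w
      rw [← B.map_smul, ← B.map_smul, ← B.map_add]
      simp
    have hpos : ∀ z ∈ rightHalfPlane,
        HasFDerivWithinAt (reflectionExtension N a f) (D z) rightHalfPlane z := by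
      intro z hz
      refine ((hA' z hz).congr_fderiv ?_).congr (fun w hw => reflectionExtension_of_nonneg hw)
        (reflectionExtension_of_nonneg hz)
      ext <;> simp [hD, reflectionExtension_of_nonneg (show 0 ≤ z.1 from hz)]
    have hneg : ∀ z ∈ {z : ℝ × ℝ | z.1 ≤ 0},
        HasFDerivWithinAt (reflectionExtension N a f) (D z) {z | z.1 ≤ 0} z := by
      intro z hz
      have hj : ∀ j ∈ Finset.range N, HasFDerivWithinAt
          (fun z : ℝ × ℝ => a j • f (-((j : ℝ) + 1) * z.1, z.2))
          (a j • (A (-((j : ℝ) + 1) * z.1, z.2)).comp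
            (((-((j : ℝ) + 1)) • ContinuousLinearMap.fst ℝ ℝ ℝ).prod
              (ContinuousLinearMap.snd ℝ ℝ ℝ))) {z | z.1 ≤ 0} z := by
        intro j _
        refine HasFDerivWithinAt.const_smul ?_ _
        refine HasFDerivWithinAt.comp z (hA' _ (hL j hz)) (f := fun z : ℝ × ℝ =>
          (-((j : ℝ) + 1) * z.1, z.2)) ?_ (hL j)
        exact ((hasFDerivAt_fst.const_mul (-((j : ℝ) + 1))).prodMk hasFDerivAt_snd).hasFDerivWithinAt
      have := HasFDerivWithinAt.fun_sum hj
      refine (this.congr_fderiv ?_).congr (fun w hw => reflectionExtension_of_nonpos ha0 hw)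
        (reflectionExtension_of_nonpos ha0 hz)
      ext
      · simp only [hD, ContinuousLinearMap.coe_comp, Function.comp_apply,
          ContinuousLinearMap.inl_apply, sum_apply,
          add_apply, ContinuousLinearMap.smulRight_apply,
          reflectionExtension_of_nonpos ha'0 (show z.1 ≤ 0 from hz)]
        simp only [FunLike.coe_smul, Pi.smul_apply, ContinuousLinearMap.coe_comp,
          Function.comp_apply, ContinuousLinearMap.prod_apply, ContinuousLinearMap.coe_fst',
          ContinuousLinearMap.coe_snd', one_smul, zero_smul, add_zero]
        refine Finset.sum_congr rfl fun j _ => ?_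
        rw [hlin]
        simp [ha', mul_smul]
      · simp only [hD, ContinuousLinearMap.coe_comp, Function.comp_apply,
          ContinuousLinearMap.inr_apply, sum_apply,
          add_apply, ContinuousLinearMap.smulRight_apply,
          reflectionExtension_of_nonpos ha0 (show z.1 ≤ 0 from hz)]
        simp
    intro z
    rcases lt_trichotomy z.1 0 with h | h | h
    · refine (hneg z h.le).hasFDerivAt (mem_of_superset
        ((isOpen_lt continuous_fst continuous_const).mem_nhds h) fun w hw => ?_)
      exact le_of_lt (show w.1 < 0 from hw)
    · have := (hpos z h.ge).union (hneg z h.le)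
      rwa [hunion, hasFDerivWithinAt_univ] at this
    · refine (hpos z h.le).hasFDerivAt (mem_of_superset
        ((isOpen_lt continuous_const continuous_fst).mem_nhds h) fun w hw => ?_)
      exact le_of_lt (show 0 < w.1 from hw)

/-- A function of class `C^k` on the closed half plane has an extension of class `C^k`. -/
theorem exists_contDiff_extension {k : ℕ} {f : ℝ × ℝ → W}
    (hf : ContDiffOn ℝ k f rightHalfPlane) :
    ∃ F : ℝ × ℝ → W, ContDiff ℝ k F ∧ EqOn F f rightHalfPlane := by
  obtain ⟨a, ha⟩ := exists_reflection_coefficients k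
  exact ⟨_, contDiff_reflectionExtension k (k + 1) ha hf, fun z hz =>
    reflectionExtension_of_nonneg hz⟩

end Reflection

end

section

open Set Filter MeasureTheory

/-! ### Flows of planar fields `∂_t + g ∂_y` near the origin -/

/-- The curves `r ↦ (r, Y (r, s))`, followed from time `0` to time `t`, stay in `Ω`. -/
def staysIn (Ω : Set (ℝ × ℝ)) (Y : ℝ × ℝ → ℝ) : Set (ℝ × ℝ) :=
  {p | ∀ r ∈ uIcc 0 p.1, (r, Y (r, p.2)) ∈ Ω}

/-- The solution map `Y` of `y' = g (t, y)` with its inverse `S`; near the origin of `Ω` the field `G`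
is `g`. -/
structure PlanarFlow (Ω : Set (ℝ × ℝ)) (g : ℝ × ℝ → ℝ) where
  Y : ℝ × ℝ → ℝ
  S : ℝ × ℝ → ℝ
  G : ℝ × ℝ → ℝ
  D : ℝ × ℝ → ℝ
  contDiff_Y : ContDiff ℝ 1 Y
  contDiff_S : ContDiff ℝ 1 S
  Y_zero : ∀ s, Y (0, s) = s
  S_Y : ∀ t s, S (t, Y (t, s)) = s
  Y_S : ∀ t y, Y (t, S (t, y)) = y
  G_eq : ∀ z ∈ Ω, z ∈ Metric.ball (0 : ℝ × ℝ) 1 → G z = g z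
  deriv_Y : ∀ t s, HasDerivAt (fun t => Y (t, s)) (G (t, Y (t, s))) t
  D_pos : ∀ z, 0 < D z
  deriv_Y' : ∀ t s, HasDerivAt (fun s => Y (t, s)) (D (t, s)) s
  smooth_Y : ContDiffOn ℝ ∞ Y (staysIn Ω Y)
  smooth_S : ContDiffOn ℝ ∞ S {z | (z.1, S z) ∈ staysIn Ω Y}

/-- At each time `s ↦ Y (t, s)` is strictly increasing, and it is onto because it stays within `M *
|t|` of the identity. So `(t, s) ↦ (t, Y (t, s))` is a bijection with invertible derivative, and the
inverse function theorem applies. -/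
theorem exists_inverse_solution_map {k : ℕ} {Y G D : ℝ × ℝ → ℝ} {M : ℝ}
    (hY : ContDiff ℝ (k + 1) Y) (hY0 : ∀ s, Y (0, s) = s) (hM : ∀ z, ‖G z‖ ≤ M)
    (hG : ∀ t s, HasDerivAt (fun t => Y (t, s)) (G (t, Y (t, s))) t)
    (hD : ∀ z, 0 < D z) (hDs : ∀ t s, HasDerivAt (fun s => Y (t, s)) (D (t, s)) s) :
    ∃ S : ℝ × ℝ → ℝ, ContDiff ℝ (k + 1) S ∧ (∀ t s, S (t, Y (t, s)) = s) ∧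
      ∀ t y, Y (t, S (t, y)) = y := by
  have hbound : ∀ t s, |Y (t, s) - s| ≤ M * |t| := by
    intro t s
    have := Convex.norm_image_sub_le_of_norm_hasDerivWithin_le (f := fun t => Y (t, s))
      (f' := fun t => G (t, Y (t, s))) (s := univ) (x := 0) (y := t) (C := M)
      (fun x _ => (hG x s).hasDerivWithinAt) (fun x _ => hM _) convex_univ trivial trivial
    simpa [hY0] using this
  have hmono : ∀ t, StrictMono (fun s => Y (t, s)) := fun t =>
    strictMono_of_hasDerivAt_pos (fun s => hDs t s) (fun s => hD _)
  have hsurj : ∀ t, Function.Surjective (fun s => Y (t, s)) := by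
    intro t
    refine Continuous.surjective (hY.continuous.comp (by fun_prop)) ?_ ?_
    · refine tendsto_atTop_mono (f := fun s => s - M * |t|)
        (fun s => by have := abs_le.1 (hbound t s); linarith) ?_
      exact tendsto_atTop_add_const_right _ _ tendsto_id
    · refine tendsto_atBot_mono (g := fun s => Y (t, s)) (f := fun s => s + M * |t|)
        (fun s => by have := abs_le.1 (hbound t s); linarith) ?_
      exact tendsto_atBot_add_const_right _ _ tendsto_id
  choose S hS using hsurj
  set P : ℝ × ℝ → ℝ × ℝ := fun z => (z.1, Y z) with hP
  let e : ℝ × ℝ ≃ ℝ × ℝ :=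
    { toFun := P
      invFun := fun z => (z.1, S z.1 z.2)
      left_inv := fun z => by
        ext
        · rfl
        · exact (hmono z.1).injective (hS z.1 (Y z))
      right_inv := fun z => by
        ext
        · rfl
        · exact hS z.1 z.2 }
  have hPk : ContDiff ℝ (k + 1) P := contDiff_fst.prodMk hY
  have hYdiff : Differentiable ℝ Y := hY.differentiable (by simp)
  have hYf : ∀ z, fderiv ℝ Y z (0, 1) = D z := fun z => by
    have h2 : HasDerivAt (fun a : ℝ => (z.1, a)) ((0 : ℝ), (1 : ℝ)) z.2 :=
      (hasDerivAt_const z.2 z.1).prodMk (hasDerivAt_id z.2)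
    exact ((hYdiff z).hasFDerivAt.comp_hasDerivAt z.2 h2).unique (hDs z.1 z.2)
  have hPf : ∀ z, HasFDerivAt P ((ContinuousLinearMap.fst ℝ ℝ ℝ).prod (fderiv ℝ Y z)) z := fun z =>
    hasFDerivAt_fst.prodMk (hYdiff z).hasFDerivAt
  have hinj : ∀ z, Function.Injective
      ((ContinuousLinearMap.fst ℝ ℝ ℝ).prod (fderiv ℝ Y z) : ℝ × ℝ →L[ℝ] ℝ × ℝ) := by
    intro z
    rw [injective_iff_map_eq_zero]
    rintro ⟨a, b⟩ h
    simp only [ContinuousLinearMap.prod_apply, ContinuousLinearMap.coe_fst', Prod.mk_eq_zero] at h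
    obtain ⟨rfl, h2⟩ := h
    have : ((0, b) : ℝ × ℝ) = b • (0, 1) := by simp
    rw [this, map_smul, hYf, smul_eq_mul, mul_eq_zero] at h2
    rcases h2 with rfl | h2
    · rfl
    · exact absurd h2 (hD z).ne'
  set L : ℝ × ℝ → ((ℝ × ℝ) ≃L[ℝ] (ℝ × ℝ)) := fun z =>
    (LinearEquiv.ofInjectiveEndo _ (hinj z)).toContinuousLinearEquiv with hL
  have hPL : ∀ z, HasFDerivAt P (L z : (ℝ × ℝ) →L[ℝ] (ℝ × ℝ)) z := fun z => by
    convert hPf z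
    ext <;> rfl
  have hopen : IsOpenMap P := by
    rw [isOpenMap_iff_nhds_le]
    intro z
    have hst : HasStrictFDerivAt P (L z : (ℝ × ℝ) →L[ℝ] (ℝ × ℝ)) z :=
      hPk.contDiffAt.hasStrictFDerivAt' (hPL z) (by simp)
    exact hst.map_nhds_eq_of_equiv.ge
  set h := e.toHomeomorphOfContinuousOpen hPk.continuous hopen with hh
  have hsymm : ContDiff ℝ (k + 1) h.symm := h.contDiff_symm hPL hPk
  refine ⟨fun z => S z.1 z.2, contDiff_snd.comp hsymm, fun t s => ?_, fun t y => hS t y⟩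
  exact (hmono t).injective (hS t (Y (t, s)))

/-- The field on `Ω` has a `C^k` extension for each `k`, possibly a different one each time. The
flow of the first extension is used throughout; on orbits that stay in `Ω` it agrees, by uniqueness,
with the flow of every other extension, and is therefore smooth there. -/
theorem exists_planarFlow {Ω : Set (ℝ × ℝ)} {g : ℝ × ℝ → ℝ}
    (hext : ∀ k : ℕ, ∃ F : ℝ × ℝ → ℝ, ContDiff ℝ k F ∧ EqOn F g Ω) :
    Nonempty (PlanarFlow Ω g) := by
  let χ : ContDiffBump (0 : ℝ × ℝ) := ⟨1, 2, one_pos, one_lt_two⟩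
  choose F hF hFg using hext
  have hGk : ∀ k : ℕ, ContDiff ℝ (k + 1) (fun z => χ z * F (k + 1) z) := fun k =>
    χ.contDiff.mul (by exact_mod_cast hF (k + 1))
  have hGs : ∀ k : ℕ, HasCompactSupport (fun z => χ z * F (k + 1) z) := fun k =>
    χ.hasCompactSupport.mul_right
  choose Y hYk hY0 hYt D hD hDc hD0 hDs using fun k => exists_solution_map k (hGk k) (hGs k)
  have hbd : ∀ k, ∃ C, ∀ z, ‖χ z * F (k + 1) z‖ ≤ C := fun k =>
    (hGs k).exists_bound_of_continuous (hGk k).continuous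
  choose M hM using hbd
  choose S hSk hSY hYS using fun k =>
    exists_inverse_solution_map (hYk k) (hY0 k) (hM k) (hYt k) (hD k) (hDs k)
  have huniq : ∀ k, ∀ p ∈ staysIn Ω (Y 0), Y 0 p = Y k p := by
    rintro k ⟨t, s⟩ hp
    obtain ⟨K, hK⟩ := (hGk k).lipschitzWith_of_hasCompactSupport (hGs k) (by simp)
    have hKt : ∀ t, LipschitzWith K (fun y => χ (t, y) * F (k + 1) (t, y)) := fun t => by
      have := hK.comp (LipschitzWith.prodMk_left t)
      simpa using! this
    have heq : ∀ r ∈ uIcc 0 t, χ (r, Y 0 (r, s)) * F (0 + 1) (r, Y 0 (r, s)) =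
        χ (r, Y 0 (r, s)) * F (k + 1) (r, Y 0 (r, s)) := fun r hr => by
      rw [hFg _ (hp r hr), hFg _ (hp r hr)]
    have hc0 : Continuous fun r => Y 0 (r, s) := (hYk 0).continuous.comp (by fun_prop)
    have hck : Continuous fun r => Y k (r, s) := (hYk k).continuous.comp (by fun_prop)
    rcases le_total 0 t with ht | ht
    · rw [uIcc_of_le ht] at heq
      exact ODE_solution_unique_of_mem_Icc_right (a := 0) (b := t) (s := fun _ => univ)
        (v := fun t y => χ (t, y) * F (k + 1) (t, y))
        (f := fun r => Y 0 (r, s)) (g := fun r => Y k (r, s))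
        (fun t _ => (hKt t).lipschitzOnWith) hc0.continuousOn
        (fun r hr => (heq r (Ico_subset_Icc_self hr)) ▸ (hYt 0 r s).hasDerivWithinAt)
        (fun _ _ => trivial) hck.continuousOn (fun r _ => (hYt k r s).hasDerivWithinAt)
        (fun _ _ => trivial) (by simp only [hY0]) (right_mem_Icc.2 ht)
    · rw [uIcc_of_ge ht] at heq
      exact ODE_solution_unique_of_mem_Icc_left (a := t) (b := 0) (s := fun _ => univ)
        (v := fun t y => χ (t, y) * F (k + 1) (t, y))
        (f := fun r => Y 0 (r, s)) (g := fun r => Y k (r, s))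
        (fun t _ => (hKt t).lipschitzOnWith) hc0.continuousOn
        (fun r hr => (heq r (Ioc_subset_Icc_self hr)) ▸ (hYt 0 r s).hasDerivWithinAt)
        (fun _ _ => trivial) hck.continuousOn (fun r _ => (hYt k r s).hasDerivWithinAt)
        (fun _ _ => trivial) (by simp only [hY0]) (left_mem_Icc.2 ht)
  refine ⟨⟨Y 0, S 0, fun z => χ z * F (0 + 1) z, D 0, by simpa using hYk 0, by simpa using hSk 0,
    hY0 0, hSY 0, hYS 0, fun z hz hz1 => ?_, hYt 0, hD 0, hDs 0, ?_, ?_⟩⟩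
  · have : χ z = 1 := χ.one_of_mem_closedBall (Metric.ball_subset_closedBall hz1)
    simp only [this, one_mul]
    exact hFg _ hz
  · rw [contDiffOn_infty]
    intro k
    exact ((hYk k).of_le (by exact_mod_cast Nat.le_succ k)).contDiffOn.congr (huniq k)
  · rw [contDiffOn_infty]
    intro k
    refine ((hSk k).of_le (by exact_mod_cast Nat.le_succ k)).contDiffOn.congr fun z hz => ?_
    have h1 := huniq k _ hz
    rw [hYS 0] at h1
    have h2 := hSY k z.1 (S 0 z)
    rw [← h1] at h2
    exact h2.symm

namespace PlanarFlow

variable {Ω : Set (ℝ × ℝ)} {g : ℝ × ℝ → ℝ} (P : PlanarFlow Ω g)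

theorem strictMono_Y (t : ℝ) : StrictMono (fun s => P.Y (t, s)) :=
  strictMono_of_hasDerivAt_pos (fun s => P.deriv_Y' t s) (fun _ => P.D_pos _)

theorem strictMono_S (t : ℝ) : StrictMono (fun y => P.S (t, y)) := by
  intro y y' h
  have : P.Y (t, P.S (t, y)) < P.Y (t, P.S (t, y')) := by rwa [P.Y_S, P.Y_S]
  exact (P.strictMono_Y t).lt_iff_lt.1 this

theorem S_zero (y : ℝ) : P.S (0, y) = y := by
  have := P.S_Y 0 y
  rwa [P.Y_zero] at this

theorem differentiable_S : Differentiable ℝ P.S := P.contDiff_S.differentiable (by simp)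

theorem fderiv_S_flow (z : ℝ × ℝ) : fderiv ℝ P.S z (1, P.G z) = 0 := by
  set s := P.S z with hs
  have hz : (z.1, P.Y (z.1, s)) = z := by
    ext
    · rfl
    · exact P.Y_S z.1 z.2
  have h1 : HasDerivAt (fun t => (t, P.Y (t, s))) ((1 : ℝ), P.G z) z.1 := by
    have := (hasDerivAt_id z.1).prodMk (P.deriv_Y z.1 s)
    rwa [hz] at this
  have h2 : HasFDerivAt P.S (fderiv ℝ P.S z) (z.1, P.Y (z.1, s)) := by
    rw [hz]; exact (P.differentiable_S z).hasFDerivAt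
  have h3 := h2.comp_hasDerivAt z.1 h1
  have h4 : (P.S ∘ fun t => (t, P.Y (t, s))) = fun _ => s := by
    funext t
    exact P.S_Y t s
  rw [h4] at h3
  exact h3.unique (hasDerivAt_const _ _)

theorem fderiv_S_pos (z : ℝ × ℝ) : 0 < fderiv ℝ P.S z (0, 1) := by
  have h1 : HasDerivAt (fun s => (z.1, P.Y (z.1, s))) ((0 : ℝ), P.D (z.1, P.S z)) (P.S z) :=
    (hasDerivAt_const _ _).prodMk (P.deriv_Y' z.1 (P.S z))
  have hz : (z.1, P.Y (z.1, P.S z)) = z := by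
    ext
    · rfl
    · exact P.Y_S z.1 z.2
  have h2 : HasFDerivAt P.S (fderiv ℝ P.S z) (z.1, P.Y (z.1, P.S z)) := by
    rw [hz]; exact (P.differentiable_S z).hasFDerivAt
  have h3 := h2.comp_hasDerivAt (P.S z) h1
  have h4 : (P.S ∘ fun s => (z.1, P.Y (z.1, s))) = id := by
    funext s
    exact P.S_Y z.1 s
  rw [h4] at h3
  have h5 := h3.unique (hasDerivAt_id _)
  have h6 : ((0 : ℝ), P.D (z.1, P.S z)) = P.D (z.1, P.S z) • ((0 : ℝ), (1 : ℝ)) := by simp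
  rw [h6, map_smul, smul_eq_mul] at h5
  have := P.D_pos (z.1, P.S z)
  by_contra hneg
  push Not at hneg
  nlinarith

end PlanarFlow

end

section

open Set Filter MeasureTheory

/-! ### Planar flow boxes -/

/-- The four shapes of a flow box in a surface with boundary convex field: around an interior point,
around a point where the field enters or leaves, and around a point of convex tangency. -/
inductive BoxKind
  | inner
  | entry
  | exit
  | tangent

/-- The standard region that a flow box of a given kind and size is modelled on; the field is vertical,
i.e. it points along the first coordinate. -/
def boxRegion : BoxKind → ℝ → Set (ℝ × ℝ)
  | .inner, ε => Ioo (-ε) ε ×ˢ Ioo (-ε) ε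
  | .entry, ε => Ico 0 ε ×ˢ Ioo (-ε) ε
  | .exit, ε => Ioc (-ε) 0 ×ˢ Ioo (-ε) ε
  | .tangent, ε => {p | p.1 ^ 2 ≤ p.2 ∧ p.2 < ε}

/-- A flow box for the field `∂_t + g ∂_y` around the origin of `Ω`, inside `O`. -/
structure PlanarBox (Ω O : Set (ℝ × ℝ)) (g : ℝ × ℝ → ℝ) (kind : BoxKind) where
  ε : ℝ
  U : Set (ℝ × ℝ)
  T : ℝ × ℝ → ℝ
  S : ℝ × ℝ → ℝ
  K : ℝ × ℝ → ℝ × ℝ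
  ε_pos : 0 < ε
  isOpen_U : IsOpen U
  U_subset : U ⊆ O
  zero_mem : (0, 0) ∈ U
  smooth_T : ContDiffOn ℝ ∞ T (Ω ∩ U)
  smooth_S : ContDiffOn ℝ ∞ S (Ω ∩ U)
  smooth_K : ContDiffOn ℝ ∞ K (boxRegion kind ε)
  mapsTo_K : ∀ p ∈ boxRegion kind ε, K p ∈ Ω ∩ U
  mapsTo_TS : ∀ z ∈ Ω ∩ U, (T z, S z) ∈ boxRegion kind ε
  T_K : ∀ p ∈ boxRegion kind ε, T (K p) = p.1
  S_K : ∀ p ∈ boxRegion kind ε, S (K p) = p.2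
  K_TS : ∀ z ∈ Ω ∩ U, K (T z, S z) = z
  K_zero : K (0, 0) = (0, 0)
  deriv_S : ∀ z ∈ Ω ∩ U, ∃ L : ℝ × ℝ →L[ℝ] ℝ, HasFDerivAt S L z ∧ L (1, g z) = 0 ∧ L ≠ 0
  deriv_T : ∀ z ∈ Ω ∩ U, ∃ L : ℝ × ℝ →L[ℝ] ℝ, HasFDerivAt T L z ∧ 0 < L (1, g z)

namespace PlanarFlow

variable {Ω : Set (ℝ × ℝ)} {g : ℝ × ℝ → ℝ} (P : PlanarFlow Ω g)

theorem exists_small_box {O : Set (ℝ × ℝ)} (hO : O ∈ 𝓝 ((0 : ℝ), (0 : ℝ))) :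
    ∃ ε > 0, ∀ t s, |t| < ε → |s| < ε → (t, P.Y (t, s)) ∈ O := by
  have hc : Continuous fun z : ℝ × ℝ => (z.1, P.Y z) :=
    continuous_fst.prodMk P.contDiff_Y.continuous
  have := hc.continuousAt.preimage_mem_nhds (x := ((0 : ℝ), (0 : ℝ))) (by simpa [P.Y_zero] using hO)
  obtain ⟨ε, hε, h⟩ := Metric.mem_nhds_iff.1 this
  refine ⟨ε, hε, fun t s ht hs => h (a := (t, s)) ?_⟩
  rw [Metric.mem_ball, Prod.dist_eq]
  simpa using ⟨ht, hs⟩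

theorem deriv_S_box {z : ℝ × ℝ} (hz : z ∈ Ω) (hz1 : z ∈ Metric.ball (0 : ℝ × ℝ) 1) :
    ∃ L : ℝ × ℝ →L[ℝ] ℝ, HasFDerivAt P.S L z ∧ L (1, g z) = 0 ∧ L ≠ 0 := by
  refine ⟨fderiv ℝ P.S z, (P.differentiable_S z).hasFDerivAt, ?_, fun h => ?_⟩
  · rw [← P.G_eq z hz hz1]
    exact P.fderiv_S_flow z
  · have := P.fderiv_S_pos z
    rw [h] at this
    exact lt_irrefl _ this

theorem isOpen_box (ε δ : ℝ) : IsOpen {z : ℝ × ℝ | |z.1| < ε ∧ |P.S z| < δ} :=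
  (isOpen_lt continuous_fst.abs continuous_const).inter
    (isOpen_lt P.contDiff_S.continuous.abs continuous_const)

/-- A flow box over a set which is a union of the lines `t = const`. -/
theorem exists_productBox {Ω : Set (ℝ × ℝ)} {g : ℝ × ℝ → ℝ} (P : PlanarFlow Ω g) {kind : BoxKind} {J : Set ℝ} (hΩ : ∀ z : ℝ × ℝ, z ∈ Ω ↔ z.1 ∈ J)
    (hJ : J.OrdConnected) (hJ0 : (0 : ℝ) ∈ J)
    (hR : ∀ ε, boxRegion kind ε = (J ∩ Ioo (-ε) ε) ×ˢ Ioo (-ε) ε) {O : Set (ℝ × ℝ)}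
    (hO : O ∈ 𝓝 ((0 : ℝ), (0 : ℝ))) : Nonempty (PlanarBox Ω O g kind) := by
  obtain ⟨ε, hε, hεO⟩ := P.exists_small_box (inter_mem hO (Metric.ball_mem_nhds (0 : ℝ × ℝ) one_pos))
  have hstay : ∀ p : ℝ × ℝ, p.1 ∈ J → p ∈ staysIn Ω P.Y := fun p hp r hr =>
    (hΩ _).2 (hJ.uIcc_subset hJ0 hp hr)
  have hU : ∀ z : ℝ × ℝ, |z.1| < ε → |P.S z| < ε → z ∈ O ∩ Metric.ball (0 : ℝ × ℝ) 1 := by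
    intro z h1 h2
    have := hεO z.1 (P.S z) h1 h2
    rwa [P.Y_S z.1 z.2] at this
  refine ⟨⟨ε, {z | |z.1| < ε ∧ |P.S z| < ε}, Prod.fst, P.S, fun p => (p.1, P.Y p), hε,
    P.isOpen_box ε ε, fun z hz => (hU z hz.1 hz.2).1, ?_, contDiffOn_fst, ?_, ?_, ?_, ?_,
    fun _ _ => rfl, fun p _ => P.S_Y p.1 p.2, fun z _ => ?_, ?_, ?_, ?_⟩⟩
  · show |(0 : ℝ)| < ε ∧ |P.S (0, 0)| < ε
    simp [P.S_zero, hε]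
  · exact P.smooth_S.mono fun z hz => hstay _ ((hΩ z).1 hz.1)
  · refine contDiffOn_fst.prodMk (P.smooth_Y.mono fun p hp => ?_)
    rw [hR] at hp
    exact hstay _ hp.1.1
  · intro p hp
    rw [hR] at hp
    refine ⟨(hΩ _).2 hp.1.1, abs_lt.2 hp.1.2, ?_⟩
    show |P.S (p.1, P.Y (p.1, p.2))| < ε
    rw [P.S_Y]
    exact abs_lt.2 hp.2
  · intro z hz
    rw [hR]
    exact ⟨⟨(hΩ z).1 hz.1, abs_lt.1 hz.2.1⟩, abs_lt.1 hz.2.2⟩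
  · ext
    · rfl
    · exact P.Y_S z.1 z.2
  · simp [P.Y_zero]
  · intro z hz
    exact P.deriv_S_box hz.1 (hU z hz.2.1 hz.2.2).2
  · intro z _
    exact ⟨ContinuousLinearMap.fst ℝ ℝ ℝ, hasFDerivAt_fst, by simp⟩

end PlanarFlow

/-- At a zero of `f` the product rule asks only for continuity of `h`. It gives second derivatives
at a tangency from factors that are merely continuous. -/
theorem hasDerivAt_mul_of_eq_zero {f h : ℝ → ℝ} {f' : ℝ} (hf : HasDerivAt f f' 0) (hf0 : f 0 = 0)
    (hh : ContinuousAt h 0) : HasDerivAt (fun t => f t * h t) (f' * h 0) 0 := by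
  rw [hasDerivAt_iff_tendsto_slope] at hf ⊢
  refine (hf.mul (hh.tendsto.mono_left nhdsWithin_le_nhds)).congr fun t => ?_
  simp only [slope_def_field, hf0]
  ring

/-- Zero is a one-way barrier: once `u` is negative it cannot become positive again, and if it were
zero at the end, its negative derivative there would make it positive just before. Applied to the
height over the boundary, it keeps orbits near a convex tangency inside the half-plane. -/
theorem nonneg_of_nonneg_end {u u' : ℝ → ℝ} {t : ℝ} (hu : ∀ r, HasDerivAt u (u' r) r)
    (h : ∀ r, 0 < r → r ≤ t → u r = 0 → u' r < 0) (ht : 0 ≤ u t) : ∀ r ∈ Icc 0 t, 0 ≤ u r := by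
  intro r₀ hr₀
  by_contra! hneg
  have hle : ∀ x ∈ Icc r₀ t, u x ≤ 0 := fun x hx =>
    image_le_of_deriv_right_lt_deriv_boundary (f := u) (f' := u') (a := r₀) (b := t)
      (B := fun _ => 0) (B' := fun _ => 0) (fun x _ => (hu x).continuousAt.continuousWithinAt)
      (fun x _ => (hu x).hasDerivWithinAt) hneg.le (fun x => hasDerivAt_const x 0)
      (fun x hx hx0 => by
        refine h x ?_ hx.2.le hx0
        rcases hx.1.lt_or_eq with h1 | h1
        · exact hr₀.1.trans_lt h1
        · subst h1; linarith) hx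
  have ht0 : u t = 0 := le_antisymm (hle t (right_mem_Icc.2 hr₀.2)) ht
  have hlt : r₀ < t := by
    rcases hr₀.2.lt_or_eq with h1 | h1
    · exact h1
    · subst h1; linarith
  have hd := h t (hr₀.1.trans_lt hlt) le_rfl ht0
  have hslope := (hasDerivAt_iff_tendsto_slope.1 (hu t)).eventually (gt_mem_nhds hd)
  have hev : ∀ᶠ x in 𝓝[<] t, slope u t x < 0 :=
    hslope.filter_mono (nhdsWithin_mono _ fun x hx => ne_of_lt hx)
  obtain ⟨x, hx1, hx2⟩ := (hev.and (Ico_mem_nhdsLT hlt)).exists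
  have h3 := hle x ⟨hx2.1, hx2.2.le⟩
  rw [slope_def_field, ht0, sub_zero] at hx1
  have : 0 ≤ u x / (x - t) := div_nonneg_of_nonpos h3 (by linarith [hx2.2])
  linarith

/-- No continuity of `θ` is assumed: injectivity of `η` on `I` identifies `θ` with the local inverse
given by the inverse function theorem. -/
theorem contDiffOn_inverse_interval {η θ : ℝ → ℝ} {I V : Set ℝ} (hI : IsOpen I)
    (hη : ContDiffOn ℝ ∞ η I) (hd : ∀ t ∈ I, deriv η t ≠ 0) (hinj : InjOn η I)
    (hθ : ∀ h ∈ V, θ h ∈ I ∧ η (θ h) = h) : ContDiffOn ℝ ∞ θ V := by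
  intro h₀ hh₀
  obtain ⟨h1, h2⟩ := hθ h₀ hh₀
  have hc : ContDiffAt ℝ ∞ η (θ h₀) := hη.contDiffAt (hI.mem_nhds h1)
  have hder : HasDerivAt η (deriv η (θ h₀)) (θ h₀) := (hc.differentiableAt (by simp)).hasDerivAt
  have hder' := hder.hasFDerivAt_equiv (hd _ h1)
  have hloc := hc.to_localInverse hder' (by simp)
  have hstrict := hc.hasStrictFDerivAt' hder' (by simp)
  rw [h2] at hloc
  have hcont : Tendsto (hc.localInverse hder' (by simp)) (𝓝 h₀) (𝓝 (θ h₀)) := by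
    have := hloc.continuousAt.tendsto
    have h4 := hc.localInverse_apply_image hder' (by simp)
    rw [h2] at h4
    rwa [h4] at this
  have hright : ∀ᶠ y in 𝓝 h₀, η (hc.localInverse hder' (by simp) y) = y := by
    have := hstrict.eventually_right_inverse
    rw [h2] at this
    exact this
  refine hloc.contDiffWithinAt.congr_of_eventuallyEq ?_ ?_
  · filter_upwards [nhdsWithin_le_nhds hright, nhdsWithin_le_nhds (hcont.eventually
      (hI.mem_nhds h1)), self_mem_nhdsWithin] with y hy1 hy2 hy3
    exact hinj (hθ y hy3).1 hy2 ((hθ y hy3).2.trans hy1.symm)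
  · have h4 := hc.localInverse_apply_image hder' (by simp)
    rw [h2] at h4
    exact h4.symm

end

/-! ### Flow boxes at a convex tangency -/

section

open Set Filter MeasureTheory

theorem exists_pos_of_eventually_nhds_zero {p : ℝ → Prop} (h : ∀ᶠ t in 𝓝 (0 : ℝ), p t) :
    ∃ ρ > 0, ∀ t, |t| < ρ → p t := by
  obtain ⟨ρ, hρ, h⟩ := Metric.eventually_nhds_iff.1 h
  exact ⟨ρ, hρ, fun t ht => h (by simpa using ht)⟩

/-- A function with a nondegenerate minimum `0` at `0` is locally the square of a coordinate. -/
theorem exists_sqrt_coordinate {b q : ℝ → ℝ} {ρ κ : ℝ} (hρ : 0 < ρ)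
    (hb : ContDiffOn ℝ ∞ b (Ioo (-ρ) ρ)) (hb0 : b 0 = 0)
    (hd : ∀ t ∈ Ioo (-ρ) ρ, HasDerivAt b (q t) t) (hq0 : q 0 = 0) (hq : HasDerivAt q κ 0)
    (hκ : 0 < κ) :
    ∃ ε > 0, ε < ρ ∧ ∃ η : ℝ → ℝ, ContDiffOn ℝ ∞ η (Ioo (-ε) ε) ∧ η 0 = 0 ∧
      (∀ t ∈ Ioo (-ε) ε, 0 < deriv η t) ∧ ∀ t ∈ Ioo (-ε) ε, η t ^ 2 = b t := by
  -- A cutoff makes `b` globally smooth, so that Hadamard's lemma applies twice and gives `b t = t ^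
  -- 2 * m t` near `0`. Then `m 0 = κ / 2 > 0`, and the coordinate is `t * √(m t)`.
  let χ : ContDiffBump (0 : ℝ) := ⟨ρ / 3, ρ / 2, by linarith, by linarith⟩
  have hχ : ContDiff ℝ ∞ (fun t => χ t * b t) := by
    refine contDiff_iff_contDiffAt.2 fun t => ?_
    by_cases ht : t ∉ tsupport fun t => χ t * b t
    · exact contDiffAt_const.congr_of_eventuallyEq (notMem_tsupport_iff_eventuallyEq.1 ht)
    rw [not_not] at ht
    have h1 : t ∈ tsupport χ := tsupport_mul_subset_left ht
    rw [χ.tsupport_eq] at h1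
    have h2 : |t| ≤ ρ / 2 := by simpa using h1
    have h3 := abs_le.1 h2
    exact χ.contDiff.contDiffAt.mul
      (hb.contDiffAt (Ioo_mem_nhds (by linarith) (by linarith)))
  have hχ1 : ∀ t, |t| < ρ / 3 → χ t = 1 := fun t ht =>
    χ.one_of_mem_closedBall (by simpa using ht.le)
  have hnear : ∀ t, |t| < ρ / 3 → (fun t => χ t * b t) =ᶠ[𝓝 t] b := fun t ht => by
    filter_upwards [(isOpen_lt continuous_abs continuous_const).mem_nhds ht] with r hr
    rw [hχ1 r hr, one_mul]
  obtain ⟨m₁, hm₁, hbm, hm₁0⟩ := exists_smooth_factor hχ (by simp [hb0])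
  have hd0 : deriv (fun t => χ t * b t) 0 = 0 := by
    rw [(hnear 0 (by simpa using by linarith)).deriv_eq, (hd 0 ⟨by linarith, hρ⟩).deriv, hq0]
  obtain ⟨m, hm, hmm, -⟩ := exists_smooth_factor hm₁ (hm₁0.trans hd0)
  have hbt : ∀ t, |t| < ρ / 3 → b t = t * (t * m t) := fun t ht => by
    have := hbm t
    rw [hχ1 t ht, one_mul] at this
    rw [this, hmm]
  have hmd : Differentiable ℝ m := hm.differentiable (by simp)
  have hm0 : 2 * m 0 = κ := by
    have hm'c : Continuous (deriv m) := hm.continuous_deriv (by simp)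
    have h1 : ∀ᶠ t in 𝓝 (0 : ℝ), q t = t * (2 * m t + t * deriv m t) := by
      filter_upwards [(isOpen_lt continuous_abs continuous_const).mem_nhds
        (show |(0 : ℝ)| < ρ / 3 by simpa using by linarith)] with t ht
      have ht3 := abs_lt.1 (show |t| < ρ / 3 from ht)
      have h2 : HasDerivAt b (t * (2 * m t + t * deriv m t)) t := by
        have h3 := (hasDerivAt_id t).mul ((hasDerivAt_id t).mul (hmd t).hasDerivAt)
        have h4 : (fun r => r * (r * m r)) =ᶠ[𝓝 t] b := by
          filter_upwards [(isOpen_lt continuous_abs continuous_const).mem_nhds ht] with r hr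
          exact (hbt r hr).symm
        refine (h3.congr_of_eventuallyEq h4.symm).congr_deriv ?_
        simp
        ring
      exact (hd t ⟨by linarith, by linarith⟩).unique h2
    have h5 := hasDerivAt_mul_of_eq_zero (hasDerivAt_id (0 : ℝ)) rfl
      (h := fun t => 2 * m t + t * deriv m t)
      (by have := hm.continuous; fun_prop)
    have h6 := hq.unique (h5.congr_of_eventuallyEq h1)
    simpa using h6.symm
  have hmpos : 0 < m 0 := by linarith
  obtain ⟨ρ₁, hρ₁, h₁⟩ := exists_pos_of_eventually_nhds_zero
    (hm.continuous.continuousAt.eventually (lt_mem_nhds hmpos))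
  set η : ℝ → ℝ := fun t => t * √(m t) with hη
  have hηs : ContDiffOn ℝ ∞ η (Ioo (-ρ₁) ρ₁) :=
    contDiffOn_id.mul (hm.contDiffOn.sqrt fun t ht => (h₁ t (abs_lt.2 ht)).ne')
  have hη0 : deriv η 0 = √(m 0) := by
    have := hasDerivAt_mul_of_eq_zero (hasDerivAt_id (0 : ℝ)) rfl
      (h := fun t => √(m t)) (by have := hm.continuous; fun_prop)
    simpa using this.deriv
  have hcont : ContinuousAt (deriv η) 0 :=
    (hηs.continuousOn_deriv_of_isOpen isOpen_Ioo (by simp)).continuousAt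
      (Ioo_mem_nhds (by linarith) hρ₁)
  obtain ⟨ρ₂, hρ₂, h₂⟩ := exists_pos_of_eventually_nhds_zero
    (hcont.eventually (lt_mem_nhds (show 0 < deriv η 0 by rw [hη0]; exact Real.sqrt_pos.2 hmpos)))
  refine ⟨min (ρ / 3) (min ρ₁ ρ₂), by positivity, ?_, η, ?_, by simp [hη], ?_, ?_⟩
  · exact (min_le_left _ _).trans_lt (by linarith)
  · have : min (ρ / 3) (min ρ₁ ρ₂) ≤ ρ₁ := (min_le_right _ _).trans (min_le_left _ _)
    exact hηs.mono (Ioo_subset_Ioo (by linarith) this)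
  · intro t ht
    exact h₂ t (lt_of_lt_of_le (abs_lt.2 ht) ((min_le_right _ _).trans (min_le_right _ _)))
  · intro t ht
    have ht' := abs_lt.2 ht
    have hmt := h₁ t (ht'.trans_le ((min_le_right _ _).trans (min_le_left _ _)))
    rw [hbt t (ht'.trans_le (min_le_left _ _)), hη]
    simp only [mul_pow, Real.sq_sqrt hmt.le]
    ring

namespace PlanarFlow

/-- Along the boundary line the slope `g` has the sign of `-t`, so an orbit crosses the line only
downwards for `t > 0`, and only upwards for `t < 0`. Hence an orbit that is in the half-plane at
time `t` was there at all times between `0` and `t`, and the flow is smooth along it. The orbit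
label `b t = S (t, 0)` of the boundary points has a nondegenerate minimum at `0`. Since `S`
increases with `y`, the half-plane is `b t ≤ S`; with `η ^ 2 = b` it becomes the parabolic region in
the coordinates `(η t, S)`. -/
theorem exists_tangentBox {g : ℝ × ℝ → ℝ} (P : PlanarFlow {z | 0 ≤ z.2} g) {κ : ℝ} (hκ : 0 < κ)
    (hg0 : g (0, 0) = 0) (hg : HasDerivAt (fun t => g (t, 0)) (-κ) 0) {O : Set (ℝ × ℝ)}
    (hO : O ∈ 𝓝 ((0 : ℝ), (0 : ℝ))) : Nonempty (PlanarBox {z | 0 ≤ z.2} O g .tangent) := by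
  have hGg : ∀ t, |t| < 1 → P.G (t, 0) = g (t, 0) := fun t ht => by
    refine P.G_eq _ (le_refl (0 : ℝ)) ?_
    simpa [Prod.dist_eq] using ht
  have hGd : HasDerivAt (fun t => P.G (t, 0)) (-κ) 0 := by
    refine hg.congr_of_eventuallyEq ?_
    filter_upwards [(isOpen_lt continuous_abs continuous_const).mem_nhds
      (show |(0 : ℝ)| < 1 by simp)] with t ht
    exact hGg t ht
  have hG0 : P.G (0, 0) = 0 := by rw [hGg 0 (by simp), hg0]
  obtain ⟨ρ, hρ, hsign⟩ : ∃ ρ > 0, ∀ t, |t| < ρ → t ≠ 0 → t * P.G (t, 0) < 0 := by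
    refine exists_pos_of_eventually_nhds_zero ?_
    have h1 := (hasDerivAt_iff_tendsto_slope.1 hGd).eventually
      (gt_mem_nhds (show -κ < 0 by linarith))
    filter_upwards [eventually_nhdsWithin_iff.1 h1] with t ht ht0
    have h2 := ht ht0
    rw [slope_def_field, hG0, sub_zero, sub_zero] at h2
    have h3 : t * P.G (t, 0) = t ^ 2 * (P.G (t, 0) / t) := by field_simp
    rw [h3]
    exact mul_neg_of_pos_of_neg (by positivity) h2
  have hstay : ∀ t s, |t| < ρ → 0 ≤ P.Y (t, s) → (t, s) ∈ staysIn {z | 0 ≤ z.2} P.Y := by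
    intro t s ht hY r hr
    rcases le_total 0 t with h0 | h0
    · refine nonneg_of_nonneg_end (u := fun r => P.Y (r, s)) (t := t) (fun r => P.deriv_Y r s)
        (fun r hr0 hrt hz => ?_) hY r (by rwa [uIcc_of_le h0] at hr)
      rw [hz]
      have := hsign r (by rw [abs_of_pos hr0]; rw [abs_of_nonneg h0] at ht; linarith) hr0.ne'
      nlinarith
    · have := nonneg_of_nonneg_end (u := fun r => P.Y (-r, s))
        (u' := fun r => -P.G (-r, P.Y (-r, s))) (t := -t)
        (fun r => by
          have := (P.deriv_Y (-r) s).scomp r (hasDerivAt_neg r)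
          simpa [Function.comp_def] using this)
        (fun r hr0 hrt hz => ?_) (by simpa using hY) (-r)
        (by rw [uIcc_of_ge h0] at hr; exact ⟨by linarith [hr.2], by linarith [hr.1]⟩)
      · simpa using this
      · rw [hz]
        have := hsign (-r) (by
          rw [abs_neg, abs_of_pos hr0]; rw [abs_of_nonpos h0] at ht; linarith) (by linarith)
        have h3 : 0 < P.G (-r, 0) := by nlinarith
        linarith
  have hY0 : ∀ t, P.Y (t, P.S (t, 0)) = 0 := fun t => P.Y_S t 0
  have hb : ContDiffOn ℝ ∞ (fun t => P.S (t, 0)) (Ioo (-ρ) ρ) := by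
    refine P.smooth_S.comp (contDiffOn_id.prodMk contDiffOn_const) fun t ht => ?_
    exact hstay _ _ (abs_lt.2 ht) (hY0 t).ge
  set q : ℝ → ℝ := fun t => fderiv ℝ P.S (t, 0) (0, 1) with hq
  have hqc : Continuous q := by
    have h1 : Continuous (fun t : ℝ => fderiv ℝ P.S (t, 0)) :=
      (P.contDiff_S.continuous_fderiv (by simp)).comp (by fun_prop)
    exact h1.clm_apply continuous_const
  -- `S` is constant along `(1, G)`, so its `t`-derivative on the boundary line is `-G` times its
  -- `y`-derivative. The second derivative of `b` at `0` is then `κ` times `q 0`.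
  have hbd : ∀ t, HasDerivAt (fun t => P.S (t, 0)) (-P.G (t, 0) * q t) t := by
    intro t
    have h1 : HasDerivAt (fun t : ℝ => (t, (0 : ℝ))) ((1 : ℝ), (0 : ℝ)) t :=
      (hasDerivAt_id t).prodMk (hasDerivAt_const t 0)
    refine ((P.differentiable_S (t, 0)).hasFDerivAt.comp_hasDerivAt t h1).congr_deriv ?_
    have h2 : ((1 : ℝ), (0 : ℝ)) = (1, P.G (t, 0)) - P.G (t, 0) • ((0 : ℝ), (1 : ℝ)) := by simp
    rw [h2, map_sub, P.fderiv_S_flow, map_smul, hq]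
    simp
  have hqd : HasDerivAt (fun t => -P.G (t, 0) * q t) (κ * q 0) 0 := by
    have := hasDerivAt_mul_of_eq_zero hGd.neg (by simp [hG0]) hqc.continuousAt
    simpa using this
  obtain ⟨ρ₂, hρ₂, hρ₂ρ, η, hηs, hη0, hηd, hηsq⟩ := exists_sqrt_coordinate hρ hb
    (P.S_zero 0) (fun t _ => hbd t) (by simp [hG0]) hqd (mul_pos hκ (P.fderiv_S_pos _))
  obtain ⟨ε₁, hε₁, hεO⟩ :=
    P.exists_small_box (inter_mem hO (Metric.ball_mem_nhds (0 : ℝ × ℝ) one_pos))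
  obtain ⟨ε₂, hε₂, hε₂ρ, hε₂ε⟩ : ∃ ε₂ > 0, ε₂ < ρ₂ ∧ ε₂ < ε₁ :=
    ⟨min ρ₂ ε₁ / 2, by positivity, by linarith [min_le_left ρ₂ ε₁, lt_min hρ₂ hε₁],
      by linarith [min_le_right ρ₂ ε₁, lt_min hρ₂ hε₁]⟩
  have hmono : StrictMonoOn η (Ioo (-ρ₂) ρ₂) := by
    refine strictMonoOn_of_deriv_pos (convex_Ioo _ _) hηs.continuousOn fun t ht => ?_
    rw [interior_Ioo] at ht
    exact hηd t ht
  have hmem : ∀ t, |t| ≤ ε₂ → t ∈ Ioo (-ρ₂) ρ₂ := fun t ht => by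
    have := abs_le.1 ht
    constructor <;> linarith
  have hsub : Ioo (-ε₂) ε₂ ⊆ Ioo (-ρ₂) ρ₂ := Ioo_subset_Ioo (by linarith) hε₂ρ.le
  have hp1 : 0 < η ε₂ := by
    rw [← hη0]
    exact hmono (hmem 0 (by simpa using hε₂.le)) (hmem _ (abs_of_pos hε₂).le) hε₂
  have hp2 : η (-ε₂) < 0 := by
    rw [← hη0]
    exact hmono (hmem _ (by rw [abs_neg]; exact (abs_of_pos hε₂).le))
      (hmem 0 (by simpa using hε₂.le)) (by linarith)
  -- Chosen so that `(-h₁, h₁)` lies in the image of `(-ε₂, ε₂)` under `η`. The bound `ε ≤ h₁ ^ 2`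
  -- below then keeps the first coordinates of the parabolic region in the domain of the inverse
  -- `θ`.
  set h₁ := min (η ε₂) (-η (-ε₂)) with hh₁
  have hh₁pos : 0 < h₁ := lt_min hp1 (by linarith)
  have hex : ∀ h, ∃ t, h ∈ Ioo (-h₁) h₁ → t ∈ Ioo (-ε₂) ε₂ ∧ η t = h := by
    intro h
    by_cases hh : h ∈ Ioo (-h₁) h₁
    · have hc : ContinuousOn η (Icc (-ε₂) ε₂) :=
        hηs.continuousOn.mono fun t ht => hmem t (abs_le.2 ht)
      have h4 := min_le_left (η ε₂) (-η (-ε₂))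
      have h5 := min_le_right (η ε₂) (-η (-ε₂))
      obtain ⟨t, ht, ht2⟩ := intermediate_value_Ioo (by linarith : -ε₂ ≤ ε₂) hc
        (show h ∈ Ioo (η (-ε₂)) (η ε₂) from ⟨by linarith [hh.1], by linarith [hh.2]⟩)
      exact ⟨t, fun _ => ⟨ht, ht2⟩⟩
    · exact ⟨0, fun h => absurd h hh⟩
  choose θ hθ using hex
  have hθs : ContDiffOn ℝ ∞ θ (Ioo (-h₁) h₁) :=
    contDiffOn_inverse_interval isOpen_Ioo (hηs.mono hsub)
      (fun t ht => (hηd t (hsub ht)).ne') (hmono.injOn.mono hsub) (fun h hh => hθ h hh)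
  set ε := min ε₁ (h₁ ^ 2) with hε
  have hεpos : 0 < ε := lt_min hε₁ (by positivity)
  have hreg : ∀ h s : ℝ, h ^ 2 ≤ s → s < ε → h ∈ Ioo (-h₁) h₁ := fun h s h1 h2 => by
    have : h ^ 2 < h₁ ^ 2 := by linarith [min_le_right ε₁ (h₁ ^ 2)]
    exact abs_lt.1 (abs_lt_of_sq_lt_sq this hh₁pos.le)
  have hU : ∀ z : ℝ × ℝ, |z.1| < ε₂ → |P.S z| < ε → z ∈ O ∩ Metric.ball (0 : ℝ × ℝ) 1 := by
    intro z h1 h2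
    have := hεO z.1 (P.S z) (h1.trans hε₂ε) (h2.trans_le (min_le_left _ _))
    rwa [P.Y_S z.1 z.2] at this
  have hTS : ∀ z : ℝ × ℝ, 0 ≤ z.2 → |z.1| < ε₂ → |P.S z| < ε →
      (η z.1, P.S z) ∈ boxRegion .tangent ε := by
    intro z h0 h1 h2
    refine ⟨?_, (abs_lt.1 h2).2⟩
    show η z.1 ^ 2 ≤ P.S z
    rw [hηsq _ (hsub (abs_lt.1 h1))]
    exact (P.strictMono_S z.1).monotone h0
  have hYnn : ∀ h s, h ∈ Ioo (-h₁) h₁ → h ^ 2 ≤ s → 0 ≤ P.Y (θ h, s) := fun h s h1 h2 => by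
    obtain ⟨h3, h4⟩ := hθ h h1
    rw [← h4, hηsq _ (hsub h3)] at h2
    have := (P.strictMono_Y (θ h)).monotone h2
    simpa only [hY0] using this
  have hθε : ∀ h, h ∈ Ioo (-h₁) h₁ → |θ h| < ε₂ := fun h hh => abs_lt.2 (hθ h hh).1
  refine ⟨⟨ε, {z | |z.1| < ε₂ ∧ |P.S z| < ε}, fun z => η z.1, P.S,
    fun p => (θ p.1, P.Y (θ p.1, p.2)), hεpos, P.isOpen_box _ _, fun z hz => (hU z hz.1 hz.2).1,
    ?_, ?_, ?_, ?_, ?_, ?_, ?_, fun p _ => P.S_Y _ _, ?_, ?_, ?_, ?_⟩⟩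
  · show |(0 : ℝ)| < ε₂ ∧ |P.S (0, 0)| < ε
    simp [P.S_zero, hε₂, hεpos]
  · exact hηs.comp contDiffOn_fst fun z hz => hsub (abs_lt.1 hz.2.1)
  · refine P.smooth_S.mono fun z hz => hstay _ _ (by linarith [hz.2.1]) ?_
    rw [P.Y_S]
    exact hz.1
  · have h1 : ContDiffOn ℝ ∞ (fun p : ℝ × ℝ => θ p.1) (boxRegion .tangent ε) :=
      hθs.comp contDiffOn_fst fun p hp => hreg _ _ hp.1 hp.2
    refine h1.prodMk (P.smooth_Y.comp (h1.prodMk contDiffOn_snd) fun p hp => ?_)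
    have := hreg _ _ hp.1 hp.2
    exact hstay _ _ (by linarith [hθε _ this]) (hYnn _ _ this hp.1)
  · intro p hp
    have := hreg _ _ hp.1 hp.2
    refine ⟨hYnn _ _ this hp.1, hθε _ this, ?_⟩
    show |P.S (θ p.1, P.Y (θ p.1, p.2))| < ε
    rw [P.S_Y, abs_of_nonneg (le_trans (sq_nonneg _) hp.1)]
    exact hp.2
  · exact fun z hz => hTS z hz.1 hz.2.1 hz.2.2
  · exact fun p hp => (hθ _ (hreg _ _ hp.1 hp.2)).2
  · intro z hz
    have h1 := hTS z hz.1 hz.2.1 hz.2.2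
    have h2 := hθ _ (hreg _ _ h1.1 h1.2)
    have h3 : θ (η z.1) = z.1 := hmono.injOn (hsub h2.1) (hsub (abs_lt.1 hz.2.1)) h2.2
    ext
    · exact h3
    · show P.Y (θ (η z.1), P.S z) = z.2
      rw [h3]
      exact P.Y_S z.1 z.2
  · have h2 := hθ 0 ⟨by linarith, hh₁pos⟩
    have h3 : θ 0 = 0 := hmono.injOn (hsub h2.1) (hmem 0 (by simpa using hε₂.le)) (h2.2.trans hη0.symm)
    simp [h3, P.Y_zero]
  · exact fun z hz => P.deriv_S_box hz.1 (hU z hz.2.1 hz.2.2).2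
  · intro z hz
    have hz' := hsub (abs_lt.1 hz.2.1)
    have h1 : HasDerivAt η (deriv η z.1) z.1 :=
      ((hηs.contDiffAt (isOpen_Ioo.mem_nhds hz')).differentiableAt (by simp)).hasDerivAt
    refine ⟨_, h1.comp_hasFDerivAt z hasFDerivAt_fst, ?_⟩
    simpa using hηd _ hz'

end PlanarFlow

end

/-! ### From planar vector fields to planar flow boxes -/

section

open Set Filter MeasureTheory

/-- The domain of the plane in which a flow box of a given kind at the origin lives. -/
def boxDomain : BoxKind → Set (ℝ × ℝ)
  | .inner => univ
  | .entry => {z | 0 ≤ z.1}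
  | .exit => {z | z.1 ≤ 0}
  | .tangent => {z | 0 ≤ z.2}

theorem zero_mem_boxDomain (kind : BoxKind) : (0 : ℝ × ℝ) ∈ boxDomain kind := by
  cases kind <;> simp [boxDomain]

theorem exists_contDiff_extension_boxDomain (kind : BoxKind) {k : ℕ} {g : ℝ × ℝ → ℝ}
    (hg : ContDiffOn ℝ k g (boxDomain kind)) :
    ∃ F : ℝ × ℝ → ℝ, ContDiff ℝ k F ∧ EqOn F g (boxDomain kind) := by
  have key : ∀ e : (ℝ × ℝ) ≃L[ℝ] (ℝ × ℝ), (∀ z, z ∈ boxDomain kind ↔ e z ∈ rightHalfPlane) →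
      ∃ F : ℝ × ℝ → ℝ, ContDiff ℝ k F ∧ EqOn F g (boxDomain kind) := by
    intro e he
    have h1 : ContDiffOn ℝ k (g ∘ e.symm) rightHalfPlane :=
      hg.comp e.symm.contDiff.contDiffOn fun z hz => (he _).2 (by simpa using hz)
    obtain ⟨F, hF, hFg⟩ := exists_contDiff_extension h1
    refine ⟨F ∘ e, hF.comp e.contDiff, fun z hz => ?_⟩
    have := hFg ((he z).1 hz)
    simpa using this
  cases kind with
  | inner => exact ⟨g, contDiffOn_univ.1 hg, fun _ _ => rfl⟩
  | entry => exact key (ContinuousLinearEquiv.refl ℝ _) fun z => Iff.rfl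
  | exit =>
    refine key (ContinuousLinearEquiv.neg ℝ) fun z => ?_
    show z.1 ≤ 0 ↔ 0 ≤ (-z).1
    simp
  | tangent => exact key (ContinuousLinearEquiv.prodComm ℝ ℝ ℝ) fun z => Iff.rfl

/-- A planar field with positive first component has flow boxes at the origin. -/
theorem exists_planarBox (kind : BoxKind) {w : ℝ × ℝ → ℝ × ℝ} {O : Set (ℝ × ℝ)}
    (hO : O ∈ 𝓝 (0 : ℝ × ℝ)) (hw : ContDiffOn ℝ ∞ w (boxDomain kind ∩ O)) (hpos : 0 < (w 0).1)
    (htan : kind = .tangent → (w 0).2 = 0 ∧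
      ∃ κ > 0, HasDerivAt (fun t : ℝ => (w (t, 0)).2) (-κ) 0) :
    ∃ g, ∃ B : PlanarBox (boxDomain kind) O g kind,
      ∀ z ∈ boxDomain kind ∩ B.U, ∃ c : ℝ, 0 < c ∧ w z = c • (1, g z) := by
  have h0 : (0 : ℝ × ℝ) ∈ boxDomain kind ∩ O := ⟨zero_mem_boxDomain kind, mem_of_mem_nhds hO⟩
  have hev : ∀ᶠ z in 𝓝[boxDomain kind ∩ O] 0, 0 < (w z).1 :=
    (continuous_fst.continuousAt.comp_continuousWithinAt (hw.continuousOn 0 h0)).eventually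
      (lt_mem_nhds hpos)
  rw [nhdsWithin_inter_of_mem' (mem_nhdsWithin_of_mem_nhds hO), eventually_nhdsWithin_iff] at hev
  obtain ⟨r, hr, hball⟩ := Metric.eventually_nhds_iff_ball.1 (hev.and hO)
  let χ : ContDiffBump (0 : ℝ × ℝ) := ⟨r / 3, r / 2, by linarith, by linarith⟩
  -- Dividing by the first component reparametrizes the orbits so that time is the first coordinate.
  -- The cutoff gives a slope on the whole domain, including where `w` is not controlled.
  set g : ℝ × ℝ → ℝ := fun z => χ z * ((w z).2 / (w z).1) with hg
  have hgs : ContDiffOn ℝ ∞ g (boxDomain kind) := by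
    intro z hz
    by_cases hzr : z ∈ Metric.ball (0 : ℝ × ℝ) r
    · have h1 : ContDiffWithinAt ℝ ∞ w (boxDomain kind) z :=
        (hw z ⟨hz, (hball z hzr).2⟩).mono_of_mem_nhdsWithin
          (inter_mem self_mem_nhdsWithin (mem_nhdsWithin_of_mem_nhds
            (mem_of_superset (Metric.isOpen_ball.mem_nhds hzr) fun y hy => (hball y hy).2)))
      exact χ.contDiff.contDiffWithinAt.mul ((contDiff_snd.contDiffAt.comp_contDiffWithinAt z h1).div
        (contDiff_fst.contDiffAt.comp_contDiffWithinAt z h1) ((hball z hzr).1 hz).ne')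
    · have h2 : z ∉ tsupport χ := by
        rw [χ.tsupport_eq]
        intro h
        have h3 : dist z 0 ≤ r / 2 := h
        have h4 : r ≤ dist z 0 := not_lt.1 hzr
        linarith
      refine (contDiffAt_const (c := (0 : ℝ)).congr_of_eventuallyEq ?_).contDiffWithinAt
      filter_upwards [notMem_tsupport_iff_eventuallyEq.1 h2] with y hy
      simp [hg, hy]
  obtain ⟨P⟩ := exists_planarFlow (Ω := boxDomain kind) (g := g) fun k =>
    exists_contDiff_extension_boxDomain kind (hgs.of_le (by exact_mod_cast le_top))
  have hO' : O ∩ Metric.ball 0 (r / 3) ∈ 𝓝 ((0 : ℝ), (0 : ℝ)) :=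
    inter_mem hO (Metric.ball_mem_nhds _ (by linarith))
  have hχ : ∀ z ∈ Metric.ball (0 : ℝ × ℝ) (r / 3), χ z = 1 := fun z hz =>
    χ.one_of_mem_closedBall (Metric.ball_subset_closedBall hz)
  have main : Nonempty (PlanarBox (boxDomain kind) (O ∩ Metric.ball 0 (r / 3)) g kind) := by
    cases kind with
    | inner =>
      exact P.exists_productBox (J := univ) (fun z => Iff.rfl) ordConnected_univ trivial
        (fun ε => by simp [boxRegion]) hO'
    | entry =>
      refine P.exists_productBox (J := Ici 0) (fun z => Iff.rfl) ordConnected_Ici self_mem_Ici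
        (fun ε => ?_) hO'
      ext ⟨a, b⟩
      simp only [boxRegion, mem_prod, mem_Ico, mem_Ioo, mem_inter_iff, mem_Ici]
      refine and_congr_left fun _ => ⟨fun h => ⟨h.1, by linarith [h.1, h.2], h.2⟩, fun h => ⟨h.1, h.2.2⟩⟩
    | exit =>
      refine P.exists_productBox (J := Iic 0) (fun z => Iff.rfl) ordConnected_Iic self_mem_Iic
        (fun ε => ?_) hO'
      ext ⟨a, b⟩
      simp only [boxRegion, mem_prod, mem_Ioc, mem_Ioo, mem_inter_iff, mem_Iic]
      refine and_congr_left fun _ => ⟨fun h => ⟨h.2, h.1, by linarith [h.1, h.2]⟩, fun h => ⟨h.2.1, h.1⟩⟩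
    | tangent =>
      obtain ⟨hz, κ, hκ, hd⟩ := htan rfl
      have hwc : ContinuousWithinAt w (boxDomain .tangent) 0 :=
        (hw.continuousOn 0 h0).mono_of_mem_nhdsWithin
          (inter_mem self_mem_nhdsWithin (mem_nhdsWithin_of_mem_nhds hO))
      have hline : Tendsto (fun t : ℝ => (t, (0 : ℝ))) (𝓝 0) (𝓝[boxDomain .tangent] 0) := by
        refine tendsto_nhdsWithin_iff.2 ⟨?_, Eventually.of_forall fun t => le_refl (0 : ℝ)⟩
        exact (by fun_prop : Continuous fun t : ℝ => (t, (0 : ℝ))).tendsto' _ _ rfl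
      have hlw : ContinuousAt (fun t : ℝ => χ (t, 0) / (w (t, 0)).1) 0 := by
        have h1 : Tendsto (fun t : ℝ => (w (t, 0)).1) (𝓝 0) (𝓝 (w 0).1) :=
          (continuous_fst.tendsto _).comp (hwc.tendsto.comp hline)
        have h2 : Continuous fun t : ℝ => χ (t, 0) := χ.continuous.comp (by fun_prop)
        exact h2.continuousAt.div h1 hpos.ne'
      have h5 := hasDerivAt_mul_of_eq_zero hd hz hlw
      refine P.exists_tangentBox (κ := κ / (w 0).1) (div_pos hκ hpos) ?_ ?_ hO'
      · show χ 0 * ((w 0).2 / (w 0).1) = 0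
        rw [hz]; simp
      · have h6 : χ ((0 : ℝ), (0 : ℝ)) = 1 := hχ _ (Metric.mem_ball_self (by linarith))
        refine (h5.congr_of_eventuallyEq (Eventually.of_forall fun t => ?_)).congr_deriv ?_
        · simp only [hg]
          ring
        · rw [h6]
          show -κ * (1 / (w 0).1) = _
          ring
  obtain ⟨B⟩ := main
  -- The box was built inside the ball where the cutoff is `1`, so `w` is there a positive multiple
  -- of `(1, g)`.
  refine ⟨g, { B with U_subset := fun z hz => (B.U_subset hz).1 }, fun z hz => ?_⟩
  have hzb := (B.U_subset hz.2).2
  have hp := (hball z (Metric.ball_subset_ball (by linarith) hzb)).1 hz.1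
  refine ⟨(w z).1, hp, ?_⟩
  ext
  · simp
  · simp only [hg, hχ z hzb, Prod.smul_mk, smul_eq_mul]
    field_simp

end

section

open Set Filter MeasureTheory

variable {X : Type*} [TopologicalSpace X] [ChartedSpace (EuclideanHalfSpace 2) X]

/-! ### A vector field in a chart -/

/-- The components of the field `v` at `x` in the preferred chart at `p`. -/
noncomputable def chartField (v : ∀ x : X, TangentSpace (𝓡∂ 2) x) (p x : X) :
    EuclideanSpace ℝ (Fin 2) :=
  mfderiv (𝓡∂ 2) 𝓘(ℝ, EuclideanSpace ℝ (Fin 2)) (extChartAt (𝓡∂ 2) p) x (v x)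

section

variable [IsManifold (𝓡∂ 2) ∞ X] {v : ∀ x : X, TangentSpace (𝓡∂ 2) x}

theorem contMDiffOn_chartField (hv : IsSmoothField v) (p : X) :
    ContMDiffOn (𝓡∂ 2) 𝓘(ℝ, EuclideanSpace ℝ (Fin 2)) ∞ (chartField v p)
      (chartAt (EuclideanHalfSpace 2) p).source := by
  have h1 : ContMDiffOn (𝓡∂ 2) 𝓘(ℝ, EuclideanSpace ℝ (Fin 2)) ∞
      (fun x => (trivializationAt (EuclideanSpace ℝ (Fin 2)) (TangentSpace (𝓡∂ 2)) p ⟨x, v x⟩).2)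
      (chartAt (EuclideanHalfSpace 2) p).source :=
    ((trivializationAt (EuclideanSpace ℝ (Fin 2)) (TangentSpace (𝓡∂ 2)) p).contMDiffOn_section_iff
      (chartAt (EuclideanHalfSpace 2) p).open_source (by simp)).1 hv.contMDiffOn
  refine h1.congr fun x hx => ?_
  have h2 := TangentBundle.continuousLinearMapAt_trivializationAt (I := 𝓡∂ 2) hx
  have h3 : chartField v p x = (trivializationAt (EuclideanSpace ℝ (Fin 2))
      (TangentSpace (𝓡∂ 2)) p).continuousLinearMapAt ℝ x (v x) :=
    (congrArg (fun L => L (v x)) h2).symm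
  rw [h3, Bundle.Trivialization.continuousLinearMapAt_apply,
    Bundle.Trivialization.linearMapAt_apply, if_pos (by simpa using hx)]

theorem chartField_self (p : X) : chartField v p p = v p := by
  unfold chartField
  rw [mfderiv_extChartAt_self]
  rfl

/-- Boundary points are defined by their own preferred chart; being interior does not depend on the
chart of the atlas, so the chart at `p` can be used for all nearby `q`. -/
theorem isBoundaryPoint_iff_extChartAt {p q : X} (hq : q ∈ (extChartAt (𝓡∂ 2) p).source) :
    q ∈ (𝓡∂ 2).boundary X ↔ extChartAt (𝓡∂ 2) p q 0 = 0 := by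
  have hq' : q ∈ (chartAt (EuclideanHalfSpace 2) p).source := by simpa using hq
  have h1 := (𝓡∂ 2).isInteriorPoint_iff_of_mem_atlas (n := ∞) (by simp)
    (chart_mem_atlas (EuclideanHalfSpace 2) p) hq'
  have h3 : (extChartAt (𝓡∂ 2) p).target ∈ 𝓝[range (𝓡∂ 2)] (extChartAt (𝓡∂ 2) p q) :=
    extChartAt_target_mem_nhdsWithin' hq
  have h2 : extChartAt (𝓡∂ 2) p q ∈ interior (extChartAt (𝓡∂ 2) p).target ↔
      0 < extChartAt (𝓡∂ 2) p q 0 := by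
    have h4 := interior_range_modelWithCornersEuclideanHalfSpace 2
    constructor
    · intro h
      have h5 := interior_mono (extChartAt_target_subset_range (I := 𝓡∂ 2) p) h
      rw [h4] at h5
      exact h5
    · intro h
      have h5 : extChartAt (𝓡∂ 2) p q ∈ interior (range (𝓡∂ 2)) := by
        rw [h4]
        exact h
      rw [mem_interior_iff_mem_nhds] at h5 ⊢
      rwa [nhdsWithin_eq_nhds.2 h5] at h3
  have h6 : 0 ≤ extChartAt (𝓡∂ 2) p q 0 := by
    have := extChartAt_target_subset_range (I := 𝓡∂ 2) p ((extChartAt (𝓡∂ 2) p).map_source hq)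
    rw [range_modelWithCornersEuclideanHalfSpace] at this
    exact this
  show (𝓡∂ 2).IsBoundaryPoint q ↔ _
  rw [(𝓡∂ 2).isBoundaryPoint_iff_not_isInteriorPoint, h1]
  show ¬ extChartAt (𝓡∂ 2) p q ∈ interior (extChartAt (𝓡∂ 2) p).target ↔ _
  rw [h2, not_lt]
  exact ⟨fun h => le_antisymm h h6, fun h => h.le⟩

/-- The differential of a map in terms of a chart. -/
theorem mfderiv_eq_fderivWithin_chart {W : Type*} [NormedAddCommGroup W] [NormedSpace ℝ W]
    {F : X → W} {p q : X} (hq : q ∈ (extChartAt (𝓡∂ 2) p).source)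
    (hF : MDifferentiableAt (𝓡∂ 2) 𝓘(ℝ, W) F q) (u : TangentSpace (𝓡∂ 2) q) :
    DifferentiableWithinAt ℝ (F ∘ (extChartAt (𝓡∂ 2) p).symm) (range (𝓡∂ 2))
        (extChartAt (𝓡∂ 2) p q) ∧
      mfderiv (𝓡∂ 2) 𝓘(ℝ, W) F q u =
        fderivWithin ℝ (F ∘ (extChartAt (𝓡∂ 2) p).symm) (range (𝓡∂ 2)) (extChartAt (𝓡∂ 2) p q)
          (mfderiv (𝓡∂ 2) 𝓘(ℝ, EuclideanSpace ℝ (Fin 2)) (extChartAt (𝓡∂ 2) p) q u) := by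
  set φ := extChartAt (𝓡∂ 2) p with hφ
  have hqt := φ.map_source hq
  have h1 : MDifferentiableWithinAt 𝓘(ℝ, EuclideanSpace ℝ (Fin 2)) (𝓡∂ 2) φ.symm (range (𝓡∂ 2))
      (φ q) := mdifferentiableWithinAt_extChartAt_symm hqt
  have h2 : MDifferentiableAt (𝓡∂ 2) 𝓘(ℝ, W) F (φ.symm (φ q)) := by
    rwa [φ.left_inv hq]
  have h4 : DifferentiableWithinAt ℝ (F ∘ φ.symm) (range (𝓡∂ 2)) (φ q) :=
    (h2.comp_mdifferentiableWithinAt _ h1).differentiableWithinAt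
  refine ⟨h4, ?_⟩
  have h6 : HasMFDerivAt (𝓡∂ 2) 𝓘(ℝ, EuclideanSpace ℝ (Fin 2)) φ q
      (mfderiv (𝓡∂ 2) 𝓘(ℝ, EuclideanSpace ℝ (Fin 2)) φ q) :=
    (mdifferentiableAt_extChartAt (by rw [← extChartAt_source (𝓡∂ 2) p]; exact hq)).hasMFDerivAt
  have h7 := h4.hasFDerivWithinAt.hasMFDerivWithinAt.comp q
    (h6.hasMFDerivWithinAt (s := φ.source)) (fun x hx =>
      extChartAt_target_subset_range p (φ.map_source hx))
  have h8 : φ.source ∈ 𝓝 q := extChartAt_source_mem_nhds' hq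
  have h9 := (h7.hasMFDerivAt h8).congr_of_eventuallyEq (f₁ := F) (by
    filter_upwards [h8] with x hx
    simp [φ.left_inv hx])
  rw [h9.mfderiv]
  rfl

/-- A vector at a boundary point that points inside in some chart does not point outside. -/
theorem tangentCoord_nonneg {p q : X} (hq : q ∈ (extChartAt (𝓡∂ 2) p).source)
    (hqb : q ∈ (𝓡∂ 2).boundary X) (hpos : 0 < chartField v p q 0) :
    0 ≤ tangentCoord (v q) 0 := by
  set φ := extChartAt (𝓡∂ 2) p with hφ
  set φ' := extChartAt (𝓡∂ 2) q with hφ'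
  obtain ⟨hd, hD⟩ := mfderiv_eq_fderivWithin_chart hq (F := φ')
    (mdifferentiableAt_extChartAt (by simp)) (v q)
  set D := fderivWithin ℝ (φ' ∘ φ.symm) (range (𝓡∂ 2)) (φ q)
  set w := chartField v p q with hw
  have hvD : v q = D w := by
    rw [← chartField_self (v := v) q]
    exact hD
  have hqt := φ.map_source hq
  have hrange : ∀ y : EuclideanSpace ℝ (Fin 2), y ∈ range (𝓡∂ 2) ↔ 0 ≤ y 0 := fun y => by
    rw [range_modelWithCornersEuclideanHalfSpace]
    rfl
  -- The segment from `φ q` in direction `w` stays in the half-plane. Seen in the chart at `q`, its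
  -- normal coordinate starts at `0` and remains nonnegative, so its right derivative, which is the
  -- normal component of `v q`, is nonnegative.
  have hline : HasDerivWithinAt (fun t : ℝ => φ q + t • w) w (Ici 0) 0 := by
    have := ((hasDerivAt_id (0 : ℝ)).smul_const w).const_add (φ q)
    simpa using this.hasDerivWithinAt
  have hmaps : MapsTo (fun t : ℝ => φ q + t • w) (Ici 0) (range (𝓡∂ 2)) := by
    intro t ht
    rw [hrange]
    have h1 := (hrange _).1 (extChartAt_target_subset_range (I := 𝓡∂ 2) p hqt)
    have h2 : 0 ≤ t * w 0 := mul_nonneg ht hpos.le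
    simpa using add_nonneg h1 h2
  have h3 := (show HasFDerivWithinAt (φ' ∘ φ.symm) D (range (𝓡∂ 2)) (φ q + (0 : ℝ) • w) by
    rw [zero_smul, add_zero]; exact hd.hasFDerivWithinAt).comp_hasDerivWithinAt (0 : ℝ) hline hmaps
  have h4 : HasDerivWithinAt (fun t : ℝ => φ' (φ.symm (φ q + t • w)) 0) ((D w) 0) (Ici 0) 0 :=
    (EuclideanSpace.proj (𝕜 := ℝ) (0 : Fin 2)).hasFDerivAt.comp_hasDerivWithinAt (0 : ℝ) h3
  have h5 : ∀ᶠ t in 𝓝[>] (0 : ℝ), φ.symm (φ q + t • w) ∈ φ'.source := by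
    have hc1 : ContinuousWithinAt (fun t : ℝ => φ.symm (φ q + t • w)) (Ici 0) 0 := by
      refine ContinuousAt.comp_continuousWithinAt (g := φ.symm) ?_ hline.continuousWithinAt
      rw [zero_smul, add_zero]
      exact continuousAt_extChartAt_symm'' (I := 𝓡∂ 2) hqt
    have h6 : φ'.source ∈ 𝓝 (φ.symm (φ q + (0 : ℝ) • w)) := by
      rw [zero_smul, add_zero, φ.left_inv hq]
      exact extChartAt_source_mem_nhds (I := 𝓡∂ 2) q
    exact (hc1.eventually h6).filter_mono (nhdsWithin_mono _ Ioi_subset_Ici_self)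
  have h0 : φ' (φ.symm (φ q + (0 : ℝ) • w)) 0 = 0 := by
    rw [zero_smul, add_zero, φ.left_inv hq]
    exact (isBoundaryPoint_iff_extChartAt (mem_extChartAt_source q)).1 hqb
  have h7 := (hasDerivWithinAt_iff_tendsto_slope' (self_notMem_Ioi (a := (0 : ℝ)))).1
    (h4.mono Ioi_subset_Ici_self)
  show 0 ≤ (show EuclideanSpace ℝ (Fin 2) from v q) 0
  rw [show (show EuclideanSpace ℝ (Fin 2) from v q) = D w from hvD]
  refine ge_of_tendsto h7 ?_
  filter_upwards [h5, self_mem_nhdsWithin] with t ht ht0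
  rw [slope_def_field, h0, sub_zero, sub_zero]
  refine div_nonneg ?_ (le_of_lt ht0)
  exact (hrange _).1 (extChartAt_target_subset_range (I := 𝓡∂ 2) q (φ'.map_source ht))

end

end

section

open Set Filter MeasureTheory

variable {X : Type*} [TopologicalSpace X] [ChartedSpace (EuclideanHalfSpace 2) X]

/-! ### Flow boxes in a surface -/

/-- The derivative of a function along the field `v`. -/
noncomputable def fieldDeriv (v : ∀ x : X, TangentSpace (𝓡∂ 2) x) (F : X → ℝ) (x : X) : ℝ :=
  mfderiv (𝓡∂ 2) 𝓘(ℝ, ℝ) F x (v x)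

/-- A flow box for the field `v` around `p`: coordinates `(t, σ)` on an open set `B`, with image a
standard region and inverse map `κ`, such that `σ` is constant and `t` increases along `v`. -/
structure FlowBox (v : ∀ x : X, TangentSpace (𝓡∂ 2) x) (p : X) where
  kind : BoxKind
  ε : ℝ
  B : Set X
  t : X → ℝ
  σ : X → ℝ
  κ : ℝ × ℝ → X
  ε_pos : 0 < ε
  isOpen_B : IsOpen B
  mem_B : p ∈ B
  smooth_t : ContMDiffOn (𝓡∂ 2) 𝓘(ℝ, ℝ) ∞ t B
  smooth_σ : ContMDiffOn (𝓡∂ 2) 𝓘(ℝ, ℝ) ∞ σ B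
  smooth_κ : ContMDiffOn 𝓘(ℝ, ℝ × ℝ) (𝓡∂ 2) ∞ κ (boxRegion kind ε)
  mapsTo_κ : ∀ z ∈ boxRegion kind ε, κ z ∈ B
  mapsTo : ∀ x ∈ B, (t x, σ x) ∈ boxRegion kind ε
  t_κ : ∀ z ∈ boxRegion kind ε, t (κ z) = z.1
  σ_κ : ∀ z ∈ boxRegion kind ε, σ (κ z) = z.2
  κ_tσ : ∀ x ∈ B, κ (t x, σ x) = x
  κ_zero : κ (0, 0) = p
  fieldDeriv_σ : ∀ x ∈ B, fieldDeriv v σ x = 0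
  mfderiv_σ_ne : ∀ x ∈ B, mfderiv (𝓡∂ 2) 𝓘(ℝ, ℝ) σ x ≠ 0
  fieldDeriv_t_pos : ∀ x ∈ B, 0 < fieldDeriv v t x

theorem zero_mem_boxRegion (kind : BoxKind) {ε : ℝ} (hε : 0 < ε) : ((0 : ℝ), (0 : ℝ)) ∈ boxRegion kind ε := by
  cases kind <;> simp [boxRegion, hε]

/-- Linear coordinates on the plane, the first one being `s` times the coordinate `i`. -/
noncomputable def scaledCoord (i : Fin 2) (s : ℝ) (hs : s ≠ 0) :
    EuclideanSpace ℝ (Fin 2) ≃L[ℝ] (ℝ × ℝ) :=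
  LinearEquiv.toContinuousLinearEquiv
    { toFun := fun y => (s * y i, y (i + 1))
      map_add' := fun y z => by ext <;> simp [mul_add]
      map_smul' := fun c y => by ext <;> simp [mul_left_comm]
      invFun := fun z => (z.1 / s) • EuclideanSpace.single i 1 + z.2 • EuclideanSpace.single (i + 1) 1
      left_inv := fun y => by
        ext j
        fin_cases i <;> fin_cases j <;> simp [hs]
      right_inv := fun z => by
        fin_cases i <;> ext <;> simp <;> field_simp }

theorem scaledCoord_symm_apply (i : Fin 2) (s : ℝ) (hs : s ≠ 0) (z : ℝ × ℝ) :
    (scaledCoord i s hs).symm z =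
      (z.1 / s) • EuclideanSpace.single i 1 + z.2 • EuclideanSpace.single (i + 1) 1 := rfl

theorem mem_range_halfSpace (y : EuclideanSpace ℝ (Fin 2)) : y ∈ range (𝓡∂ 2) ↔ 0 ≤ y 0 := by
  rw [range_modelWithCornersEuclideanHalfSpace]
  rfl

section

variable [IsManifold (𝓡∂ 2) ∞ X] {v : ∀ x : X, TangentSpace (𝓡∂ 2) x}

/-- A planar box is carried to the surface by the chart followed by `L`. The hypotheses `h1` and
`h2` say that `L` matches the half-plane with the domain of the box near the origin. -/
theorem exists_flowBox_of_chart (hv : IsSmoothField v) (p : X) (kind : BoxKind)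
    (L : EuclideanSpace ℝ (Fin 2) ≃L[ℝ] (ℝ × ℝ))
    (h1 : ∀ᶠ z in 𝓝[boxDomain kind] 0, extChartAt (𝓡∂ 2) p p + L.symm z ∈ range (𝓡∂ 2))
    (h2 : ∀ y ∈ range (𝓡∂ 2), L (y - extChartAt (𝓡∂ 2) p p) ∈ boxDomain kind)
    (hpos : 0 < (L (v p)).1)
    (htan : kind = .tangent → (L (v p)).2 = 0 ∧
      ∃ κ > 0, HasDerivAt (fun t : ℝ => (L (chartField v p ((extChartAt (𝓡∂ 2) p).symm
        (extChartAt (𝓡∂ 2) p p + L.symm (t, 0))))).2) (-κ) 0) :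
    ∃ b : FlowBox v p, b.kind = kind := by
  set φ := extChartAt (𝓡∂ 2) p with hφ
  have hps : p ∈ φ.source := mem_extChartAt_source p
  have htend : Tendsto (fun z => φ p + L.symm z) (𝓝[boxDomain kind] 0) (𝓝[range (𝓡∂ 2)] (φ p)) := by
    refine tendsto_nhdsWithin_iff.2 ⟨?_, h1⟩
    have : Continuous fun z => φ p + L.symm z := by fun_prop
    exact (this.tendsto' 0 (φ p) (by simp)).mono_left nhdsWithin_le_nhds
  have h3 : ∀ᶠ z in 𝓝[boxDomain kind] 0, φ p + L.symm z ∈ φ.target :=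
    htend.eventually (extChartAt_target_mem_nhdsWithin p)
  obtain ⟨O, hO, h0O, hOt⟩ := mem_nhdsWithin.1 h3
  replace hOt : ∀ z ∈ boxDomain kind ∩ O, φ p + L.symm z ∈ φ.target := fun z hz => hOt ⟨hz.2, hz.1⟩
  set w : ℝ × ℝ → ℝ × ℝ := fun z => L (chartField v p (φ.symm (φ p + L.symm z))) with hw
  have hκ : ContMDiffOn 𝓘(ℝ, ℝ × ℝ) (𝓡∂ 2) ∞ (fun z => φ.symm (φ p + L.symm z))
      (boxDomain kind ∩ O) := by
    refine (contMDiffOn_extChartAt_symm p).comp (ContDiff.contMDiff ?_).contMDiffOn hOt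
    fun_prop
  have hws : ContDiffOn ℝ ∞ w (boxDomain kind ∩ O) := by
    refine L.contDiff.comp_contDiffOn (contMDiffOn_iff_contDiffOn.1 ?_)
    refine (contMDiffOn_chartField hv p).comp hκ fun z hz => ?_
    rw [← extChartAt_source (𝓡∂ 2) p]
    exact φ.map_target (hOt z hz)
  have hw0 : w 0 = L (v p) := by
    show L (chartField v p (φ.symm (φ p + L.symm 0))) = _
    rw [map_zero, add_zero, φ.left_inv hps, chartField_self]
  obtain ⟨g, P, hP⟩ := exists_planarBox kind (hO.mem_nhds h0O) hws (by rwa [hw0])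
    (fun h => by rw [hw0]; exact htan h)
  set c : X → ℝ × ℝ := fun x => L (φ x - φ p) with hc
  have hcΩ : ∀ x ∈ φ.source, c x ∈ boxDomain kind := fun x hx =>
    h2 _ (extChartAt_target_subset_range p (φ.map_source hx))
  have hcs : ContMDiffOn (𝓡∂ 2) 𝓘(ℝ, ℝ × ℝ) ∞ c φ.source := by
    have h4 : ContMDiffOn (𝓡∂ 2) 𝓘(ℝ, EuclideanSpace ℝ (Fin 2)) ∞ φ φ.source := by
      rw [hφ, extChartAt_source]
      exact contMDiffOn_extChartAt
    have h5 : ContDiff ℝ ∞ (fun y => L (y - φ p)) := by fun_prop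
    exact h5.contMDiff.comp_contMDiffOn h4
  have hopen : IsOpen (φ.source ∩ c ⁻¹' P.U) :=
    hcs.continuousOn.isOpen_inter_preimage (isOpen_extChartAt_source p) P.isOpen_U
  have hinv : ∀ x ∈ φ.source, φ.symm (φ p + L.symm (c x)) = x := fun x hx => by
    simp only [hc, ContinuousLinearEquiv.symm_apply_apply, add_sub_cancel]
    exact φ.left_inv hx
  have hcinv : ∀ z ∈ boxDomain kind ∩ P.U, φ.symm (φ p + L.symm z) ∈ φ.source ∧
      c (φ.symm (φ p + L.symm z)) = z := fun z hz => by
    have h4 := hOt z ⟨hz.1, P.U_subset hz.2⟩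
    refine ⟨φ.map_target h4, ?_⟩
    simp only [hc, φ.right_inv h4, add_sub_cancel_left, ContinuousLinearEquiv.apply_symm_apply]
  have hchain : ∀ x ∈ φ.source, ∀ (F : ℝ × ℝ → ℝ) (L' : ℝ × ℝ →L[ℝ] ℝ), HasFDerivAt F L' (c x) →
      fieldDeriv v (F ∘ c) x = L' (w (c x)) ∧
        (L' ≠ 0 → mfderiv (𝓡∂ 2) 𝓘(ℝ, ℝ) (F ∘ c) x ≠ 0) := by
    intro x hx F L' hF
    have hx' : x ∈ (chartAt (EuclideanHalfSpace 2) p).source := by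
      rwa [← extChartAt_source (𝓡∂ 2) p]
    have h4 : HasFDerivAt (F ∘ fun y => L (y - φ p)) (L' ∘L (L : EuclideanSpace ℝ (Fin 2) →L[ℝ] ℝ × ℝ))
        (φ x) := hF.comp (φ x) (L.hasFDerivAt.comp (φ x) ((hasFDerivAt_id _).sub_const _))
    have h5 : HasMFDerivAt (𝓡∂ 2) 𝓘(ℝ, EuclideanSpace ℝ (Fin 2)) φ x
        (mfderiv (𝓡∂ 2) 𝓘(ℝ, EuclideanSpace ℝ (Fin 2)) φ x) :=
      (mdifferentiableAt_extChartAt hx').hasMFDerivAt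
    have h6 := (h4.hasMFDerivAt.comp x h5).mfderiv
    constructor
    · have h7 : fieldDeriv v (F ∘ c) x = L' (L (chartField v p x)) := by
        exact congrArg (fun D => D (v x)) h6
      rw [h7, hw]
      simp only [hinv x hx]
    · intro hL' h0
      obtain ⟨M, hM⟩ := isInvertible_mfderiv_extChartAt (I := 𝓡∂ 2) hx
      refine hL' (ContinuousLinearMap.ext fun z => ?_)
      have h7 : ∀ u : TangentSpace (𝓡∂ 2) x,
          L' (L (mfderiv (𝓡∂ 2) 𝓘(ℝ, EuclideanSpace ℝ (Fin 2)) φ x u)) = 0 := fun u => by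
        have h8 : mfderiv (𝓡∂ 2) 𝓘(ℝ, ℝ) (F ∘ c) x u =
          L' (L (mfderiv (𝓡∂ 2) 𝓘(ℝ, EuclideanSpace ℝ (Fin 2)) φ x u)) :=
            congrArg (fun D => D u) h6
        rw [← h8, h0]
        rfl
      have h9 := h7 (M.symm (L.symm z))
      have h10 : mfderiv (𝓡∂ 2) 𝓘(ℝ, EuclideanSpace ℝ (Fin 2)) φ x (M.symm (L.symm z)) = L.symm z := by
        rw [← hM]
        exact M.apply_symm_apply _
      rw [h10, L.apply_symm_apply] at h9
      simpa using h9
  refine ⟨⟨kind, P.ε, φ.source ∩ c ⁻¹' P.U, P.T ∘ c, P.S ∘ c, fun z => φ.symm (φ p + L.symm (P.K z)),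
    P.ε_pos, hopen, ⟨hps, ?_⟩, ?_, ?_, ?_, ?_, ?_, ?_, ?_, ?_, ?_, ?_, ?_, ?_⟩, rfl⟩
  · show c p ∈ P.U
    have : c p = 0 := by simp [hc]
    rw [this]
    exact P.zero_mem
  · exact P.smooth_T.contMDiffOn.comp (hcs.mono inter_subset_left) fun x hx => ⟨hcΩ x hx.1, hx.2⟩
  · exact P.smooth_S.contMDiffOn.comp (hcs.mono inter_subset_left) fun x hx => ⟨hcΩ x hx.1, hx.2⟩
  · exact hκ.comp P.smooth_K.contMDiffOn fun z hz =>
      ⟨(P.mapsTo_K z hz).1, P.U_subset (P.mapsTo_K z hz).2⟩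
  · intro z hz
    have h4 := P.mapsTo_K z hz
    refine ⟨(hcinv _ h4).1, ?_⟩
    rw [mem_preimage, (hcinv _ h4).2]
    exact h4.2
  · exact fun x hx => P.mapsTo_TS _ ⟨hcΩ x hx.1, hx.2⟩
  · intro z hz
    simp only [Function.comp_apply, (hcinv _ (P.mapsTo_K z hz)).2, P.T_K z hz]
  · intro z hz
    simp only [Function.comp_apply, (hcinv _ (P.mapsTo_K z hz)).2, P.S_K z hz]
  · intro x hx
    simp only [Function.comp_apply, P.K_TS _ ⟨hcΩ x hx.1, hx.2⟩, hinv x hx.1]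
  · have : ((0 : ℝ), (0 : ℝ)) = 0 := rfl
    simp only [P.K_zero]
    rw [this, map_zero, add_zero, φ.left_inv hps]
  · intro x hx
    obtain ⟨L', hL', hg, -⟩ := P.deriv_S _ ⟨hcΩ x hx.1, hx.2⟩
    obtain ⟨a, -, ha⟩ := hP _ ⟨hcΩ x hx.1, hx.2⟩
    rw [(hchain x hx.1 _ _ hL').1, ha, map_smul, hg, smul_zero]
  · intro x hx
    obtain ⟨L', hL', -, hne⟩ := P.deriv_S _ ⟨hcΩ x hx.1, hx.2⟩
    exact (hchain x hx.1 _ _ hL').2 hne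
  · intro x hx
    obtain ⟨L', hL', hg⟩ := P.deriv_T _ ⟨hcΩ x hx.1, hx.2⟩
    obtain ⟨a, ha0, ha⟩ := hP _ ⟨hcΩ x hx.1, hx.2⟩
    rw [(hchain x hx.1 _ _ hL').1, ha, map_smul]
    exact mul_pos ha0 hg

theorem isBoundaryPoint_boundaryPoint {p : X} (hp : p ∈ (𝓡∂ 2).boundary X) :
    ∀ᶠ s in 𝓝 (0 : ℝ), boundaryPoint p s ∈ (extChartAt (𝓡∂ 2) p).source ∧
      boundaryPoint p s ∈ (𝓡∂ 2).boundary X := by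
  set φ := extChartAt (𝓡∂ 2) p with hφ
  have h0 : φ p 0 = 0 := (isBoundaryPoint_iff_extChartAt (mem_extChartAt_source p)).1 hp
  have htend : Tendsto (fun s : ℝ => φ p + s • EuclideanSpace.single (1 : Fin 2) (1 : ℝ)) (𝓝 0)
      (𝓝[range (𝓡∂ 2)] (φ p)) := by
    refine tendsto_nhdsWithin_iff.2 ⟨?_, Eventually.of_forall fun s => ?_⟩
    · have : Continuous fun s : ℝ => φ p + s • EuclideanSpace.single (1 : Fin 2) (1 : ℝ) := by
        fun_prop
      exact this.tendsto' 0 (φ p) (by simp)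
    · rw [mem_range_halfSpace]
      simp [h0]
  filter_upwards [htend.eventually (extChartAt_target_mem_nhdsWithin p)] with s hs
  have hsrc : boundaryPoint p s ∈ φ.source := φ.map_target hs
  refine ⟨hsrc, (isBoundaryPoint_iff_extChartAt hsrc).2 ?_⟩
  show φ (φ.symm _) 0 = 0
  rw [φ.right_inv hs]
  simp [h0]

/-- At a point of tangency of a boundary convex field the normal component decreases along the
field. -/
theorem deriv_normalComponent_mul_neg (hc : IsBoundaryConvex v) {p : X} (hp : p ∈ tangencyLocus v) :
    deriv (normalComponent v p) 0 * tangentCoord (v p) 1 < 0 := by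
  have hk := hc.1.1 p hp
  have h1 := hc.1.2 p hp
  -- Otherwise the normal component would be positive just ahead of `p` in the direction of `v`, and
  -- `p` would belong to the empty locus `tangencyPlus v`. `tangentCoord_nonneg` passes from the
  -- chart at `p`, where the normal component is computed, to the charts that define `inwardLocus`.
  by_contra! hcon
  have hkv : 0 < deriv (normalComponent v p) 0 * tangentCoord (v p) 1 :=
    hcon.lt_of_ne (mul_ne_zero hk h1).symm
  have hbp : boundaryPoint p 0 = p := by
    unfold boundaryPoint
    rw [zero_smul, add_zero, (extChartAt (𝓡∂ 2) p).left_inv (mem_extChartAt_source p)]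
  have hn0 : normalComponent v p 0 = 0 := by
    show (chartField v p (boundaryPoint p 0)) 0 = 0
    rw [hbp, chartField_self]
    exact le_antisymm hp.2.2 hp.1.2
  have hd : HasDerivAt (fun t => normalComponent v p (t * tangentCoord (v p) 1))
      (deriv (normalComponent v p) 0 * tangentCoord (v p) 1) 0 := by
    have h2 : HasDerivAt (normalComponent v p) (deriv (normalComponent v p) 0)
        (0 * tangentCoord (v p) 1) := by
      rw [zero_mul]
      exact (differentiableAt_of_deriv_ne_zero hk).hasDerivAt
    have h3 := h2.comp (0 : ℝ) ((hasDerivAt_id (0 : ℝ)).mul_const (tangentCoord (v p) 1))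
    simpa [Function.comp_def] using h3
  have h4 := ((hasDerivAt_iff_tendsto_slope.1 hd).eventually (lt_mem_nhds hkv)).filter_mono
    (nhdsWithin_mono (0 : ℝ) (s := Ioi 0) fun x hx => (ne_of_gt hx : x ≠ 0))
  have h5 : Tendsto (fun t : ℝ => t * tangentCoord (v p) 1) (𝓝[>] 0) (𝓝 0) := by
    have : Continuous fun t : ℝ => t * tangentCoord (v p) 1 := by fun_prop
    exact (this.tendsto' 0 0 (by simp)).mono_left nhdsWithin_le_nhds
  have h6 : p ∈ tangencyPlus v := by
    refine ⟨hp, ?_⟩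
    filter_upwards [h4, h5.eventually (isBoundaryPoint_boundaryPoint hp.1.1), self_mem_nhdsWithin]
      with t ht hb ht0
    refine ⟨hb.2, tangentCoord_nonneg hb.1 hb.2 ?_⟩
    have ht0' : 0 < t := ht0
    simp only [slope_def_field, zero_mul, hn0, sub_zero] at ht
    exact (div_pos_iff_of_pos_right ht0').1 ht
  rw [hc.2] at h6
  exact h6

/-- Every point has a flow box. -/
theorem nonempty_flowBox (hv : IsSmoothField v) (hne : ∀ x, v x ≠ 0) (hc : IsBoundaryConvex v)
    (p : X) : Nonempty (FlowBox v p) := by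
  set φ := extChartAt (𝓡∂ 2) p with hφ
  have hps : p ∈ φ.source := mem_extChartAt_source p
  have hp0 : 0 ≤ φ p 0 := (mem_range_halfSpace _).1
    (extChartAt_target_subset_range (I := 𝓡∂ 2) p (φ.map_source hps))
  set u : EuclideanSpace ℝ (Fin 2) := v p with hu
  rcases hp0.lt_or_eq with hp0 | hp0
  · -- interior point
    have hint : ∀ L : EuclideanSpace ℝ (Fin 2) ≃L[ℝ] (ℝ × ℝ),
        ∀ᶠ z in 𝓝[boxDomain .inner] 0, φ p + L.symm z ∈ range (𝓡∂ 2) := by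
      intro L
      have hcont : Continuous fun z => (φ p + L.symm z) 0 :=
        (EuclideanSpace.proj (𝕜 := ℝ) (0 : Fin 2)).continuous.comp
          (continuous_const.add L.symm.continuous)
      have h0 : ∀ᶠ z in 𝓝 0, 0 < (φ p + L.symm z) 0 :=
        hcont.continuousAt.eventually (lt_mem_nhds (by simpa using hp0))
      filter_upwards [nhdsWithin_le_nhds h0] with z hz
      exact (mem_range_halfSpace _).2 hz.le
    -- With scale `u i` the first linear coordinate of `u` is `u i ^ 2 > 0`. The boundary cases
    -- below use the same device, with `i = 0` when `v` is transversal and `i = 1` when it is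
    -- tangent; for `u 0 < 0` the scaling also flips the half-plane to `z.1 ≤ 0`.
    obtain ⟨i, hi⟩ : ∃ i, u i ≠ 0 := by
      by_contra! h
      exact hne p (show u = 0 by ext i; simpa using h i)
    obtain ⟨b, -⟩ := exists_flowBox_of_chart hv p .inner (scaledCoord i (u i) hi) (hint _)
      (fun _ _ => trivial) (by
        show 0 < u i * u i
        exact mul_self_pos.2 hi) (fun h => by cases h)
    exact ⟨b⟩
  have hbd : p ∈ (𝓡∂ 2).boundary X := (isBoundaryPoint_iff_extChartAt hps).2 hp0.symm
  rcases lt_trichotomy (u 0) 0 with h0 | h0 | h0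
  · obtain ⟨b, -⟩ := exists_flowBox_of_chart hv p .exit (scaledCoord 0 (u 0) h0.ne)
      (by
        filter_upwards [self_mem_nhdsWithin] with z hz
        rw [mem_range_halfSpace, scaledCoord_symm_apply, PiLp.add_apply, ← hp0]
        simpa using div_nonneg_of_nonpos (show z.1 ≤ 0 from hz) h0.le)
      (fun y hy => by
        show u 0 * (y - φ p) 0 ≤ 0
        have hy' := (mem_range_halfSpace _).1 hy
        simpa [← hp0] using mul_nonpos_of_nonpos_of_nonneg h0.le hy')
      (by
        show 0 < u 0 * u 0
        exact mul_self_pos.2 h0.ne) (fun h => by cases h)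
    exact ⟨b⟩
  · have hpt : p ∈ tangencyLocus v := ⟨⟨hbd, h0.ge⟩, ⟨hbd, h0.le⟩⟩
    have h1 : u 1 ≠ 0 := hc.1.2 p hpt
    have hk := deriv_normalComponent_mul_neg hc hpt
    have hk1 : deriv (normalComponent v p) 0 * u 1 < 0 := hk
    obtain ⟨b, -⟩ := exists_flowBox_of_chart hv p .tangent (scaledCoord 1 (u 1) h1)
      (by
        filter_upwards [self_mem_nhdsWithin] with z hz
        rw [mem_range_halfSpace, scaledCoord_symm_apply, PiLp.add_apply, ← hp0]
        simpa using (show 0 ≤ z.2 from hz))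
      (fun y hy => by
        show 0 ≤ (y - φ p) 0
        have hy' := (mem_range_halfSpace _).1 hy
        simpa [← hp0] using hy')
      (by
        show 0 < u 1 * u 1
        exact mul_self_pos.2 h1)
      (fun _ => by
        -- The box coordinate `t` is `u 1` times the boundary coordinate, so differentiation in `t`
        -- divides by `u 1`. Positivity of this number is `deriv_normalComponent_mul_neg`.
        refine ⟨h0, -(deriv (normalComponent v p) 0 / u 1), ?_, ?_⟩
        · have : deriv (normalComponent v p) 0 / u 1 = deriv (normalComponent v p) 0 * u 1 / u 1 ^ 2 := by
            field_simp
          rw [this]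
          have := div_neg_of_neg_of_pos hk1 (show 0 < u 1 ^ 2 by positivity)
          linarith
        · have h2 : HasDerivAt (normalComponent v p) (deriv (normalComponent v p) 0) (0 / u 1) := by
            rw [zero_div]
            exact (differentiableAt_of_deriv_ne_zero (hc.1.1 p hpt)).hasDerivAt
          have h3 := h2.comp (0 : ℝ) ((hasDerivAt_id (0 : ℝ)).div_const (u 1))
          refine (h3.congr_of_eventuallyEq (Eventually.of_forall fun t => ?_)).congr_deriv (by ring)
          show (chartField v p (φ.symm (φ p + (scaledCoord 1 (u 1) h1).symm (t, 0)))) 0 =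
            (chartField v p (boundaryPoint p (t / u 1))) 0
          rw [scaledCoord_symm_apply, zero_smul, add_zero]
          rfl)
    exact ⟨b⟩
  · obtain ⟨b, -⟩ := exists_flowBox_of_chart hv p .entry (scaledCoord 0 (u 0) h0.ne')
      (by
        filter_upwards [self_mem_nhdsWithin] with z hz
        rw [mem_range_halfSpace, scaledCoord_symm_apply, PiLp.add_apply, ← hp0]
        simpa using div_nonneg (show 0 ≤ z.1 from hz) h0.le)
      (fun y hy => by
        show 0 ≤ u 0 * (y - φ p) 0
        have hy' := (mem_range_halfSpace _).1 hy
        simpa [← hp0] using mul_nonneg h0.le hy')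
      (by
        show 0 < u 0 * u 0
        exact mul_self_pos.2 h0.ne') (fun h => by cases h)
    exact ⟨b⟩

end

end

section

open Set Filter MeasureTheory

variable {X : Type*} [TopologicalSpace X] [ChartedSpace (EuclideanHalfSpace 2) X]
  {v : ∀ x : X, TangentSpace (𝓡∂ 2) x}

/-! ### Derivatives along a field, and a function increasing along the field -/

theorem fieldDeriv_add {F G : X → ℝ} {x : X} (hF : MDifferentiableAt (𝓡∂ 2) 𝓘(ℝ, ℝ) F x)
    (hG : MDifferentiableAt (𝓡∂ 2) 𝓘(ℝ, ℝ) G x) :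
    fieldDeriv v (F + G) x = fieldDeriv v F x + fieldDeriv v G x := by
  have h := (hF.hasMFDerivAt.add hG.hasMFDerivAt).mfderiv
  exact congrArg (fun D => D (v x)) h

theorem fieldDeriv_const_smul {F : X → ℝ} {x : X} (hF : MDifferentiableAt (𝓡∂ 2) 𝓘(ℝ, ℝ) F x)
    (c : ℝ) : fieldDeriv v (c • F) x = c * fieldDeriv v F x := by
  have h := (hF.hasMFDerivAt.const_smul c).mfderiv
  exact congrArg (fun D => D (v x)) h

theorem fieldDeriv_congr {F G : X → ℝ} {x : X} (h : F =ᶠ[𝓝 x] G) :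
    fieldDeriv v F x = fieldDeriv v G x := by
  unfold fieldDeriv
  have := h.mfderiv_eq (I := 𝓡∂ 2) (I' := 𝓘(ℝ, ℝ))
  exact congrArg (fun D : EuclideanSpace ℝ (Fin 2) →L[ℝ] ℝ => D (v x)) this

theorem fieldDeriv_const (c : ℝ) (x : X) : fieldDeriv v (fun _ => c) x = 0 := by
  have h := (hasMFDerivAt_const (I := 𝓡∂ 2) (I' := 𝓘(ℝ, ℝ)) c x).mfderiv
  exact congrArg (fun D => D (v x)) h

theorem fieldDeriv_sum {ι : Type*} (s : Finset ι) {F : ι → X → ℝ} {x : X}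
    (hF : ∀ i ∈ s, MDifferentiableAt (𝓡∂ 2) 𝓘(ℝ, ℝ) (F i) x) :
    MDifferentiableAt (𝓡∂ 2) 𝓘(ℝ, ℝ) (∑ i ∈ s, F i) x ∧
      fieldDeriv v (∑ i ∈ s, F i) x = ∑ i ∈ s, fieldDeriv v (F i) x := by
  classical
  induction s using Finset.induction_on with
  | empty => exact ⟨mdifferentiableAt_const (c := (0 : ℝ)), by simpa using! fieldDeriv_const (v := v) 0 x⟩
  | insert a s ha ih =>
    obtain ⟨h1, h2⟩ := ih fun i hi => hF i (Finset.mem_insert_of_mem hi)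
    have h3 := hF a (Finset.mem_insert_self _ _)
    rw [Finset.sum_insert ha, Finset.sum_insert ha, fieldDeriv_add h3 h1, h2]
    exact ⟨h3.add h1, rfl⟩

/-- The opposite field. -/
noncomputable def reverseField (v : ∀ x : X, TangentSpace (𝓡∂ 2) x) : ∀ x : X, TangentSpace (𝓡∂ 2) x :=
  fun x => -(v x)

theorem fieldDeriv_reverse (F : X → ℝ) (x : X) :
    fieldDeriv (reverseField v) F x = -fieldDeriv v F x :=
  map_neg (mfderiv (𝓡∂ 2) 𝓘(ℝ, ℝ) F x) (v x)

theorem fieldDeriv_neg {F : X → ℝ} {x : X} (hF : MDifferentiableAt (𝓡∂ 2) 𝓘(ℝ, ℝ) F x) :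
    fieldDeriv v (-F) x = -fieldDeriv v F x := by
  have := fieldDeriv_const_smul (v := v) hF (-1)
  simpa using this

/-- The kind of a flow box after reversing the field. -/
def BoxKind.reverse : BoxKind → BoxKind
  | .inner => .inner
  | .entry => .exit
  | .exit => .entry
  | .tangent => .tangent

theorem mem_boxRegion_reverse {kind : BoxKind} {ε : ℝ} {z : ℝ × ℝ} :
    z ∈ boxRegion kind.reverse ε ↔ (-z.1, z.2) ∈ boxRegion kind ε := by
  cases kind <;> simp only [BoxKind.reverse, boxRegion, mem_prod, mem_Ioo, mem_Ico, mem_Ioc,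
    neg_lt_neg_iff, Left.nonneg_neg_iff, Left.neg_nonpos_iff]
  · constructor
    · exact fun h => ⟨⟨h.1.2, by linarith [h.1.1]⟩, h.2⟩
    · exact fun h => ⟨⟨by linarith [h.1.2], h.1.1⟩, h.2⟩
  · exact and_congr_left fun _ => ⟨fun h => ⟨h.2, by linarith [h.1]⟩, fun h => ⟨by linarith [h.2], h.1⟩⟩
  · exact and_congr_left fun _ => ⟨fun h => ⟨h.2, h.1⟩, fun h => ⟨h.2, h.1⟩⟩
  · show z.1 ^ 2 ≤ z.2 ∧ z.2 < ε ↔ (-z.1) ^ 2 ≤ z.2 ∧ z.2 < ε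
    rw [neg_sq]

theorem FlowBox.mdifferentiableAt_t {p : X} (b : FlowBox v p) {x : X} (hx : x ∈ b.B) :
    MDifferentiableAt (𝓡∂ 2) 𝓘(ℝ, ℝ) b.t x :=
  (b.smooth_t.contMDiffAt (b.isOpen_B.mem_nhds hx)).mdifferentiableAt (by simp)

theorem FlowBox.mdifferentiableAt_σ {p : X} (b : FlowBox v p) {x : X} (hx : x ∈ b.B) :
    MDifferentiableAt (𝓡∂ 2) 𝓘(ℝ, ℝ) b.σ x :=
  (b.smooth_σ.contMDiffAt (b.isOpen_B.mem_nhds hx)).mdifferentiableAt (by simp)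

/-- A flow box for the opposite field. -/
noncomputable def FlowBox.reverse {p : X} (b : FlowBox v p) : FlowBox (reverseField v) p where
  kind := b.kind.reverse
  ε := b.ε
  B := b.B
  t := -b.t
  σ := b.σ
  κ := fun z => b.κ (-z.1, z.2)
  ε_pos := b.ε_pos
  isOpen_B := b.isOpen_B
  mem_B := b.mem_B
  smooth_t := b.smooth_t.neg
  smooth_σ := b.smooth_σ
  smooth_κ := b.smooth_κ.comp (t := boxRegion b.kind b.ε)
    (contDiff_fst.neg.prodMk contDiff_snd).contMDiff.contMDiffOn
    fun _ hz => mem_boxRegion_reverse.1 hz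
  mapsTo_κ := fun _ hz => b.mapsTo_κ _ (mem_boxRegion_reverse.1 hz)
  mapsTo := fun x hx => mem_boxRegion_reverse.2 (by simpa using b.mapsTo x hx)
  t_κ := fun z hz => by
    show -b.t (b.κ (-z.1, z.2)) = z.1
    rw [b.t_κ _ (mem_boxRegion_reverse.1 hz), neg_neg]
  σ_κ := fun z hz => b.σ_κ _ (mem_boxRegion_reverse.1 hz)
  κ_tσ := fun x hx => by simpa using b.κ_tσ x hx
  κ_zero := by simpa using b.κ_zero
  fieldDeriv_σ := fun x hx => by rw [fieldDeriv_reverse, b.fieldDeriv_σ x hx, neg_zero]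
  mfderiv_σ_ne := b.mfderiv_σ_ne
  fieldDeriv_t_pos := fun x hx => by
    rw [fieldDeriv_reverse, fieldDeriv_neg (b.mdifferentiableAt_t hx), neg_neg]
    exact b.fieldDeriv_t_pos x hx

theorem contMDiff_cutoff_mul {χ F : X → ℝ} {N : Set X} (hχ : ContMDiff (𝓡∂ 2) 𝓘(ℝ, ℝ) ∞ χ)
    (hN : tsupport χ ⊆ N) (hNo : IsOpen N) (hF : ContMDiffOn (𝓡∂ 2) 𝓘(ℝ, ℝ) ∞ F N) :
    ContMDiff (𝓡∂ 2) 𝓘(ℝ, ℝ) ∞ (fun x => χ x * F x) := by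
  refine contMDiff_of_tsupport fun x hx => ?_
  have hx' : x ∈ N := hN (tsupport_mul_subset_left hx)
  exact hχ.contMDiffAt.mul (hF.contMDiffAt (hNo.mem_nhds hx'))

section

variable [IsManifold (𝓡∂ 2) ∞ X]

theorem contMDiff_fieldDeriv (hv : IsSmoothField v) {F : X → ℝ}
    (hF : ContMDiff (𝓡∂ 2) 𝓘(ℝ, ℝ) ∞ F) : ContMDiff (𝓡∂ 2) 𝓘(ℝ, ℝ) ∞ (fieldDeriv v F) := by
  have h1 := (hF.contMDiff_tangentMap (m := ∞) (by simp)).comp hv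
  exact (contMDiff_snd_tangentBundle_modelSpace ℝ 𝓘(ℝ, ℝ)).comp h1

theorem exists_cutoff [T2Space X] {p : X} {N : Set X} (hN : N ∈ 𝓝 p) :
    ∃ χ : X → ℝ, ContMDiff (𝓡∂ 2) 𝓘(ℝ, ℝ) ∞ χ ∧ χ =ᶠ[𝓝 p] 1 ∧ tsupport χ ⊆ N := by
  obtain ⟨χ, -, hχ⟩ := (SmoothBumpFunction.nhds_basis_tsupport (I := 𝓡∂ 2) p).mem_iff.1 hN
  exact ⟨χ, χ.contMDiff, χ.eventuallyEq_one, hχ⟩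

theorem fderivWithin_chart_eq_zero {f : X → ℝ} {p q : X} (hf : MDifferentiableAt (𝓡∂ 2) 𝓘(ℝ, ℝ) f q)
    (hq : q ∈ (extChartAt (𝓡∂ 2) p).source) (hc : IsCritical f q) :
    fderivWithin ℝ (f ∘ (extChartAt (𝓡∂ 2) p).symm) (range (𝓡∂ 2)) (extChartAt (𝓡∂ 2) p q) = 0 := by
  obtain ⟨M, hM⟩ := isInvertible_mfderiv_extChartAt (I := 𝓡∂ 2) hq
  refine ContinuousLinearMap.ext fun z => ?_
  have h1 := (mfderiv_eq_fderivWithin_chart hq hf (M.symm z)).2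
  have h2 : mfderiv (𝓡∂ 2) 𝓘(ℝ, EuclideanSpace ℝ (Fin 2)) (extChartAt (𝓡∂ 2) p) q (M.symm z) = z := by
    rw [← hM]
    exact M.apply_symm_apply _
  rw [h2, show mfderiv (𝓡∂ 2) 𝓘(ℝ, ℝ) f q = 0 from hc] at h1
  exact h1.symm

/-- The critical points of a Morse function are isolated. -/
theorem IsMorse.eventually_not_isCritical {f : X → ℝ} (hf : IsMorse f) {p : X} (hp : IsCritical f p) :
    ∀ᶠ q in 𝓝 p, IsCritical f q → q = p := by
  set φ := extChartAt (𝓡∂ 2) p with hφ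
  have hps : p ∈ φ.source := mem_extChartAt_source p
  have hfd : ∀ q, MDifferentiableAt (𝓡∂ 2) 𝓘(ℝ, ℝ) f q := fun q =>
    hf.1.contMDiffAt.mdifferentiableAt (by simp)
  set h := fderivWithin ℝ (f ∘ φ.symm) (range (𝓡∂ 2)) with hh
  have hker : LinearMap.ker (chartHessian f p : EuclideanSpace ℝ (Fin 2) →ₗ[ℝ]
      (EuclideanSpace ℝ (Fin 2) →L[ℝ] ℝ)) = ⊥ := by
    rw [LinearMap.ker_eq_bot']
    intro u hu
    refine hf.2 p hp u fun w => ?_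
    have : chartHessian f p u = 0 := hu
    rw [this]
    rfl
  obtain ⟨K, -, hK⟩ := LinearMap.exists_antilipschitzWith _ hker
  -- Without differentiability the Hessian would be `0` by convention, contrary to its
  -- nondegeneracy. The Hessian is thus a true derivative with trivial kernel, bounded below in
  -- finite dimension, and the differential of `f` cannot vanish at other points near `p`.
  have hdiff : DifferentiableWithinAt ℝ h (range (𝓡∂ 2)) (φ p) := by
    by_contra hnd
    have h0 : chartHessian f p = 0 := fderivWithin_zero_of_not_differentiableWithinAt hnd
    have h1 : (EuclideanSpace.single (0 : Fin 2) (1 : ℝ)) = 0 :=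
      hf.2 p hp _ (fun w => by rw [h0]; rfl)
    simpa using congrArg (fun y : EuclideanSpace ℝ (Fin 2) => y 0) h1
  have hev := hdiff.hasFDerivWithinAt.eventually_ne (c := 0) ⟨K, hK⟩
  have htend : Tendsto φ (𝓝 p) (𝓝[range (𝓡∂ 2)] (φ p)) := by
    refine tendsto_nhdsWithin_iff.2 ⟨continuousAt_extChartAt p, ?_⟩
    filter_upwards [extChartAt_source_mem_nhds (I := 𝓡∂ 2) p] with x hx
    exact extChartAt_target_subset_range p (φ.map_source hx)
  have hev' : ∀ᶠ y in 𝓝[range (𝓡∂ 2)] (φ p), y ≠ φ p → h y ≠ 0 := by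
    rw [eventually_nhdsWithin_iff] at hev ⊢
    filter_upwards [hev] with y hy h1 h2
    exact hy ⟨h1, h2⟩
  filter_upwards [htend.eventually hev', extChartAt_source_mem_nhds (I := 𝓡∂ 2) p] with q hq hqs hqc
  by_contra hne
  exact hq (fun h => hne (φ.injOn hqs hps h)) (fderivWithin_chart_eq_zero (hfd q) hqs hqc)

/-- A gradient-like nowhere vanishing field with flow boxes has a smooth function that increases
strictly along the field everywhere. -/
theorem exists_lyapunov [T2Space X] [CompactSpace X] (hv : IsSmoothField v)
    (hbox : ∀ p, Nonempty (FlowBox v p)) (hg : IsGradientLike v) :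
    ∃ f : X → ℝ, ContMDiff (𝓡∂ 2) 𝓘(ℝ, ℝ) ∞ f ∧ ∀ x, 0 < fieldDeriv v f x := by
  classical
  obtain ⟨f, hf, hfv⟩ := hg
  replace hfv : ∀ x, ¬ IsCritical f x → 0 < fieldDeriv v f x := hfv
  have hf0 : ∀ x, IsCritical f x → fieldDeriv v f x = 0 := fun x hx => by
    have hx' : mfderiv (𝓡∂ 2) 𝓘(ℝ, ℝ) f x = 0 := hx
    unfold fieldDeriv
    rw [hx']
    rfl
  have hfc := (contMDiff_fieldDeriv hv hf.1).continuous
  have hclosed : IsClosed {x | IsCritical f x} := by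
    -- The gradient-like condition turns criticality into a closed inequality.
    have : {x | IsCritical f x} = {x | fieldDeriv v f x ≤ 0} := by
      ext x
      by_cases hx : IsCritical f x
      · simpa [hx] using! (hf0 x hx).le
      · simpa [hx] using! hfv x hx
    rw [this]
    exact isClosed_le hfc continuous_const
  have hN : ∀ p, ∃ N, IsOpen N ∧ p ∈ N ∧ ∀ q ∈ N, IsCritical f q → q = p := fun p => by
    by_cases hp : IsCritical f p
    · obtain ⟨N, h1, h2, h3⟩ := eventually_nhds_iff.1 (hf.eventually_not_isCritical hp)
      exact ⟨N, h2, h3, h1⟩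
    · exact ⟨{x | IsCritical f x}ᶜ, hclosed.isOpen_compl, hp, fun q hq hqc => absurd hqc hq⟩
  choose N hNo hpN hNc using hN
  have hfin : {x | IsCritical f x}.Finite := by
    obtain ⟨t, ht⟩ := CompactSpace.elim_nhds_subcover N fun p => (hNo p).mem_nhds (hpN p)
    refine t.finite_toSet.subset fun x hx => ?_
    obtain ⟨p, hpt, hp⟩ := mem_iUnion₂.1 (ht.ge (mem_univ x))
    rw [hNc p x hp hx]
    exact hpt
  have b : ∀ p, FlowBox v p := fun p => (hbox p).some
  choose χ hχs hχ1 hχN using fun p => exists_cutoff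
    (((hNo p).inter (b p).isOpen_B).mem_nhds ⟨hpN p, (b p).mem_B⟩)
  set g : X → X → ℝ := fun p x => χ p x * (b p).t x with hgdef
  have hgs : ∀ p, ContMDiff (𝓡∂ 2) 𝓘(ℝ, ℝ) ∞ (g p) := fun p =>
    contMDiff_cutoff_mul (hχs p) (hχN p) ((hNo p).inter (b p).isOpen_B)
      ((b p).smooth_t.mono inter_subset_right)
  -- `G` is the box time near each critical point: the other summands vanish there, since `N q`
  -- contains no critical point except possibly `q`.
  set G : X → ℝ := ∑ p ∈ hfin.toFinset, g p with hG
  have hmd : ∀ {F : X → ℝ} (x : X), ContMDiff (𝓡∂ 2) 𝓘(ℝ, ℝ) ∞ F →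
      MDifferentiableAt (𝓡∂ 2) 𝓘(ℝ, ℝ) F x := fun x hF =>
    hF.contMDiffAt.mdifferentiableAt (by simp)
  have hGs : ContMDiff (𝓡∂ 2) 𝓘(ℝ, ℝ) ∞ G := by
    have := contMDiff_finsetSum (t := hfin.toFinset) (f := g) (fun p _ => hgs p)
    have h2 : G = fun x => ∑ p ∈ hfin.toFinset, g p x := by
      ext x
      simp [hG]
    rwa [h2]
  have hGpos : ∀ p, IsCritical f p → 0 < fieldDeriv v G p := by
    intro p hp
    rw [hG, (fieldDeriv_sum _ (fun q _ => hmd p (hgs q))).2, Finset.sum_eq_single_of_mem p (by simpa using hp)]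
    · have h1 : g p =ᶠ[𝓝 p] (b p).t := by
        filter_upwards [hχ1 p] with x hx
        simp [hgdef, hx]
      rw [fieldDeriv_congr h1]
      exact (b p).fieldDeriv_t_pos p (b p).mem_B
    · intro q hq hqp
      have hq' : p ∉ tsupport (χ q) := fun h => hqp (hNc q p (hχN q h).1 hp).symm
      have h1 : g q =ᶠ[𝓝 p] fun _ => 0 := by
        filter_upwards [notMem_tsupport_iff_eventuallyEq.1 hq'] with x hx
        simp [hgdef, hx]
      rw [fieldDeriv_congr h1, fieldDeriv_const]
  have hGc := (contMDiff_fieldDeriv hv hGs).continuous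
  -- Outside this compact set `G` increases and `f` does not decrease along `v`. The set contains no
  -- critical points, so on it the derivative of `f` has a positive minimum `m`, which beats a small
  -- multiple of `G`.
  have hA : IsCompact {x | fieldDeriv v G x ≤ 0} := (isClosed_le hGc continuous_const).isCompact
  have hApos : ∀ x ∈ {x | fieldDeriv v G x ≤ 0}, 0 < fieldDeriv v f x := fun x hx =>
    hfv x fun hxc => absurd (hGpos x hxc) (not_lt.2 hx)
  have hfnn : ∀ x, 0 ≤ fieldDeriv v f x := fun x => by
    by_cases hx : IsCritical f x
    · exact (hf0 x hx).ge
    · exact (hfv x hx).le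
  obtain ⟨m, hm, hmA⟩ : ∃ m > 0, ∀ x ∈ {x | fieldDeriv v G x ≤ 0}, m ≤ fieldDeriv v f x :=
    hA.exists_forall_le' hfc.continuousOn hApos
  obtain ⟨C, hC⟩ := hA.exists_bound_of_continuousOn hGc.continuousOn
  set ε := m / (|C| + 1) with hε
  have hεpos : 0 < ε := by positivity
  refine ⟨f + ε • G, hf.1.add (contMDiff_const.mul hGs), fun x => ?_⟩
  rw [fieldDeriv_add (hmd x hf.1) ((hmd x hGs).const_smul ε), fieldDeriv_const_smul (hmd x hGs)]
  rcases le_or_gt (fieldDeriv v G x) 0 with hx | hx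
  · have h1 := hmA x hx
    have h2 := (abs_le.1 (hC x hx)).1
    have h3 : ε * |C| < m := by
      rw [hε, div_mul_eq_mul_div, div_lt_iff₀ (by positivity)]
      nlinarith
    have h4 : ε * -|C| ≤ ε * fieldDeriv v G x :=
      mul_le_mul_of_nonneg_left (by linarith [le_abs_self C]) hεpos.le
    linarith
  · have := hfnn x
    positivity

end

end

section

open Set Filter MeasureTheory

/-! ### Leaves of the flow -/

theorem exists_eq_smul_of_apply_eq_zero {ℓ : EuclideanSpace ℝ (Fin 2) →L[ℝ] ℝ} (hℓ : ℓ ≠ 0)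
    {v w : EuclideanSpace ℝ (Fin 2)} (hv0 : v ≠ 0) (hv : ℓ v = 0) (hw : ℓ w = 0) :
    ∃ c : ℝ, w = c • v := by
  have h1 := (ℓ : EuclideanSpace ℝ (Fin 2) →ₗ[ℝ] ℝ).finrank_range_add_finrank_ker
  have h2 : LinearMap.range (ℓ : EuclideanSpace ℝ (Fin 2) →ₗ[ℝ] ℝ) = ⊤ := by
    refine LinearMap.range_eq_top.2 (LinearMap.surjective ?_)
    intro h
    exact hℓ (ContinuousLinearMap.ext fun z => LinearMap.congr_fun h z)
  rw [h2, finrank_top, Module.finrank_self, finrank_euclideanSpace_fin] at h1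
  have h3 : Module.finrank ℝ (LinearMap.ker (ℓ : EuclideanSpace ℝ (Fin 2) →ₗ[ℝ] ℝ)) = 1 := by omega
  have h4 := (finrank_eq_one_iff_of_nonzero' (⟨v, hv⟩ : LinearMap.ker
    (ℓ : EuclideanSpace ℝ (Fin 2) →ₗ[ℝ] ℝ)) (fun h => hv0 (congrArg Subtype.val h))).1 h3 ⟨w, hw⟩
  obtain ⟨c, hc⟩ := h4
  exact ⟨c, (congrArg Subtype.val hc).symm⟩

theorem exists_continuousOn_inverse {h : ℝ → ℝ} {a b : ℝ} (hab : a ≤ b)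
    (hc : ContinuousOn h (Icc a b)) (hm : StrictMonoOn h (Icc a b)) :
    ∃ θ : ℝ → ℝ, ContinuousOn θ (Icc (h a) (h b)) ∧ (∀ r ∈ Icc (h a) (h b), θ r ∈ Icc a b ∧ h (θ r) = r) ∧
      ∀ t ∈ Icc a b, θ (h t) = t := by
  have hmem : ∀ t ∈ Icc a b, h t ∈ Icc (h a) (h b) := fun t ht =>
    ⟨hm.monotoneOn (left_mem_Icc.2 hab) ht ht.1, hm.monotoneOn ht (right_mem_Icc.2 hab) ht.2⟩
  have hex : ∀ r, ∃ t, r ∈ Icc (h a) (h b) → t ∈ Icc a b ∧ h t = r := fun r => by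
    by_cases hr : r ∈ Icc (h a) (h b)
    · obtain ⟨t, ht⟩ := intermediate_value_Icc hab hc hr
      exact ⟨t, fun _ => ht⟩
    · exact ⟨a, fun h => absurd h hr⟩
  choose θ hθ using hex
  have hθh : ∀ t ∈ Icc a b, θ (h t) = t := fun t ht =>
    hm.injOn (hθ _ (hmem t ht)).1 ht (hθ _ (hmem t ht)).2
  refine ⟨θ, ?_, fun r hr => hθ r hr, hθh⟩
  have hemb : Topology.IsClosedEmbedding ((Icc a b).domRestrict h) :=
    (continuousOn_iff_continuous_domRestrict.1 hc).isClosedEmbedding (injOn_iff_injective.1 hm.injOn)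
  rw [continuousOn_iff_continuous_domRestrict]
  have h1 : Continuous fun r : Icc (h a) (h b) => (⟨θ r, (hθ r r.2).1⟩ : Icc a b) := by
    rw [hemb.isInducing.continuous_iff]
    refine continuous_subtype_val.congr fun r => ?_
    exact (hθ r r.2).2.symm
  exact continuous_subtype_val.comp h1

/-- At the infimum of the set where `Q` holds, the two-point step takes a nearby point of the set to
a point below the infimum, unless `a` is reached. It serves to carry a local property from the top
of a leaf down along it. -/
theorem real_induction_down {Q : ℝ → Prop} {a b : ℝ} (hab : a ≤ b) (hb : Q b)
    (h : ∀ r ∈ Icc a b, ∃ δ > 0, ∀ r₁ ∈ Icc a b, ∀ r₂ ∈ Icc a b, |r₁ - r| < δ → |r₂ - r| < δ →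
      r₁ ≤ r₂ → Q r₂ → Q r₁) : Q a := by
  set S := {r | r ∈ Icc a b ∧ Q r} with hS
  have hne : S.Nonempty := ⟨b, ⟨hab, le_rfl⟩, hb⟩
  have hbd : BddBelow S := ⟨a, fun r hr => hr.1.1⟩
  set m := sInf S with hm
  have ham : a ≤ m := le_csInf hne fun r hr => hr.1.1
  have hmb : m ≤ b := csInf_le hbd ⟨⟨hab, le_rfl⟩, hb⟩
  obtain ⟨δ, hδ, hstep⟩ := h m ⟨ham, hmb⟩
  obtain ⟨r₂, hr₂, hr₂m⟩ := exists_lt_of_csInf_lt hne (show m < m + δ by linarith)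
  have hm2 : m ≤ r₂ := csInf_le hbd hr₂
  set r₁ := max a (m - δ / 2) with hr₁
  have h1 : r₁ ≤ m := max_le ham (by linarith)
  have hr₁m : r₁ ∈ Icc a b := ⟨le_max_left _ _, h1.trans hmb⟩
  have hQ : Q r₁ := hstep r₁ hr₁m r₂ hr₂.1
    (by rw [abs_lt]; constructor <;> linarith [le_max_right a (m - δ / 2)])
    (by rw [abs_lt]; constructor <;> linarith) (h1.trans hm2) hr₂.2
  have h2 : m ≤ r₁ := csInf_le hbd ⟨hr₁m, hQ⟩
  rcases max_cases a (m - δ / 2) with h3 | h3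
  · rw [hr₁, h3.1] at hQ
    exact hQ
  · rw [hr₁, h3.1] at h2
    linarith

theorem boxRegion_slice_ordConnected (kind : BoxKind) (ε s : ℝ) :
    ({r | (r, s) ∈ boxRegion kind ε} : Set ℝ).OrdConnected := by
  refine ⟨fun x hx y hy z hz => ?_⟩
  cases kind with
  | inner => exact ⟨⟨hx.1.1.trans_le hz.1, hz.2.trans_lt hy.1.2⟩, hx.2⟩
  | entry => exact ⟨⟨hx.1.1.trans hz.1, hz.2.trans_lt hy.1.2⟩, hx.2⟩
  | exit => exact ⟨⟨hx.1.1.trans_le hz.1, hz.2.trans hy.1.2⟩, hx.2⟩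
  | tangent =>
    have h1 := Real.abs_le_sqrt hx.1
    have h2 := Real.abs_le_sqrt hy.1
    have h3 : |z| ≤ √s := abs_le.2 ⟨(abs_le.1 h1).1.trans hz.1, hz.2.trans (abs_le.1 h2).2⟩
    refine ⟨?_, hx.2⟩
    have h0 : 0 ≤ s := (sq_nonneg x).trans hx.1
    show z ^ 2 ≤ s
    rw [← Real.sq_sqrt h0, ← sq_abs z]
    gcongr

variable {X : Type*} [TopologicalSpace X] [ChartedSpace (EuclideanHalfSpace 2) X]

/-- The differential of a function on a surface, as a linear form on the plane. -/
noncomputable def differential (F : X → ℝ) (x : X) : EuclideanSpace ℝ (Fin 2) →L[ℝ] ℝ :=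
  mfderiv (𝓡∂ 2) 𝓘(ℝ, ℝ) F x

/-- A single vector `w` of the plane differentiates all functions along the curve at once, so values
of different differentials on it can be compared. -/
theorem exists_velocity {c : ℝ → X} {J : Set ℝ} {r : ℝ}
    (hc : MDifferentiableWithinAt 𝓘(ℝ, ℝ) (𝓡∂ 2) c J r) :
    ∃ w : EuclideanSpace ℝ (Fin 2), ∀ G : X → ℝ, MDifferentiableAt (𝓡∂ 2) 𝓘(ℝ, ℝ) G (c r) →
      HasDerivWithinAt (fun r => G (c r)) (differential G (c r) w) J r := by
  set c' : ℝ →L[ℝ] EuclideanSpace ℝ (Fin 2) := mfderivWithin 𝓘(ℝ, ℝ) (𝓡∂ 2) c J r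
  refine ⟨c' 1, fun G hG => ?_⟩
  have h : HasFDerivWithinAt (fun r => G (c r)) (differential G (c r) ∘L c') J r := (hG.hasMFDerivAt.comp_hasMFDerivWithinAt r hc.hasMFDerivWithinAt).hasFDerivWithinAt
  exact h.hasDerivWithinAt

section

variable {v : ∀ x : X, TangentSpace (𝓡∂ 2) x}

/-- The derivative of a function along the slice of a flow box. -/
theorem FlowBox.hasDerivWithinAt_slice {p : X} (b : FlowBox v p) {F : X → ℝ} {r s : ℝ}
    (hr : (r, s) ∈ boxRegion b.kind b.ε)
    (hF : MDifferentiableAt (𝓡∂ 2) 𝓘(ℝ, ℝ) F (b.κ (r, s))) :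
    HasDerivWithinAt (fun r => F (b.κ (r, s)))
      (fieldDeriv v F (b.κ (r, s)) / fieldDeriv v b.t (b.κ (r, s)))
      {r | (r, s) ∈ boxRegion b.kind b.ε} r := by
  set J := {r | (r, s) ∈ boxRegion b.kind b.ε} with hJ
  set x := b.κ (r, s) with hx
  have hxB : x ∈ b.B := b.mapsTo_κ _ hr
  -- The slice may be a single point, at the tip of the parabolic region; there every number is a
  -- derivative within it.
  by_cases hacc : AccPt r (𝓟 J)
  swap
  · exact HasFDerivWithinAt.of_not_accPt hacc
  have huniq : UniqueDiffWithinAt ℝ J r := uniqueDiffWithinAt_iff_accPt.2 hacc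
  have h1 : MDifferentiableWithinAt 𝓘(ℝ, ℝ × ℝ) (𝓡∂ 2) b.κ (boxRegion b.kind b.ε) (r, s) :=
    (b.smooth_κ _ hr).mdifferentiableWithinAt (by simp)
  have h2 : MDifferentiableWithinAt 𝓘(ℝ, ℝ) 𝓘(ℝ, ℝ × ℝ) (fun r : ℝ => (r, s)) J r :=
    (by fun_prop : DifferentiableWithinAt ℝ (fun r : ℝ => (r, s)) J r).mdifferentiableWithinAt
  obtain ⟨w, key⟩ := exists_velocity (h1.comp r h2 (fun r hr => hr))
  have ht : differential b.t x w = (1 : ℝ) := by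
    refine huniq.eq_deriv _ (key _ (b.mdifferentiableAt_t hxB)) ?_
    exact (hasDerivWithinAt_id r J).congr (fun r hr => b.t_κ _ hr) (b.t_κ _ hr)
  have hσ : differential b.σ x w = (0 : ℝ) := by
    refine huniq.eq_deriv _ (key _ (b.mdifferentiableAt_σ hxB)) ?_
    exact (hasDerivWithinAt_const r J s).congr (fun r hr => b.σ_κ _ hr) (b.σ_κ _ hr)
  have htv := b.fieldDeriv_t_pos x hxB
  have hv0 : v x ≠ 0 := fun h => by
    have : fieldDeriv v b.t x = 0 := by
      unfold fieldDeriv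
      rw [h]
      exact map_zero _
    linarith
  -- The velocity of the slice and the field both lie in the one-dimensional kernel of the
  -- differential of `σ`; the factor `c` is found by evaluating the differential of `t`.
  obtain ⟨c, hc⟩ := exists_eq_smul_of_apply_eq_zero (ℓ := differential b.σ x)
    (b.mfderiv_σ_ne x hxB) hv0
    (b.fieldDeriv_σ x hxB) hσ
  have hlin : ∀ G : X → ℝ, differential G x w = c * fieldDeriv v G x := fun G => by
    rw [hc]
    exact map_smul (differential G x) c (v x)
  have hct : c * fieldDeriv v b.t x = 1 := by rw [← hlin, ht]
  refine (key F hF).congr_deriv ?_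
  show differential F x w = _
  rw [hlin, eq_div_iff htv.ne', mul_right_comm, hct, one_mul]

end

/-- A field `v` on a surface with a function `f` increasing along it, and flow boxes. -/
structure FlowSystem (X : Type*) [TopologicalSpace X] [ChartedSpace (EuclideanHalfSpace 2) X] where
  v : ∀ x : X, TangentSpace (𝓡∂ 2) x
  f : X → ℝ
  smooth_f : ContMDiff (𝓡∂ 2) 𝓘(ℝ, ℝ) ∞ f
  fieldDeriv_pos : ∀ x, 0 < fieldDeriv v f x
  box : ∀ p, FlowBox v p

namespace FlowSystem

variable (D : FlowSystem X)

theorem mdifferentiableAt_f (x : X) : MDifferentiableAt (𝓡∂ 2) 𝓘(ℝ, ℝ) D.f x :=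
  D.smooth_f.contMDiffAt.mdifferentiableAt (by simp)

/-- The system with the opposite field. -/
noncomputable def reverse : FlowSystem X where
  v := reverseField D.v
  f := -D.f
  smooth_f := D.smooth_f.neg
  fieldDeriv_pos := fun x => by
    rw [fieldDeriv_reverse, fieldDeriv_neg (D.mdifferentiableAt_f x), neg_neg]
    exact D.fieldDeriv_pos x
  box := fun p => (D.box p).reverse

/-- A curve along the field, parametrized by the values of `f`. -/
def IsLeaf (γ : ℝ → X) (a b : ℝ) : Prop :=
  ContinuousOn γ (Icc a b) ∧ (∀ r ∈ Icc a b, D.f (γ r) = r) ∧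
    ∀ p, ∀ r ∈ Icc a b, γ r ∈ (D.box p).B →
      ∀ᶠ s in 𝓝[Icc a b] r, (D.box p).σ (γ s) = (D.box p).σ (γ r)

/-- `y` is reached from `x` along the field. -/
def Below (x y : X) : Prop :=
  ∃ γ, D.IsLeaf γ (D.f x) (D.f y) ∧ D.f x ≤ D.f y ∧ γ (D.f x) = x ∧ γ (D.f y) = y

variable {D}

theorem strictMonoOn_slice {p : X} (b : FlowBox D.v p) (s : ℝ) :
    StrictMonoOn (fun r => D.f (b.κ (r, s))) {r | (r, s) ∈ boxRegion b.kind b.ε} := by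
  have hd := fun r (hr : r ∈ {r | (r, s) ∈ boxRegion b.kind b.ε}) =>
    b.hasDerivWithinAt_slice hr (D.mdifferentiableAt_f (b.κ (r, s)))
  refine strictMonoOn_of_deriv_pos (boxRegion_slice_ordConnected _ _ _).convex
    (fun r hr => (hd r hr).continuousWithinAt) fun r hr => ?_
  have hr' := interior_subset hr
  rw [((hd r hr').hasDerivAt (mem_interior_iff_mem_nhds.1 hr)).deriv]
  exact div_pos (D.fieldDeriv_pos _) (b.fieldDeriv_t_pos _ (b.mapsTo_κ _ hr'))

/-- In a flow box, the function increases with `t` along a slice. -/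
theorem f_lt_f_iff {p : X} (b : FlowBox D.v p) {x y : X} (hx : x ∈ b.B) (hy : y ∈ b.B)
    (hσ : b.σ x = b.σ y) : D.f x < D.f y ↔ b.t x < b.t y := by
  have h := (strictMonoOn_slice b (b.σ x)).lt_iff_lt (a := b.t x) (b := b.t y) (b.mapsTo x hx)
    (by rw [hσ]; exact b.mapsTo y hy)
  simp only [b.κ_tσ x hx] at h
  rw [hσ, b.κ_tσ y hy] at h
  exact h

theorem eq_of_f_eq {p : X} (b : FlowBox D.v p) {x y : X} (hx : x ∈ b.B) (hy : y ∈ b.B)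
    (hσ : b.σ x = b.σ y) (hf : D.f x = D.f y) : x = y := by
  have h1 := (f_lt_f_iff b hx hy hσ).not.1 hf.not_lt
  have h2 := (f_lt_f_iff b hy hx hσ.symm).not.1 hf.symm.not_lt
  rw [← b.κ_tσ x hx, ← b.κ_tσ y hy, hσ, le_antisymm (not_lt.1 h2) (not_lt.1 h1)]

/-- The label of any other box has derivative zero along the slice, hence is locally constant on it.
This makes the notion of leaf independent of the box. -/
theorem eventually_σ_slice {p q : X} (b : FlowBox D.v p) (c : FlowBox D.v q) {r s : ℝ}
    (hr : (r, s) ∈ boxRegion b.kind b.ε) (hc : b.κ (r, s) ∈ c.B) :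
    ∀ᶠ r' in 𝓝[{r | (r, s) ∈ boxRegion b.kind b.ε}] r, c.σ (b.κ (r', s)) = c.σ (b.κ (r, s)) := by
  set J := {r | (r, s) ∈ boxRegion b.kind b.ε} with hJ
  have hcont : ContinuousWithinAt (fun r => b.κ (r, s)) J r :=
    (b.smooth_κ.continuousOn _ hr).comp (t := boxRegion b.kind b.ε)
      (by fun_prop : Continuous fun r : ℝ => (r, s)).continuousWithinAt fun r hr => hr
  have hev := hcont.eventually (c.isOpen_B.mem_nhds hc)
  obtain ⟨δ, hδ, hball⟩ := Metric.mem_nhdsWithin_iff.1 hev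
  refine Metric.mem_nhdsWithin_iff.2 ⟨δ, hδ, fun r' hr' => ?_⟩
  have hconv : Convex ℝ (Metric.ball r δ ∩ J) :=
    (convex_ball r δ).inter (boxRegion_slice_ordConnected _ _ _).convex
  have hd : ∀ u ∈ Metric.ball r δ ∩ J,
      HasDerivWithinAt (fun r => c.σ (b.κ (r, s))) 0 (Metric.ball r δ ∩ J) u := fun u hu => by
    have h1 : b.κ (u, s) ∈ c.B := hball hu
    have h2 := b.hasDerivWithinAt_slice hu.2 (c.mdifferentiableAt_σ h1)
    rw [c.fieldDeriv_σ _ h1, zero_div] at h2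
    exact h2.mono inter_subset_right
  have := hconv.norm_image_sub_le_of_norm_hasDerivWithin_le (C := 0) hd (by simp)
    ⟨Metric.mem_ball_self hδ, hr⟩ hr'
  rw [zero_mul, norm_le_zero_iff, sub_eq_zero] at this
  exact this

/-- Points of the same slice of a flow box are reached from each other. -/
theorem below_of_slice {p : X} (b : FlowBox D.v p) {x y : X} (hx : x ∈ b.B) (hy : y ∈ b.B)
    (hσ : b.σ x = b.σ y) (ht : b.t x ≤ b.t y) : D.Below x y := by
  set s := b.σ x with hs
  have hJ : Icc (b.t x) (b.t y) ⊆ {r | (r, s) ∈ boxRegion b.kind b.ε} :=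
    (boxRegion_slice_ordConnected _ _ _).out (b.mapsTo x hx) (by
      show (b.t y, s) ∈ boxRegion b.kind b.ε
      rw [hσ]; exact b.mapsTo y hy)
  have hκx : b.κ (b.t x, s) = x := b.κ_tσ x hx
  have hκy : b.κ (b.t y, s) = y := by rw [hσ]; exact b.κ_tσ y hy
  have hκc : ContinuousOn (fun r => b.κ (r, s)) {r | (r, s) ∈ boxRegion b.kind b.ε} :=
    b.smooth_κ.continuousOn.comp (by fun_prop) fun r hr => hr
  -- `f` increases strictly along the slice, so the slice can be reparametrized by the values of
  -- `f`.
  obtain ⟨θ, hθc, hθ, hθ'⟩ := exists_continuousOn_inverse ht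
    ((D.smooth_f.continuous.comp_continuousOn hκc).mono hJ) ((strictMonoOn_slice b s).mono hJ)
  simp only [Function.comp_apply, hκx, hκy] at hθc hθ
  have hle : D.f x ≤ D.f y := by
    rcases ht.lt_or_eq with h | h
    · exact ((f_lt_f_iff b hx hy hσ).2 h).le
    · rw [← hκx, ← hκy, h]
  have hθmap : MapsTo θ (Icc (D.f x) (D.f y)) {r | (r, s) ∈ boxRegion b.kind b.ε} :=
    fun r hr => hJ (hθ r hr).1
  refine ⟨fun r => b.κ (θ r, s), ⟨hκc.comp hθc hθmap, fun r hr => (hθ r hr).2, ?_⟩, hle, ?_, ?_⟩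
  · intro q r hr hq
    have h1 := eventually_σ_slice b (D.box q) (hθmap hr) hq
    exact (tendsto_nhdsWithin_of_tendsto_nhds_of_eventually_within _ (hθc r hr)
      (eventually_mem_nhdsWithin.mono fun u hu => hθmap hu)).eventually h1
  · have h1 := hθ' (b.t x) (left_mem_Icc.2 ht)
    simp only [hκx, Function.comp_apply] at h1
    simp only [h1, hκx]
  · have h1 := hθ' (b.t y) (right_mem_Icc.2 ht)
    simp only [hκy, Function.comp_apply] at h1
    simp only [h1, hκy]

theorem IsLeaf.mono {γ : ℝ → X} {a b a' b' : ℝ} (h : D.IsLeaf γ a b) (ha : a ≤ a') (hb : b' ≤ b) :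
    D.IsLeaf γ a' b' := by
  have hsub : Icc a' b' ⊆ Icc a b := Icc_subset_Icc ha hb
  exact ⟨h.1.mono hsub, fun r hr => h.2.1 r (hsub hr), fun p r hr hp =>
    (h.2.2 p r (hsub hr) hp).filter_mono (nhdsWithin_mono _ hsub)⟩

/-- Leaves that meet at one level agree. -/
theorem IsLeaf.eqOn [T2Space X] {γ₁ γ₂ : ℝ → X} {a b : ℝ} (h₁ : D.IsLeaf γ₁ a b) (h₂ : D.IsLeaf γ₂ a b)
    {r₀ : ℝ} (hr₀ : r₀ ∈ Icc a b) (h : γ₁ r₀ = γ₂ r₀) : EqOn γ₁ γ₂ (Icc a b) := by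
  set S : Set (Icc a b) := {r | γ₁ r = γ₂ r} with hS
  have hc1 := continuousOn_iff_continuous_domRestrict.1 h₁.1
  have hc2 := continuousOn_iff_continuous_domRestrict.1 h₂.1
  have hclosed : IsClosed S := isClosed_eq hc1 hc2
  -- Near a common point both leaves keep the same `σ` in one box and have the same `f`, and these
  -- two values determine the point.
  have hopen : IsOpen S := by
    rw [isOpen_iff_mem_nhds]
    intro r hr
    have hr' : γ₁ r = γ₂ r := hr
    set c := D.box (γ₁ r) with hc
    have e1 := h₁.2.2 (γ₁ r) r r.2 c.mem_B
    have e2 := h₂.2.2 (γ₁ r) r r.2 (by rw [← hr']; exact c.mem_B)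
    have e3 := (h₁.1 r r.2).eventually (c.isOpen_B.mem_nhds c.mem_B)
    have e4 := (h₂.1 r r.2).eventually (c.isOpen_B.mem_nhds (by rw [← hr']; exact c.mem_B))
    rw [nhdsWithin_eq_map_subtype_coe r.2] at e1 e2 e3 e4
    filter_upwards [e1, e2, e3, e4] with s g1 g2 g3 g4
    refine eq_of_f_eq c g3 g4 ?_ ?_
    · rw [g1, g2, hr']
    · rw [h₁.2.1 s s.2, h₂.2.1 s s.2]
  have : PreconnectedSpace (Icc a b) := Subtype.preconnectedSpace isPreconnected_Icc
  have huniv : S = univ := IsClopen.eq_univ ⟨hclosed, hopen⟩ ⟨⟨r₀, hr₀⟩, h⟩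
  intro r hr
  have : (⟨r, hr⟩ : Icc a b) ∈ S := huniv ▸ mem_univ _
  exact this

theorem Below.refl (x : X) : D.Below x x :=
  below_of_slice (D.box x) (D.box x).mem_B (D.box x).mem_B rfl le_rfl

theorem Below.le {x y : X} (h : D.Below x y) : D.f x ≤ D.f y := h.choose_spec.2.1

theorem Below.eq_of_f_eq {x y : X} (h : D.Below x y) (hf : D.f x = D.f y) : x = y := by
  obtain ⟨γ, -, -, h1, h2⟩ := h
  rw [← h1, ← h2, hf]

theorem Below.lt {x y : X} (h : D.Below x y) (hne : x ≠ y) : D.f x < D.f y :=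
  h.le.lt_of_ne fun hf => hne (h.eq_of_f_eq hf)

theorem Below.trans {x y z : X} (hxy : D.Below x y) (hyz : D.Below y z) : D.Below x z := by
  obtain ⟨γ₁, h1, hle1, hx, hy⟩ := hxy
  obtain ⟨γ₂, h2, hle2, hy', hz⟩ := hyz
  set γ : ℝ → X := fun r => if r ≤ D.f y then γ₁ r else γ₂ r with hγ
  have hun : Icc (D.f x) (D.f z) = Icc (D.f x) (D.f y) ∪ Icc (D.f y) (D.f z) :=
    (Icc_union_Icc_eq_Icc hle1 hle2).symm
  have e1 : EqOn γ γ₁ (Icc (D.f x) (D.f y)) := fun r hr => if_pos hr.2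
  have e2 : EqOn γ γ₂ (Icc (D.f y) (D.f z)) := fun r hr => by
    rcases hr.1.lt_or_eq with h | h
    · exact if_neg (not_le.2 h)
    · subst h
      show (if _ then _ else _) = _
      rw [if_pos le_rfl, hy, hy']
  have hleaf : D.IsLeaf γ (D.f x) (D.f z) := by
    refine ⟨?_, ?_, ?_⟩
    · rw [hun]
      exact (h1.1.congr e1).union_of_isClosed (h2.1.congr e2) isClosed_Icc isClosed_Icc
    · intro r hr
      rw [hun] at hr
      rcases hr with hr | hr
      · rw [e1 hr]; exact h1.2.1 r hr
      · rw [e2 hr]; exact h2.2.1 r hr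
    · intro p r hr hp
      rw [hun, nhdsWithin_union, eventually_sup]
      have aux : ∀ (γ' : ℝ → X) (a b : ℝ), D.IsLeaf γ' a b → EqOn γ γ' (Icc a b) →
          ∀ᶠ s in 𝓝[Icc a b] r, (D.box p).σ (γ s) = (D.box p).σ (γ r) := by
        intro γ' a b hl he
        by_cases hrm : r ∈ Icc a b
        · have h3 := hl.2.2 p r hrm (by rwa [← he hrm])
          filter_upwards [h3, self_mem_nhdsWithin] with s hs hs'
          rw [he hs', he hrm, hs]
        · have : 𝓝[Icc a b] r = ⊥ := by
            rw [← notMem_closure_iff_nhdsWithin_eq_bot, isClosed_Icc.closure_eq]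
            exact hrm
          rw [this]
          exact eventually_bot
      exact ⟨aux _ _ _ h1 e1, aux _ _ _ h2 e2⟩
  exact ⟨γ, hleaf, hle1.trans hle2, by rw [e1 ⟨le_rfl, hle1⟩, hx], by rw [e2 ⟨hle2, le_rfl⟩, hz]⟩

theorem IsLeaf.below {γ : ℝ → X} {a b r₁ r₂ : ℝ} (h : D.IsLeaf γ a b) (h1 : a ≤ r₁) (h12 : r₁ ≤ r₂)
    (h2 : r₂ ≤ b) : D.Below (γ r₁) (γ r₂) := by
  have e1 := h.2.1 r₁ ⟨h1, h12.trans h2⟩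
  have e2 := h.2.1 r₂ ⟨h1.trans h12, h2⟩
  refine ⟨γ, ?_, ?_, ?_, ?_⟩
  · rw [e1, e2]
    exact h.mono h1 h2
  · rwa [e1, e2]
  · rw [e1]
  · rw [e2]

theorem Below.total_right [T2Space X] {x y z : X} (hy : D.Below x y) (hz : D.Below x z)
    (hf : D.f y ≤ D.f z) : D.Below y z := by
  obtain ⟨γ₁, h1, hle1, hx1, hy1⟩ := hy
  obtain ⟨γ₂, h2, hle2, hx2, hz2⟩ := hz
  have h3 := h1.eqOn (h2.mono le_rfl hf) (left_mem_Icc.2 hle1) (hx1.trans hx2.symm)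
  have h4 := h3 (right_mem_Icc.2 hle1)
  have := h2.below hle1 hf le_rfl
  rwa [← h4, hy1, hz2] at this

theorem Below.total_left [T2Space X] {x y z : X} (hy : D.Below y x) (hz : D.Below z x)
    (hf : D.f y ≤ D.f z) : D.Below y z := by
  obtain ⟨γ₁, h1, hle1, hx1, hy1⟩ := hy
  obtain ⟨γ₂, h2, hle2, hx2, hz2⟩ := hz
  have h3 := (h1.mono hf le_rfl).eqOn h2 (right_mem_Icc.2 hle2) (hy1.trans hz2.symm)
  have h4 := h3 (left_mem_Icc.2 hle2)
  have := h1.below le_rfl hf hle2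
  rwa [h4, hx1, hx2] at this

end FlowSystem

end

section

open Set Filter MeasureTheory

/-! ### Upper end points of leaves -/

namespace BoxKind

/-- The slices of the box have upper end points. -/
def HasTop (k : BoxKind) : Prop := k = .exit ∨ k = .tangent

/-- The time at which the slice at `s` ends. -/
noncomputable def topTime : BoxKind → ℝ → ℝ
  | .tangent, s => √s
  | _, _ => 0

/-- The parameters of the slices. -/
def topDomain : BoxKind → ℝ → Set ℝ
  | .tangent, ε => Ico 0 ε
  | _, ε => Ioo (-ε) ε

theorem continuous_topTime (k : BoxKind) : Continuous k.topTime := by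
  cases k
  case tangent => exact Real.continuous_sqrt
  all_goals exact continuous_const

theorem top_mem_iff {k : BoxKind} (hk : k.HasTop) {ε s : ℝ} (hε : 0 < ε) :
    (k.topTime s, s) ∈ boxRegion k ε ↔ s ∈ k.topDomain ε := by
  rcases hk with rfl | rfl
  · show ((0 : ℝ) ∈ Ioc (-ε) 0 ∧ s ∈ Ioo (-ε) ε) ↔ s ∈ Ioo (-ε) ε
    simp [hε]
  · show (√s ^ 2 ≤ s ∧ s < ε) ↔ s ∈ Ico 0 ε
    refine and_congr_left fun _ => ⟨fun h => (sq_nonneg _).trans h, fun h => (Real.sq_sqrt h).le⟩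

theorem mem_topDomain {k : BoxKind} (hk : k.HasTop) {ε t s : ℝ} (h : (t, s) ∈ boxRegion k ε) :
    s ∈ k.topDomain ε ∧ t ≤ k.topTime s := by
  rcases hk with rfl | rfl
  · exact ⟨h.2, h.1.2⟩
  · exact ⟨⟨(sq_nonneg t).trans h.1, h.2⟩, Real.le_sqrt_of_sq_le h.1⟩

theorem isMax_iff {k : BoxKind} {ε t s : ℝ} (h : (t, s) ∈ boxRegion k ε) :
    (∀ t', (t', s) ∈ boxRegion k ε → t' ≤ t) ↔ k.HasTop ∧ t = k.topTime s := by
  have hε : 0 < ε := by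
    cases k with
    | inner => linarith [h.1.1, h.1.2]
    | entry => linarith [h.1.1, h.1.2]
    | exit => linarith [h.1.1, h.1.2]
    | tangent => linarith [h.1, h.2, sq_nonneg t, show t ^ 2 ≤ s from h.1, show s < ε from h.2]
  constructor
  · intro hmax
    have htop : k.HasTop := by
      cases k with
      | inner =>
        have := hmax ((t + ε) / 2) ⟨⟨by linarith [h.1.1], by linarith [h.1.2]⟩, h.2⟩
        linarith [h.1.2]
      | entry =>
        have := hmax ((t + ε) / 2) ⟨⟨by linarith [h.1.1], by linarith [h.1.2]⟩, h.2⟩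
        linarith [h.1.2]
      | exit => exact Or.inl rfl
      | tangent => exact Or.inr rfl
    obtain ⟨h1, h2⟩ := mem_topDomain htop h
    exact ⟨htop, le_antisymm h2 (hmax _ ((top_mem_iff htop hε).2 h1))⟩
  · rintro ⟨htop, rfl⟩ t' ht'
    exact (mem_topDomain htop ht').2

end BoxKind

variable {X : Type*} [TopologicalSpace X] [ChartedSpace (EuclideanHalfSpace 2) X]

theorem differential_comp {F : X → ℝ} {x : X} {h : ℝ → ℝ} {h' : ℝ} (hh : HasDerivAt h h' (F x))
    (hF : MDifferentiableAt (𝓡∂ 2) 𝓘(ℝ, ℝ) F x) :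
    differential (fun y => h (F y)) x = h' • differential F x := by
  have h1 := (hh.hasFDerivAt.hasMFDerivAt.comp x hF.hasMFDerivAt).mfderiv
  refine h1.trans (ContinuousLinearMap.ext fun u => ?_)
  show (differential F x u) • h' = h' • differential F x u
  simp [mul_comm]

theorem differential_congr {F G : X → ℝ} {x : X} (h : F =ᶠ[𝓝 x] G) :
    differential F x = differential G x :=
  h.mfderiv_eq

namespace FlowSystem

variable {D : FlowSystem X}

variable (D) in
/-- `x` is the upper end point of its leaf. -/
def IsTop (x : X) : Prop := ∀ y, D.Below x y → y = x

/-- Whether a leaf ends is visible in any box around the point. A slice that goes on gives a higher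
point of the leaf; conversely a leaf that goes on must, at first, follow its slice in the box. -/
theorem isTop_iff {p x : X} (hx : x ∈ (D.box p).B) :
    D.IsTop x ↔ (D.box p).kind.HasTop ∧ (D.box p).t x = (D.box p).kind.topTime ((D.box p).σ x) := by
  set b := D.box p with hb
  rw [← BoxKind.isMax_iff (b.mapsTo x hx)]
  constructor
  · intro h t' ht'
    by_contra! hlt
    have h1 := below_of_slice b hx (b.mapsTo_κ _ ht') (b.σ_κ _ ht').symm
      (by rw [b.t_κ _ ht']; exact hlt.le)
    have h2 := congrArg b.t (h _ h1)
    rw [b.t_κ _ ht'] at h2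
    exact hlt.ne' h2
  · intro hmax y hy
    by_contra hne
    have hlt := hy.lt (Ne.symm hne)
    obtain ⟨γ, hγ, hle, hγx, hγy⟩ := hy
    have hmem : D.f x ∈ Icc (D.f x) (D.f y) := left_mem_Icc.2 hle
    have h1 := hγ.2.2 p _ hmem (by rw [hγx]; exact hx)
    have h2 := (hγ.1 _ hmem).eventually (b.isOpen_B.mem_nhds (by rw [hγx]; exact hx))
    have h3 : 𝓝[>] (D.f x) ≤ 𝓝[Icc (D.f x) (D.f y)] (D.f x) := by
      rw [← nhdsWithin_Ioc_eq_nhdsGT hlt]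
      exact nhdsWithin_mono _ Ioc_subset_Icc_self
    obtain ⟨r, ⟨hr1, hr2⟩, hr3⟩ := (((h1.and h2).filter_mono h3).and (Ioc_mem_nhdsGT hlt)).exists
    rw [hγx] at hr1
    have h4 : D.f x < D.f (γ r) := by
      rw [hγ.2.1 r (Ioc_subset_Icc_self hr3)]
      exact hr3.1
    have h5 := (f_lt_f_iff b hx hr2 hr1.symm).1 h4
    have h6 := b.mapsTo _ hr2
    rw [hr1] at h6
    linarith [hmax _ h6]

theorem isTop_κ {p : X} (hk : (D.box p).kind.HasTop) {s : ℝ}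
    (hs : s ∈ (D.box p).kind.topDomain (D.box p).ε) :
    D.IsTop ((D.box p).κ ((D.box p).kind.topTime s, s)) := by
  have h1 := (BoxKind.top_mem_iff hk (D.box p).ε_pos).2 hs
  rw [isTop_iff ((D.box p).mapsTo_κ _ h1)]
  refine ⟨hk, ?_⟩
  rw [(D.box p).t_κ _ h1, (D.box p).σ_κ _ h1]

theorem hasTop_of_isTop {x : X} (hx : D.IsTop x) : (D.box x).kind.HasTop :=
  ((isTop_iff (D.box x).mem_B).1 hx).1

theorem below_κ {p x : X} (hk : (D.box p).kind.HasTop) (hx : x ∈ (D.box p).B) :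
    (D.box p).σ x ∈ (D.box p).kind.topDomain (D.box p).ε ∧
    D.Below x ((D.box p).κ ((D.box p).kind.topTime ((D.box p).σ x), (D.box p).σ x)) := by
  obtain ⟨h1, h2⟩ := BoxKind.mem_topDomain hk ((D.box p).mapsTo x hx)
  have h3 := (BoxKind.top_mem_iff hk (D.box p).ε_pos).2 h1
  refine ⟨h1, below_of_slice (D.box p) hx ((D.box p).mapsTo_κ _ h3) ?_ ?_⟩
  · rw [(D.box p).σ_κ _ h3]
  · rwa [(D.box p).t_κ _ h3]

/-- In a box with an upper edge the end of the leaf is reached at once. In the others one can climb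
to the level `ε / 2`, which near `p` gains a definite amount of `f`. -/
theorem exists_top_or_rise (p : X) : ∃ η > 0, ∀ᶠ x in 𝓝 p,
    (∃ y, D.Below x y ∧ D.IsTop y) ∨ ∃ y, D.Below x y ∧ D.f x + η ≤ D.f y := by
  set b := D.box p with hb
  by_cases hk : b.kind.HasTop
  · refine ⟨1, one_pos, ?_⟩
    filter_upwards [b.isOpen_B.mem_nhds b.mem_B] with x hx
    obtain ⟨h1, h2⟩ := below_κ hk hx
    exact Or.inl ⟨_, h2, isTop_κ hk h1⟩
  · have hε := b.ε_pos
    have hreg : ∀ x ∈ b.B, (b.ε / 2, b.σ x) ∈ boxRegion b.kind b.ε := fun x hx => by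
      have h1 := b.mapsTo x hx
      cases hkind : b.kind with
      | inner =>
        rw [hkind] at h1
        exact ⟨⟨by linarith, by linarith⟩, h1.2⟩
      | entry =>
        rw [hkind] at h1
        exact ⟨⟨by linarith, by linarith⟩, h1.2⟩
      | exit => exact absurd (Or.inl hkind) hk
      | tangent => exact absurd (Or.inr hkind) hk
    have hp0 : b.t p = 0 ∧ b.σ p = 0 := by
      have h1 := b.t_κ _ (zero_mem_boxRegion b.kind hε)
      have h2 := b.σ_κ _ (zero_mem_boxRegion b.kind hε)
      rw [b.κ_zero] at h1 h2
      exact ⟨h1, h2⟩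
    have hcont : ContinuousAt (fun x => D.f (b.κ (b.ε / 2, b.σ x)) - D.f x) p := by
      have h1 : ContinuousOn (fun x => b.κ (b.ε / 2, b.σ x)) b.B :=
        b.smooth_κ.continuousOn.comp (continuousOn_const.prodMk b.smooth_σ.continuousOn) hreg
      exact (D.smooth_f.continuous.continuousAt.comp (h1.continuousAt (b.isOpen_B.mem_nhds b.mem_B))).sub
        D.smooth_f.continuous.continuousAt
    have hpos : 0 < D.f (b.κ (b.ε / 2, b.σ p)) - D.f p := by
      have h1 := (f_lt_f_iff b b.mem_B (b.mapsTo_κ _ (hreg p b.mem_B))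
        (b.σ_κ _ (hreg p b.mem_B)).symm).2 (by rw [b.t_κ _ (hreg p b.mem_B), hp0.1]; linarith)
      linarith
    refine ⟨(D.f (b.κ (b.ε / 2, b.σ p)) - D.f p) / 2, by linarith, ?_⟩
    have ht : ∀ᶠ x in 𝓝 p, b.t x < b.ε / 2 :=
      (b.smooth_t.continuousOn.continuousAt (b.isOpen_B.mem_nhds b.mem_B)).eventually
        (gt_mem_nhds (by rw [hp0.1]; linarith))
    filter_upwards [b.isOpen_B.mem_nhds b.mem_B, ht,
      hcont.eventually (lt_mem_nhds (half_lt_self hpos))] with x hx hxt hxf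
    refine Or.inr ⟨_, below_of_slice b hx (b.mapsTo_κ _ (hreg x hx)) (b.σ_κ _ (hreg x hx)).symm ?_, ?_⟩
    · rw [b.t_κ _ (hreg x hx)]
      exact hxt.le
    · linarith

/-- A top is determined by its coordinate in a box. -/
theorem IsTop.eq_κ {p x : X} (h : D.IsTop x) (hx : x ∈ (D.box p).B) :
    x = (D.box p).κ ((D.box p).kind.topTime ((D.box p).σ x), (D.box p).σ x) := by
  rw [← ((isTop_iff hx).1 h).2, (D.box p).κ_tσ x hx]

/-- Since `c.σ` is the parameter along `γ`, the velocity of `γ` is not proportional to the field; a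
nonzero linear form that kills the field cannot also kill this velocity. -/
theorem differential_apply_ne_zero {q : X} (c : FlowBox D.v q) {F : X → ℝ} {γ : ℝ → X} {s : ℝ}
    (hγ : MDifferentiableAt 𝓘(ℝ, ℝ) (𝓡∂ 2) γ s) (hmem : γ s ∈ c.B) (hσ : ∀ᶠ r in 𝓝 s, c.σ (γ r) = r)
    (hF : MDifferentiableAt (𝓡∂ 2) 𝓘(ℝ, ℝ) F (γ s)) (hF0 : differential F (γ s) (D.v (γ s)) = 0)
    (hFne : differential F (γ s) ≠ 0) : ∃ h' ≠ 0, HasDerivAt (fun r => F (γ r)) h' s := by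
  obtain ⟨w, hw⟩ := exists_velocity (mdifferentiableWithinAt_univ.2 hγ)
  have h1 := hw F hF
  rw [hasDerivWithinAt_univ] at h1
  refine ⟨_, fun h0 => ?_, h1⟩
  have h2 := hw c.σ (c.mdifferentiableAt_σ hmem)
  rw [hasDerivWithinAt_univ] at h2
  have h3 : differential c.σ (γ s) w = 1 :=
    h2.unique ((hasDerivAt_id s).congr_of_eventuallyEq hσ)
  have hv0 : D.v (γ s) ≠ 0 := fun h => by
    have h4 := D.fieldDeriv_pos (γ s)
    have : fieldDeriv D.v D.f (γ s) = 0 := by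
      unfold fieldDeriv
      rw [h]
      exact map_zero _
    linarith
  obtain ⟨a, ha⟩ := exists_eq_smul_of_apply_eq_zero hFne hv0 hF0 h0
  rw [ha] at h3
  have h5 : differential c.σ (γ s) (a • D.v (γ s)) = a • fieldDeriv D.v c.σ (γ s) :=
    map_smul (differential c.σ (γ s)) a _
  rw [show fieldDeriv D.v c.σ (γ s) = 0 from c.fieldDeriv_σ _ hmem, smul_zero] at h5
  exact zero_ne_one (h5.symm.trans h3)

variable [CompactSpace X]

variable (D) in
theorem exists_top (x : X) : ∃ y, D.Below x y ∧ D.IsTop y := by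
  choose η hη hN using fun p => exists_top_or_rise (D := D) p
  obtain ⟨t, ht⟩ := CompactSpace.elim_nhds_subcover _ hN
  have hmem : ∀ x, ∃ p ∈ t, (∃ y, D.Below x y ∧ D.IsTop y) ∨ ∃ y, D.Below x y ∧ D.f x + η p ≤ D.f y :=
    fun x => by
      obtain ⟨p, hp, h⟩ := mem_iUnion₂.1 (ht.ge (mem_univ x))
      exact ⟨p, hp, h⟩
  have htne : t.Nonempty := by
    obtain ⟨p, hp, -⟩ := hmem x
    exact ⟨p, hp⟩
  obtain ⟨p₀, -, hp₀⟩ := t.exists_min_image η htne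
  obtain ⟨M, hM⟩ := isCompact_univ.exists_bound_of_continuousOn D.smooth_f.continuous.continuousOn
  -- Each rise gains at least `η p₀`, the least gain in a finite cover, and `f` is bounded by `M`;
  -- so the number of rises is finite.
  have main : ∀ n : ℕ, ∀ x, M - D.f x ≤ n * η p₀ → ∃ y, D.Below x y ∧ D.IsTop y := by
    intro n
    induction n with
    | zero =>
      intro x hx
      obtain ⟨p, hp, h | ⟨y, -, hy⟩⟩ := hmem x
      · exact h
      · have := le_of_abs_le (hM y trivial)
        have := hη p
        push_cast at hx
        linarith
    | succ n ih =>
      intro x hx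
      obtain ⟨p, hp, h | ⟨y, hxy, hy⟩⟩ := hmem x
      · exact h
      · have h1 := hp₀ p hp
        push_cast at hx
        obtain ⟨z, hz, hzt⟩ := ih y (by linarith)
        exact ⟨z, hxy.trans hz, hzt⟩
  obtain ⟨n, hn⟩ := exists_nat_gt ((M - D.f x) / η p₀)
  exact main n x ((div_lt_iff₀ (hη p₀)).1 hn).le

variable (D) in
/-- The upper end point of the leaf of `x`. -/
noncomputable def top (x : X) : X := (D.exists_top x).choose

theorem below_top (x : X) : D.Below x (D.top x) := (D.exists_top x).choose_spec.1

theorem isTop_top (x : X) : D.IsTop (D.top x) := (D.exists_top x).choose_spec.2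

variable [T2Space X]

theorem top_eq_of_isTop {x y : X} (h : D.Below x y) (hy : D.IsTop y) : D.top x = y := by
  rcases le_total (D.f y) (D.f (D.top x)) with h1 | h1
  · exact hy _ (h.total_right (below_top x) h1)
  · exact (isTop_top x _ ((below_top x).total_right h h1)).symm

theorem IsTop.top_eq {x : X} (h : D.IsTop x) : D.top x = x := top_eq_of_isTop (Below.refl x) h

theorem top_eq_top {x y : X} (h : D.Below x y) : D.top x = D.top y :=
  top_eq_of_isTop (h.trans (below_top y)) (isTop_top y)

theorem top_eq_κ {p x : X} (hk : (D.box p).kind.HasTop) (hx : x ∈ (D.box p).B) :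
    D.top x = (D.box p).κ ((D.box p).kind.topTime ((D.box p).σ x), (D.box p).σ x) := by
  obtain ⟨h1, h2⟩ := below_κ hk hx
  exact top_eq_of_isTop h2 (isTop_κ hk h1)

variable (D) in
/-- Near `x` the end points of leaves lie in the box at `p`, where their coordinate is a smooth function
without critical points that is constant along the field. -/
def TopSmooth (p x : X) : Prop :=
  ∃ N, IsOpen N ∧ x ∈ N ∧ (∀ y ∈ N, D.top y ∈ (D.box p).B) ∧
    ContMDiffOn (𝓡∂ 2) 𝓘(ℝ, ℝ) ∞ (fun y => (D.box p).σ (D.top y)) N ∧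
    ∀ y ∈ N, differential (fun y => (D.box p).σ (D.top y)) y (D.v y) = 0 ∧
      differential (fun y => (D.box p).σ (D.top y)) y ≠ 0

theorem topSmooth_of_mem {p x : X} (hk : (D.box p).kind.HasTop) (hx : x ∈ (D.box p).B) :
    D.TopSmooth p x := by
  set b := D.box p with hb
  have hσ : EqOn (fun y => b.σ (D.top y)) b.σ b.B := fun y hy => by
    show b.σ (D.top y) = b.σ y
    rw [top_eq_κ hk hy]
    exact b.σ_κ _ ((BoxKind.top_mem_iff hk b.ε_pos).2 (below_κ hk hy).1)
  refine ⟨b.B, b.isOpen_B, hx, fun y hy => ?_, b.smooth_σ.congr hσ, fun y hy => ?_⟩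
  · rw [top_eq_κ hk hy]
    exact b.mapsTo_κ _ ((BoxKind.top_mem_iff hk b.ε_pos).2 (below_κ hk hy).1)
  · rw [differential_congr (hσ.eventuallyEq_of_mem (b.isOpen_B.mem_nhds hy))]
    exact ⟨b.fieldDeriv_σ y hy, b.mfderiv_σ_ne y hy⟩

/-- Points lower down in the box have the same leaf as the point of their slice at the level of `y`.
Hence their end point label is a function `h` of `c.σ` alone, and `h'` does not vanish because the
curve at constant level is transversal to the field. -/
theorem TopSmooth.of_slice {p q x y : X} (hy : D.TopSmooth p y) (hxB : x ∈ (D.box q).B)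
    (hyB : y ∈ (D.box q).B) (hσ : (D.box q).σ x = (D.box q).σ y)
    (ht : (D.box q).t x < (D.box q).t y) (hytop : ¬ D.IsTop y) : D.TopSmooth p x := by
  obtain ⟨N, hN, hyN, hNB, hNs, hNd⟩ := hy
  set c := D.box q with hc
  set t₀ := c.t y with ht₀
  set s₀ := c.σ y with hs₀
  have hmy := c.mapsTo y hyB
  have hmx := c.mapsTo x hxB
  -- the level `t₀` is interior for the slices near `s₀`
  have hreg : ∀ᶠ s in 𝓝 s₀, (t₀, s) ∈ boxRegion c.kind c.ε := by
    have hnt := mt (isTop_iff hyB).2 hytop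
    rw [hσ] at hmx
    cases hkind : c.kind with
    | inner =>
      rw [hkind] at hmy
      filter_upwards [isOpen_Ioo.mem_nhds hmy.2] with s hs
      exact ⟨hmy.1, hs⟩
    | entry =>
      rw [hkind] at hmy
      filter_upwards [isOpen_Ioo.mem_nhds hmy.2] with s hs
      exact ⟨hmy.1, hs⟩
    | exit =>
      rw [hkind] at hmy
      filter_upwards [isOpen_Ioo.mem_nhds hmy.2] with s hs
      exact ⟨hmy.1, hs⟩
    | tangent =>
      rw [hkind] at hmy hmx
      -- On the parabola itself `y` would be the upper end if `t₀ ≥ 0`, while `t₀ < 0` would leave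
      -- no room for `x` below `y`.
      have h1 : t₀ ^ 2 < s₀ := by
        refine lt_of_le_of_ne hmy.1 fun heq => hnt ⟨Or.inr hkind, ?_⟩
        rw [hkind]
        show t₀ = √s₀
        rw [← heq, Real.sqrt_sq_eq_abs, abs_of_nonneg]
        by_contra! hneg
        have h2 : c.t x ^ 2 ≤ s₀ := hmx.1
        nlinarith
      filter_upwards [lt_mem_nhds h1, gt_mem_nhds hmy.2] with s hs1 hs2
      exact ⟨hs1.le, hs2⟩
  set γ : ℝ → X := fun s => c.κ (t₀, s) with hγ
  have hγ0 : γ s₀ = y := c.κ_tσ y hyB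
  obtain ⟨U, hUreg, hU, hsU⟩ := eventually_nhds_iff.1 hreg
  have hγs : ContMDiffOn 𝓘(ℝ, ℝ) (𝓡∂ 2) ∞ γ U := by
    refine c.smooth_κ.comp (ContDiff.contMDiff ?_).contMDiffOn hUreg
    fun_prop
  set V := U ∩ γ ⁻¹' N with hV
  have hVo : IsOpen V := hγs.continuousOn.isOpen_inter_preimage hU hN
  have hsV : s₀ ∈ V := ⟨hsU, by rw [mem_preimage, hγ0]; exact hyN⟩
  set h : ℝ → ℝ := fun s => (D.box p).σ (D.top (γ s)) with hh
  have hhs : ContDiffOn ℝ ∞ h V :=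
    contMDiffOn_iff_contDiffOn.1 (hNs.comp (hγs.mono inter_subset_left) fun s hs => hs.2)
  have hhd : ∀ s ∈ V, ∃ h' ≠ 0, HasDerivAt h h' s := by
    intro s hs
    refine differential_apply_ne_zero c (F := fun y => (D.box p).σ (D.top y)) (γ := γ) ((hγs.contMDiffAt (hU.mem_nhds hs.1)).mdifferentiableAt
      (by simp)) (c.mapsTo_κ _ (hUreg s hs.1)) ?_ ((hNs.contMDiffAt (hN.mem_nhds hs.2)).mdifferentiableAt
      (by simp)) (hNd _ hs.2).1 (hNd _ hs.2).2
    filter_upwards [hU.mem_nhds hs.1] with r hr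
    exact c.σ_κ _ (hUreg r hr)
  set M := (c.B ∩ c.σ ⁻¹' V) ∩ {z | z ∈ c.B ∧ c.t z < t₀} with hM
  have hMo : IsOpen M := by
    refine (c.smooth_σ.continuousOn.isOpen_inter_preimage c.isOpen_B hVo).inter ?_
    exact c.smooth_t.continuousOn.isOpen_inter_preimage c.isOpen_B isOpen_Iio
  have htop : ∀ z ∈ M, D.top z = D.top (γ (c.σ z)) := fun z hz => by
    have h1 := hUreg _ hz.1.2.1
    refine top_eq_top (below_of_slice c hz.1.1 (c.mapsTo_κ _ h1) (c.σ_κ _ h1).symm ?_)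
    rw [c.t_κ _ h1]
    exact hz.2.2.le
  have heq : EqOn (fun z => (D.box p).σ (D.top z)) (fun z => h (c.σ z)) M := fun z hz => by
    simp only [hh, htop z hz]
  refine ⟨M, hMo, ⟨⟨hxB, by rw [mem_preimage, hσ]; exact hsV⟩, hxB, ht⟩, fun z hz => ?_, ?_, fun z hz => ?_⟩
  · rw [htop z hz]
    exact hNB _ hz.1.2.2
  · refine ContMDiffOn.congr ?_ heq
    exact hhs.contMDiffOn.comp (c.smooth_σ.mono fun z hz => hz.1.1) fun z hz => hz.1.2
  · obtain ⟨h', hh', hd⟩ := hhd _ hz.1.2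
    rw [differential_congr (heq.eventuallyEq_of_mem (hMo.mem_nhds hz)),
      differential_comp hd (c.mdifferentiableAt_σ hz.1.1)]
    refine ⟨?_, smul_ne_zero hh' (c.mfderiv_σ_ne z hz.1.1)⟩
    show h' • fieldDeriv D.v c.σ z = 0
    rw [c.fieldDeriv_σ z hz.1.1, smul_zero]

/-- The property holds in the box around the end point of the leaf, and descends along the leaf by
real induction, one slice at a time. -/
theorem topSmooth {p x : X} (hp : D.top x ∈ (D.box p).B) : D.TopSmooth p x := by
  have hk : (D.box p).kind.HasTop := ((isTop_iff hp).1 (isTop_top x)).1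
  obtain ⟨γ, hγ, hle, hγx, hγt⟩ := below_top (D := D) x
  have hbase : D.TopSmooth p (γ (D.f (D.top x))) := by
    rw [hγt]
    exact topSmooth_of_mem hk hp
  have := real_induction_down (Q := fun r => D.TopSmooth p (γ r)) hle hbase fun r hr => ?_
  · rwa [hγx] at this
  rcases hr.2.lt_or_eq with hlt | heq
  · have h1 := (hγ.1 r hr).eventually ((D.box (γ r)).isOpen_B.mem_nhds (D.box (γ r)).mem_B)
    have h2 := hγ.2.2 (γ r) r hr (D.box (γ r)).mem_B
    have h3 : ∀ᶠ r' in 𝓝[Icc (D.f x) (D.f (D.top x))] r, r' < D.f (D.top x) :=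
      nhdsWithin_le_nhds (gt_mem_nhds hlt)
    obtain ⟨δ, hδ, hball⟩ := Metric.mem_nhdsWithin_iff.1 ((h1.and h2).and h3)
    refine ⟨δ, hδ, fun r₁ hr₁ r₂ hr₂ hd1 hd2 h12 hQ => ?_⟩
    obtain ⟨⟨hB1, hσ1⟩, -⟩ := hball ⟨hd1, hr₁⟩
    obtain ⟨⟨hB2, hσ2⟩, hlt2⟩ := hball ⟨hd2, hr₂⟩
    rcases h12.lt_or_eq with h12 | rfl
    swap
    · exact hQ
    refine hQ.of_slice hB1 hB2 (hσ1.trans hσ2.symm) ?_ ?_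
    · refine (f_lt_f_iff _ hB1 hB2 (hσ1.trans hσ2.symm)).1 ?_
      rwa [hγ.2.1 _ hr₁, hγ.2.1 _ hr₂]
    · intro ht
      have h4 := ht _ (hγ.below hr₂.1 hr₂.2 le_rfl)
      rw [hγt] at h4
      rw [h4, hγ.2.1 _ hr₂] at hlt2
      exact lt_irrefl _ hlt2
  · have h1 := (hγ.1 r hr).eventually ((D.box p).isOpen_B.mem_nhds (by rw [heq, hγt]; exact hp))
    obtain ⟨δ, hδ, hball⟩ := Metric.mem_nhdsWithin_iff.1 h1
    exact ⟨δ, hδ, fun r₁ hr₁ r₂ hr₂ hd1 hd2 h12 hQ => topSmooth_of_mem hk (hball ⟨hd1, hr₁⟩)⟩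

/-- The smooth label `σ (top y)` determines `top y` through `κ (topTime σ, σ)`. This is only
continuous in general, since `topTime` is a square root in a tangent box. -/
theorem continuous_top : Continuous D.top := by
  rw [continuous_iff_continuousAt]
  intro x
  obtain ⟨N, hN, hxN, hNB, hNs, -⟩ := topSmooth (D := D) (D.box (D.top x)).mem_B
  set b := D.box (D.top x) with hb
  have hk : b.kind.HasTop := hasTop_of_isTop (isTop_top x)
  have h1 : ContinuousOn (fun s => b.κ (b.kind.topTime s, s)) (b.kind.topDomain b.ε) :=
    b.smooth_κ.continuousOn.comp (b.kind.continuous_topTime.prodMk continuous_id).continuousOn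
      fun s hs => (BoxKind.top_mem_iff hk b.ε_pos).2 hs
  have h2 : ContinuousOn D.top N := (h1.comp hNs.continuousOn fun y hy => (below_κ hk (hNB y hy)).1).congr
    fun y hy => (isTop_top y).eq_κ (hNB y hy)
  exact h2.continuousAt (hN.mem_nhds hxN)

end FlowSystem

end

section

open Set Filter MeasureTheory

/-! ### Curves with isometric charts -/

/-- An atlas of isometric charts, centred at all points, on a one-dimensional space with end points; the
chart at an end point is folded. -/
structure GeodesicAtlas (T : Type*) [TopologicalSpace T] where
  IsEnd : T → Prop
  r : T → ℝ
  c : T → ℝ → T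
  r_pos : ∀ z, 0 < r z
  c_zero : ∀ z, c z 0 = z
  continuousOn_c : ∀ z, ContinuousOn (c z) (Ioo (-r z) (r z))
  image_mem_nhds : ∀ z δ, 0 < δ → c z '' Ioo (-δ) δ ∈ 𝓝 z
  transition : ∀ z u, |u| < r z → ∃ ε : ℝ, (ε = 1 ∨ ε = -1) ∧ ∀ᶠ h in 𝓝 0, c z (u + h) = c (c z u) (ε * h)
  even : ∀ z, IsEnd z → ∀ u, |u| < r z → c z (-u) = c z u
  injOn_end : ∀ z, IsEnd z → InjOn (c z) (Ico 0 (r z))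
  injOn : ∀ z, ¬ IsEnd z → InjOn (c z) (Ioo (-r z) (r z))

theorem eventually_nhds_iff_add {p : ℝ → Prop} {t : ℝ} :
    (∀ᶠ s in 𝓝 t, p s) ↔ ∀ᶠ h in 𝓝 0, p (t + h) := by
  rw [← map_add_left_nhds_zero t, eventually_map]

theorem tendsto_const_mul_nhds_zero (ε : ℝ) : Tendsto (fun h => ε * h) (𝓝 0) (𝓝 0) :=
  (by fun_prop : Continuous fun h : ℝ => ε * h).tendsto' _ _ (by simp)

namespace GeodesicAtlas

variable {T : Type*} [TopologicalSpace T] (G : GeodesicAtlas T)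

/-- `γ` runs with unit speed near `t`. -/
def GeodesicAt (γ : ℝ → T) (t : ℝ) : Prop :=
  ∃ ε : ℝ, (ε = 1 ∨ ε = -1) ∧ ∀ᶠ h in 𝓝 0, γ (t + h) = G.c (γ t) (ε * h)

variable {G}

theorem continuousAt_c (z : T) : ContinuousAt (G.c z) 0 :=
  (G.continuousOn_c z).continuousAt (Ioo_mem_nhds (by linarith [G.r_pos z]) (G.r_pos z))

theorem GeodesicAt.continuousAt {γ : ℝ → T} {t : ℝ} (h : G.GeodesicAt γ t) : ContinuousAt γ t := by
  obtain ⟨ε, -, hε⟩ := h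
  have h1 : Tendsto (fun h => G.c (γ t) (ε * h)) (𝓝 0) (𝓝 (γ t)) := by
    have := (continuousAt_c (G := G) (γ t)).tendsto.comp (tendsto_const_mul_nhds_zero ε)
    rwa [G.c_zero] at this
  rw [ContinuousAt, ← map_add_left_nhds_zero t, tendsto_map'_iff]
  exact h1.congr' (hε.mono fun h hh => hh.symm)

theorem GeodesicAt.congr {γ γ' : ℝ → T} {t : ℝ} (h : G.GeodesicAt γ t) (he : γ =ᶠ[𝓝 t] γ') :
    G.GeodesicAt γ' t := by
  obtain ⟨ε, hε, h1⟩ := h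
  refine ⟨ε, hε, ?_⟩
  filter_upwards [h1, eventually_nhds_iff_add.1 he] with u hu hu'
  rw [← hu', hu, he.self_of_nhds]

theorem GeodesicAt.comp_affine {γ : ℝ → T} {b σ t : ℝ} (hσ : σ = 1 ∨ σ = -1)
    (h : G.GeodesicAt γ (b + σ * t)) : G.GeodesicAt (fun t => γ (b + σ * t)) t := by
  obtain ⟨ε, hε, h1⟩ := h
  refine ⟨ε * σ, ?_, ?_⟩
  · rcases hε with rfl | rfl <;> rcases hσ with rfl | rfl <;> simp
  · filter_upwards [(tendsto_const_mul_nhds_zero σ).eventually h1] with u hu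
    rw [mul_assoc, ← hu]
    congr 1
    ring

theorem geodesicAt_c {z : T} {u : ℝ} (hu : |u| < G.r z) : G.GeodesicAt (G.c z) u :=
  G.transition z u hu

variable [T2Space T]

/-- At the common point the curves run in the same or in opposite directions. Opposite directions
make no difference at a folded end point; elsewhere injectivity of the chart would allow no other
meeting point nearby. -/
theorem GeodesicAt.eventuallyEq {γ₁ γ₂ : ℝ → T} {t : ℝ} (h₁ : G.GeodesicAt γ₁ t)
    (h₂ : G.GeodesicAt γ₂ t) (h : ∃ᶠ s in 𝓝[≠] t, γ₁ s = γ₂ s) : γ₁ =ᶠ[𝓝 t] γ₂ := by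
  have h0 : γ₁ t = γ₂ t := tendsto_nhds_unique_of_frequently_eq
    (h₁.continuousAt.tendsto.mono_left nhdsWithin_le_nhds)
    (h₂.continuousAt.tendsto.mono_left nhdsWithin_le_nhds) h
  obtain ⟨ε₁, hε₁, e₁⟩ := h₁
  obtain ⟨ε₂, hε₂, e₂⟩ := h₂
  rw [← h0] at e₂
  set x := γ₁ t with hx
  have hsmall : ∀ᶠ h in 𝓝 (0 : ℝ), |h| < G.r x := by
    have := (continuous_abs.tendsto (0 : ℝ)).eventually (gt_mem_nhds (by simpa using G.r_pos x))
    exact this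
  refine eventually_nhds_iff_add.2 ?_
  by_cases heq : ε₁ = ε₂
  · filter_upwards [e₁, e₂] with u h1 h2
    rw [h1, h2, heq]
  have hneg : ε₂ = -ε₁ := by
    rcases hε₁ with rfl | rfl <;> rcases hε₂ with rfl | rfl <;> simp_all
  have habs : ∀ u : ℝ, |ε₁ * u| = |u| := fun u => by rcases hε₁ with rfl | rfl <;> simp
  by_cases hend : G.IsEnd x
  · filter_upwards [e₁, e₂, hsmall] with u h1 h2 h3
    rw [h1, h2, hneg, neg_mul, G.even x hend _ (by rwa [habs])]
  · exfalso
    have hev : ∀ᶠ s in 𝓝 t, s ≠ t → γ₁ s ≠ γ₂ s := by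
      refine eventually_nhds_iff_add.2 ?_
      filter_upwards [e₁, e₂, hsmall] with u h1 h2 h3 hne hcon
      rw [h1, h2, hneg, neg_mul] at hcon
      have h4 := habs u ▸ h3
      have h5 := G.injOn x hend (abs_lt.1 h4) (abs_lt.1 (by rwa [abs_neg])) hcon
      have h6 : ε₁ * u = 0 := by linarith
      have h7 := habs u
      rw [h6, abs_zero] at h7
      exact hne (by rw [abs_eq_zero.1 h7.symm, add_zero])
    exact h (eventually_nhdsWithin_iff.2 hev)

/-- Geodesics that agree near one time agree. -/
theorem geodesic_unique {γ₁ γ₂ : ℝ → T} {J : Set ℝ} (hJ : IsPreconnected J)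
    (h₁ : ∀ t ∈ J, G.GeodesicAt γ₁ t) (h₂ : ∀ t ∈ J, G.GeodesicAt γ₂ t) {t₀ : ℝ} (ht₀ : t₀ ∈ J)
    (h : γ₁ =ᶠ[𝓝 t₀] γ₂) : EqOn γ₁ γ₂ J := by
  have hsub : J ⊆ {t | γ₁ =ᶠ[𝓝 t] γ₂} := by
    refine hJ.subset_of_closure_inter_subset isOpen_setOfPred_eventually_nhds ⟨t₀, ht₀, h⟩ ?_
    rintro t ⟨htc, htJ⟩
    refine (h₁ t htJ).eventuallyEq (h₂ t htJ) fun hcon => ?_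
    have h1 := mem_closure_iff_frequently.1 htc
    have h2 := (eventually_nhdsWithin_iff.1 hcon).eventually_nhds
    obtain ⟨s, hs1, hs2⟩ := (h1.and_eventually h2).exists
    -- Near `s` the curves agree, and near `t` they were assumed to differ except at `t`; so a
    -- neighbourhood of `s` would reduce to the point `t`.
    have h3 : ∀ᶠ u in 𝓝 s, u = t := by
      filter_upwards [hs1, hs2] with u hu1 hu2
      by_contra hne
      exact hu2 hne hu1
    have h4 : ∀ᶠ u in 𝓝[≠] s, False := by
      filter_upwards [h3.filter_mono nhdsWithin_le_nhds, self_mem_nhdsWithin] with u hu hne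
      exact hne (hu.trans h3.self_of_nhds.symm)
    exact h4.exists.choose_spec
  exact fun t ht => (hsub ht).self_of_nhds

section existence

variable [CompactSpace T] [Nonempty T]

variable (G) in
/-- Geodesics can be prolonged by a uniform time. -/
theorem exists_uniform_time : ∃ δ > 0, ∀ (γ : ℝ → T) (t : ℝ), G.GeodesicAt γ t →
    ∃ β : ℝ → T, (∀ h ∈ Ioo (-δ) δ, G.GeodesicAt β h) ∧ ∀ᶠ h in 𝓝 0, γ (t + h) = β h := by
  obtain ⟨F, hF⟩ := CompactSpace.elim_nhds_subcover (fun z => G.c z '' Ioo (-(G.r z / 2)) (G.r z / 2))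
    fun z => G.image_mem_nhds z _ (half_pos (G.r_pos z))
  have hFne : F.Nonempty := by
    obtain ⟨x⟩ := ‹Nonempty T›
    obtain ⟨z, hz, -⟩ := mem_iUnion₂.1 (hF.ge (mem_univ x))
    exact ⟨z, hz⟩
  obtain ⟨z₀, -, hz₀⟩ := F.exists_min_image G.r hFne
  refine ⟨G.r z₀ / 2, half_pos (G.r_pos z₀), fun γ t hγ => ?_⟩
  obtain ⟨z, hz, u, hu, hux⟩ := mem_iUnion₂.1 (hF.ge (mem_univ (γ t)))
  have hmin := hz₀ z hz
  obtain ⟨ε₂, hε₂, e₂⟩ := hγ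
  have hur : |u| < G.r z := by
    have := abs_lt.2 hu
    linarith [G.r_pos z]
  obtain ⟨ε₁, hε₁, e₁⟩ := G.transition z u hur
  rw [hux] at e₁
  have hσ : ε₁ * ε₂ = 1 ∨ ε₁ * ε₂ = -1 := by
    rcases hε₁ with rfl | rfl <;> rcases hε₂ with rfl | rfl <;> simp
  refine ⟨fun h => G.c z (u + ε₁ * ε₂ * h), fun h hh => ?_, ?_⟩
  · refine GeodesicAt.comp_affine (γ := G.c z) hσ (geodesicAt_c ?_)
    rw [abs_lt]
    rcases hσ with h1 | h1 <;> rw [h1] <;> constructor <;> linarith [hh.1, hh.2, hu.1, hu.2]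
  · filter_upwards [e₂, (tendsto_const_mul_nhds_zero (ε₁ * ε₂)).eventually e₁] with h h2 h1
    rw [h2, h1]
    congr 1
    rcases hε₁ with rfl | rfl <;> simp

/-- The prolongation starts at a point `t₁` within `δ / 2` of `b`, so it reaches beyond `b + δ / 2`;
uniqueness glues it to `γ`. -/
theorem exists_extension_right {δ : ℝ} (hδ : 0 < δ) (H : ∀ (γ : ℝ → T) (t : ℝ), G.GeodesicAt γ t →
      ∃ β : ℝ → T, (∀ h ∈ Ioo (-δ) δ, G.GeodesicAt β h) ∧ ∀ᶠ h in 𝓝 0, γ (t + h) = β h)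
    {γ : ℝ → T} {a b : ℝ} (hab : a < b) (hγ : ∀ t ∈ Ioo a b, G.GeodesicAt γ t) :
    ∃ γ', (∀ t ∈ Ioo a (b + δ / 2), G.GeodesicAt γ' t) ∧ EqOn γ γ' (Ioo a b) := by
  set t₁ := max ((a + b) / 2) (b - δ / 2) with ht₁
  have h1 : a < t₁ := lt_of_lt_of_le (by linarith) (le_max_left _ _)
  have h2 : t₁ < b := max_lt (by linarith) (by linarith)
  have h3 : b - δ / 2 ≤ t₁ := le_max_right _ _
  obtain ⟨β, hβ, hβγ⟩ := H γ t₁ (hγ t₁ ⟨h1, h2⟩)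
  have hβ' : ∀ t ∈ Ioo (t₁ - δ) (t₁ + δ), G.GeodesicAt (fun t => β (-t₁ + 1 * t)) t := fun t ht =>
    GeodesicAt.comp_affine (Or.inl rfl) (hβ _ ⟨by linarith [ht.1], by linarith [ht.2]⟩)
  have hagree : EqOn γ (fun t => β (-t₁ + 1 * t)) (Ioo (max a (t₁ - δ)) b) := by
    refine geodesic_unique (G := G) isPreconnected_Ioo
      (fun t ht => hγ t ⟨(le_max_left _ _).trans_lt ht.1, ht.2⟩)
      (fun t ht => hβ' t ⟨(le_max_right _ _).trans_lt ht.1, by linarith [ht.2]⟩)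
      (t₀ := t₁) ⟨max_lt h1 (by linarith), h2⟩ (eventually_nhds_iff_add.2 ?_)
    filter_upwards [hβγ] with h hh
    rw [hh]
    congr 1
    ring
  refine ⟨fun t => if t < b then γ t else β (-t₁ + 1 * t), fun t ht => ?_, fun t ht => ?_⟩
  · rcases lt_or_ge t b with htb | htb
    · refine (hγ t ⟨ht.1, htb⟩).congr ?_
      filter_upwards [gt_mem_nhds htb] with s hs
      rw [if_pos hs]
    · refine (hβ' t ⟨by linarith, by linarith [ht.2]⟩).congr ?_
      have hm : max a (t₁ - δ) < t := max_lt ht.1 (by linarith)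
      filter_upwards [lt_mem_nhds hm] with s hs
      split_ifs with hsb
      · exact (hagree ⟨hs, hsb⟩).symm
      · rfl
  · simp only [if_pos ht.2]

variable (G) in
/-- Geodesics exist for all times. -/
theorem exists_geodesic (x : T) : ∃ γ : ℝ → T, (∀ t, G.GeodesicAt γ t) ∧ γ 0 = x := by
  obtain ⟨δ, hδ, H⟩ := G.exists_uniform_time
  -- Reversal of time reduces extension to the left to extension to the right.
  have hneg : ∀ {γ : ℝ → T} {a b : ℝ}, (∀ t ∈ Ioo a b, G.GeodesicAt γ t) →
      ∀ t ∈ Ioo (-b) (-a), G.GeodesicAt (fun t => γ (0 + (-1) * t)) t := fun h t ht =>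
    GeodesicAt.comp_affine (Or.inr rfl) (h _ ⟨by linarith [ht.2], by linarith [ht.1]⟩)
  have hn : ∀ n : ℕ, ∃ γ : ℝ → T, (∀ t ∈ Ioo (-((n + 1) * (δ / 2))) ((n + 1) * (δ / 2)), G.GeodesicAt γ t) ∧
      γ =ᶠ[𝓝 0] G.c x := by
    intro n
    induction n with
    | zero =>
      obtain ⟨β, hβ, hβx⟩ := H (G.c x) 0 (geodesicAt_c (by simpa using G.r_pos x))
      refine ⟨β, fun t ht => hβ t ⟨?_, ?_⟩, ?_⟩
      · have := ht.1; push_cast at this; linarith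
      · have := ht.2; push_cast at this; linarith
      · filter_upwards [hβx] with h hh
        rw [← hh, zero_add]
    | succ n ih =>
      obtain ⟨γ, hγ, hγx⟩ := ih
      set a : ℝ := (n + 1) * (δ / 2) with ha
      have hapos : 0 < a := by positivity
      obtain ⟨γ₁, hγ₁, e₁⟩ := exists_extension_right hδ H (by linarith : -a < a) hγ
      have h2 := hneg hγ₁
      rw [neg_neg] at h2
      obtain ⟨γ₂, hγ₂, e₂⟩ := exists_extension_right hδ H (by linarith : -(a + δ / 2) < a) h2
      have h3 := hneg hγ₂
      rw [neg_neg] at h3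
      have hlen : ((n + 1 : ℕ) + 1 : ℝ) * (δ / 2) = a + δ / 2 := by rw [ha]; push_cast; ring
      rw [hlen]
      refine ⟨_, h3, ?_⟩
      filter_upwards [hγx, Ioo_mem_nhds (show -a < 0 by linarith) hapos] with t ht htm
      rw [← ht, e₁ htm]
      have h4 := e₂ (show -t ∈ Ioo (-(a + δ / 2)) a from ⟨by linarith [htm.2], by linarith [htm.1]⟩)
      simp only [neg_mul, one_mul, zero_add, neg_neg] at h4 ⊢
      exact h4.symm
  choose γ hγ hγx using hn
  set a : ℕ → ℝ := fun n => (n + 1) * (δ / 2) with ha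
  have hapos : ∀ n, 0 < a n := fun n => by positivity
  have hunique : ∀ n m t, |t| < a n → |t| < a m → γ n t = γ m t := by
    intro n m t h1 h2
    have hmin : 0 < min (a n) (a m) := lt_min (hapos n) (hapos m)
    have hmem : ∀ s, s ∈ Ioo (-min (a n) (a m)) (min (a n) (a m)) → |s| < a n ∧ |s| < a m := fun s hs =>
      lt_min_iff.1 (abs_lt.2 hs)
    exact geodesic_unique (G := G) isPreconnected_Ioo (fun s hs => hγ n s (abs_lt.1 (hmem s hs).1))
      (fun s hs => hγ m s (abs_lt.1 (hmem s hs).2)) (t₀ := 0) ⟨by linarith, hmin⟩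
      ((hγx n).trans (hγx m).symm) (abs_lt.1 (lt_min h1 h2))
  have hN : ∀ t : ℝ, ∃ n, |t| < a n := fun t => by
    obtain ⟨n, hn⟩ := exists_nat_gt (|t| / (δ / 2))
    refine ⟨n, ?_⟩
    have := (div_lt_iff₀ (half_pos hδ)).1 hn
    simp only [ha]
    linarith
  choose N hN using hN
  refine ⟨fun t => γ (N t) t, fun t => ?_, ?_⟩
  · refine (hγ (N t) t (abs_lt.1 (hN t))).congr ?_
    filter_upwards [(continuous_abs.tendsto t).eventually (gt_mem_nhds (hN t))] with s hs
    exact hunique _ _ _ hs (hN s)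
  · show γ (N 0) 0 = x
    rw [(hγx _).self_of_nhds, G.c_zero]

end existence

end GeodesicAtlas

end

/-! ### Closed and bouncing geodesics: classification of compact connected curves -/

section

open Set Filter MeasureTheory

namespace GeodesicAtlas

variable {T : Type*} [TopologicalSpace T] {G : GeodesicAtlas T}

theorem GeodesicAt.eventually_eq_of_eq {γ₁ γ₂ : ℝ → T} {a b : ℝ} (h₁ : G.GeodesicAt γ₁ a)
    (h₂ : G.GeodesicAt γ₂ b) (h : γ₁ a = γ₂ b) :
    ∃ ε : ℝ, (ε = 1 ∨ ε = -1) ∧ ∀ᶠ u in 𝓝 0, γ₁ (a + u) = γ₂ (b + ε * u) := by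
  obtain ⟨ε₁, hε₁, e₁⟩ := h₁
  obtain ⟨ε₂, hε₂, e₂⟩ := h₂
  refine ⟨ε₂ * ε₁, by rcases hε₁ with rfl | rfl <;> rcases hε₂ with rfl | rfl <;> simp, ?_⟩
  filter_upwards [e₁, (tendsto_const_mul_nhds_zero (ε₂ * ε₁)).eventually e₂] with u h1 h2
  rw [h1, h2, h]
  congr 1
  rcases hε₂ with rfl | rfl <;> simp

theorem GeodesicAt.image_mem_nhds {γ : ℝ → T} {t δ : ℝ} (h : G.GeodesicAt γ t) (hδ : 0 < δ) :
    γ '' Ioo (t - δ) (t + δ) ∈ 𝓝 (γ t) := by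
  obtain ⟨ε, hε, he⟩ := h
  obtain ⟨η, hη, hball⟩ := Metric.eventually_nhds_iff.1 he
  refine mem_of_superset (G.image_mem_nhds (γ t) (min η δ) (lt_min hη hδ)) ?_
  rintro _ ⟨u, hu, rfl⟩
  have h1 := lt_min_iff.1 (abs_lt.2 hu)
  have h2 : |ε * u| = |u| := by rcases hε with rfl | rfl <;> simp
  refine ⟨t + ε * u, ?_, ?_⟩
  · have := abs_lt.1 (h2.trans_lt h1.2)
    constructor <;> linarith
  · rw [hball (by rw [dist_zero_right, Real.norm_eq_abs, h2]; exact h1.1)]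
    congr 1
    rcases hε with rfl | rfl <;> simp

variable [T2Space T] {γ : ℝ → T} (hγ : ∀ t, G.GeodesicAt γ t)
include hγ

/-- By uniqueness a single coincidence makes `γ` invariant under a translation or a reflection of
the whole line. -/
theorem eq_of_eq {a b : ℝ} (h : γ a = γ b) :
    ∃ ε : ℝ, (ε = 1 ∨ ε = -1) ∧ ∀ u, γ (a + u) = γ (b + ε * u) := by
  obtain ⟨ε, hε, he⟩ := (hγ a).eventually_eq_of_eq (hγ b) h
  refine ⟨ε, hε, fun u => ?_⟩
  refine geodesic_unique (G := G) isPreconnected_univ (γ₁ := fun u => γ (a + u)) (t₀ := 0)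
    (γ₂ := fun u => γ (b + ε * u)) (fun t _ => ?_) (fun t _ => ?_) trivial he (mem_univ u)
  · have := GeodesicAt.comp_affine (G := G) (γ := γ) (b := a) (σ := 1) (t := t) (Or.inl rfl) (hγ _)
    simpa using this
  · exact GeodesicAt.comp_affine hε (hγ _)

/-- End points are where the geodesic turns back: the folded chart is even, while an unfolded chart
is injective. -/
theorem isEnd_iff {t : ℝ} : G.IsEnd (γ t) ↔ ∀ u, γ (t + u) = γ (t - u) := by
  obtain ⟨ε, hε, he⟩ := hγ t
  have hsmall : ∀ᶠ h in 𝓝 (0 : ℝ), |h| < G.r (γ t) :=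
    (continuous_abs.tendsto (0 : ℝ)).eventually (gt_mem_nhds (by simpa using G.r_pos (γ t)))
  have habs : ∀ u : ℝ, |ε * u| = |u| := fun u => by rcases hε with rfl | rfl <;> simp
  have hneg : Tendsto (fun u : ℝ => -u) (𝓝 0) (𝓝 0) := by simpa using tendsto_const_mul_nhds_zero (-1)
  constructor
  · intro h u
    refine geodesic_unique (G := G) isPreconnected_univ (γ₁ := fun u => γ (t + u)) (t₀ := 0)
      (γ₂ := fun u => γ (t - u)) (fun s _ => ?_) (fun s _ => ?_) trivial ?_ (mem_univ u)
    · have := GeodesicAt.comp_affine (G := G) (γ := γ) (b := t) (σ := 1) (t := s) (Or.inl rfl) (hγ _)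
      simpa using this
    · have := GeodesicAt.comp_affine (G := G) (γ := γ) (b := t) (σ := -1) (t := s) (Or.inr rfl) (hγ _)
      simpa [sub_eq_add_neg] using this
    · filter_upwards [he, hneg.eventually he, hsmall] with s h1 h2 h3
      rw [sub_eq_add_neg, h1, h2, mul_neg, G.even _ h _ (by rwa [habs])]
  · intro h
    by_contra hend
    have hev : ∀ᶠ u in 𝓝 (0 : ℝ), u = 0 := by
      filter_upwards [he, hneg.eventually he, hsmall] with s h1 h2 h3
      have h4 := h s
      rw [sub_eq_add_neg, h1, h2, mul_neg] at h4
      rw [← habs s] at h3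
      have h5 := G.injOn _ hend (abs_lt.1 h3) (abs_lt.1 (by rwa [abs_neg])) h4
      have h6 : ε * s = 0 := by linarith
      have h7 := habs s
      rw [h6, abs_zero] at h7
      exact abs_eq_zero.1 h7.symm
    obtain ⟨η, hη, hball⟩ := Metric.eventually_nhds_iff.1 hev
    have := @hball (η / 2) (by rw [dist_zero_right, Real.norm_eq_abs, abs_of_pos] <;> linarith)
    linarith

theorem surjective [ConnectedSpace T] : Function.Surjective γ := by
  rw [← range_eq_univ]
  refine IsClopen.eq_univ ⟨isClosed_of_closure_subset fun y hy => ?_, ?_⟩ ⟨_, mem_range_self 0⟩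
  -- The chart at a limit point `y` is itself a geodesic that meets `γ`, so it is a part of `γ`, and
  -- `y` is its centre.
  · obtain ⟨_, ⟨u, hu, rfl⟩, t, ht⟩ := mem_closure_iff_nhds.1 hy _ (G.image_mem_nhds y _ (G.r_pos y))
    have hcu := geodesicAt_c (G := G) (abs_lt.2 hu)
    obtain ⟨ε, hε, he⟩ := hcu.eventually_eq_of_eq (hγ t) ht.symm
    have h1 : EqOn (G.c y) (fun s => γ ((t - ε * u) + ε * s)) (Ioo (-G.r y) (G.r y)) := by
      refine geodesic_unique (G := G) isPreconnected_Ioo (fun s hs => geodesicAt_c (abs_lt.2 hs))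
        (fun s _ => GeodesicAt.comp_affine hε (hγ _)) hu (eventually_nhds_iff_add.2 ?_)
      filter_upwards [he] with h hh
      rw [hh]
      congr 1
      ring
    have h2 := h1 (show (0 : ℝ) ∈ Ioo (-G.r y) (G.r y) from ⟨by linarith [G.r_pos y], G.r_pos y⟩)
    rw [G.c_zero] at h2
    exact ⟨_, h2.symm⟩
  · rw [isOpen_iff_mem_nhds]
    rintro _ ⟨t, rfl⟩
    exact mem_of_superset ((hγ t).image_mem_nhds one_pos) (image_subset_range _ _)

/-- The open sets `γ '' (-n, n)` increase and cover the compact space, so one of them is everything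
and contains `γ (n + 1)`. -/
theorem exists_return [ConnectedSpace T] [CompactSpace T] : ∃ a b, |b| < a ∧ γ a = γ b := by
  have hopen : ∀ n : ℕ, IsOpen (γ '' Ioo (-(n : ℝ)) n) := fun n => by
    rw [isOpen_iff_mem_nhds]
    rintro _ ⟨t, ht, rfl⟩
    have hδ : 0 < min (t + n) (n - t) := lt_min (by linarith [ht.1]) (by linarith [ht.2])
    refine mem_of_superset ((hγ t).image_mem_nhds hδ) (image_mono fun s hs => ⟨?_, ?_⟩)
    · linarith [hs.1, min_le_left (t + n) (n - t)]
    · linarith [hs.2, min_le_right (t + n) (n - t)]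
  obtain ⟨n, hn⟩ := isCompact_univ.elim_directed_cover _ hopen (fun x _ => by
    obtain ⟨t, rfl⟩ := surjective hγ x
    obtain ⟨n, hn⟩ := exists_nat_gt |t|
    exact mem_iUnion.2 ⟨n, t, abs_lt.1 hn, rfl⟩) (directed_of_isDirected_le fun i j hij =>
      image_mono (Ioo_subset_Ioo (by simpa using hij) (by simpa using hij)))
  obtain ⟨t, ht, h⟩ := hn (mem_univ (γ (n + 1)))
  exact ⟨n + 1, t, (abs_lt.2 ht).trans (by linarith), h.symm⟩

/-- The periods of a closed geodesic or of a geodesic that bounces between end points. -/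
theorem exists_period [ConnectedSpace T] [CompactSpace T] (h : (∀ x, ¬ G.IsEnd x) ∨ G.IsEnd (γ 0)) :
    ∃ R > 0, ∀ p, (∀ u, γ (u + p) = γ u) ↔ ∃ n : ℤ, p = n * R := by
  let P : AddSubgroup ℝ :=
    { carrier := {p | ∀ u, γ (u + p) = γ u}
      add_mem' := fun {p q} hp hq u => by rw [← add_assoc, hq, hp]
      zero_mem' := fun u => by rw [add_zero]
      neg_mem' := fun {p} hp u => by
        have := hp (u + -p)
        rwa [neg_add_cancel_right, eq_comm] at this }
  have hP : ∀ {p}, p ∈ P ↔ ∀ u, γ (u + p) = γ u := Iff.rfl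
  -- A return gives either the period `a - b` or the symmetry about `(a + b) / 2`. The latter is an
  -- end point if there is one; if `γ 0` is an end, composing with the symmetry about `0` gives the
  -- period `a + b`. Both numbers are nonzero because `|b| < a`.
  obtain ⟨p, hp, hp0⟩ : ∃ p ∈ P, p ≠ 0 := by
    obtain ⟨a, b, hab, he⟩ := exists_return hγ
    obtain ⟨h1, h2⟩ := abs_lt.1 hab
    obtain ⟨ε, rfl | rfl, hε⟩ := eq_of_eq hγ he
    · refine ⟨a - b, hP.2 fun u => ?_, by linarith⟩
      have := hε (u - b)
      rwa [show a + (u - b) = u + (a - b) by ring, show b + 1 * (u - b) = u by ring] at this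
    · rcases h with h | h
      · refine absurd ((isEnd_iff hγ).2 fun u => ?_) (h (γ ((a + b) / 2)))
        have := hε ((b - a) / 2 + u)
        rwa [show a + ((b - a) / 2 + u) = (a + b) / 2 + u by ring,
          show b + -1 * ((b - a) / 2 + u) = (a + b) / 2 - u by ring] at this
      · have hev := (isEnd_iff hγ).1 h
        refine ⟨a + b, hP.2 fun u => ?_, by linarith⟩
        have h3 := hε (u + b)
        have h4 := hev u
        rw [show a + (u + b) = u + (a + b) by ring, show b + -1 * (u + b) = 0 - u by ring, ← h4,
          zero_add] at h3
        exact h3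
  -- The chart at `γ 0` is injective for small positive parameters, so there are no small periods
  -- and the group of periods is cyclic.
  have hiso : ∃ δ : ℝ, 0 < δ ∧ Disjoint (P : Set ℝ) (Ioo 0 δ) := by
    obtain ⟨ε, hε, he⟩ := hγ 0
    obtain ⟨η, hη, hball⟩ := Metric.eventually_nhds_iff.1 he
    have hr := G.r_pos (γ 0)
    refine ⟨min η (G.r (γ 0)), lt_min hη hr, disjoint_left.2 fun q hq hq' => ?_⟩
    have h1 : q < η := hq'.2.trans_le (min_le_left _ _)
    have h2 : q < G.r (γ 0) := hq'.2.trans_le (min_le_right _ _)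
    have h3 := hP.1 hq 0
    have hq0 := hq'.1
    rw [hball (by rwa [dist_zero_right, Real.norm_eq_abs, abs_of_pos hq0])] at h3
    have h3' : G.c (γ 0) (ε * q) = G.c (γ 0) 0 := by rw [h3, G.c_zero]
    by_cases hend : G.IsEnd (γ 0)
    · have h4 : G.c (γ 0) q = G.c (γ 0) 0 := by
        rcases hε with rfl | rfl
        · rwa [one_mul] at h3'
        · rwa [neg_one_mul, G.even _ hend _ (by rwa [abs_of_pos hq0])] at h3'
      exact hq0.ne' (G.injOn_end _ hend ⟨hq0.le, h2⟩ ⟨le_rfl, hr⟩ h4)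
    · have h5 : ε * q ∈ Ioo (-G.r (γ 0)) (G.r (γ 0)) := by
        rcases hε with rfl | rfl <;> constructor <;> linarith
      have h4 := G.injOn _ hend h5 ⟨by linarith, hr⟩ h3'
      rcases hε with rfl | rfl <;> linarith
  obtain ⟨δ, hδ, hd⟩ := hiso
  obtain ⟨R, hR⟩ := AddSubgroup.cyclic_of_isolated_zero hδ hd
  have hmem : ∀ {q}, q ∈ P ↔ ∃ n : ℤ, q = n * R := fun {q} => by
    rw [hR, AddSubgroup.mem_closure_singleton]
    simp [eq_comm]
  have hR0 : R ≠ 0 := by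
    rintro rfl
    obtain ⟨n, hn⟩ := hmem.1 hp
    exact hp0 (by simpa using hn)
  refine ⟨|R|, abs_pos.2 hR0, fun q => hP.symm.trans (hmem.trans ?_)⟩
  rcases abs_choice R with h1 | h1 <;> rw [h1]
  constructor
  · rintro ⟨n, rfl⟩
    exact ⟨-n, by simp⟩
  · rintro ⟨n, rfl⟩
    exact ⟨-n, by simp⟩

variable (G) in
omit hγ in
/-- A compact connected curve without end points is a circle. -/
theorem exists_closed_geodesic [ConnectedSpace T] [CompactSpace T] (h : ∀ x, ¬ G.IsEnd x) :
    ∃ (γ : ℝ → T) (R : ℝ), 0 < R ∧ (∀ t, G.GeodesicAt γ t) ∧ Function.Surjective γ ∧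
      ∀ a b, γ a = γ b ↔ ∃ n : ℤ, a - b = n * R := by
  obtain ⟨γ, hγ, -⟩ := G.exists_geodesic (Classical.arbitrary T)
  obtain ⟨R, hR, hper⟩ := exists_period hγ (Or.inl h)
  refine ⟨γ, R, hR, hγ, surjective hγ, fun a b => ⟨fun he => ?_, fun hn => ?_⟩⟩
  · obtain ⟨ε, rfl | rfl, hε⟩ := eq_of_eq hγ he
    · refine (hper _).1 fun u => ?_
      have := hε (u - b)
      rwa [show a + (u - b) = u + (a - b) by ring, show b + 1 * (u - b) = u by ring] at this
    · refine absurd ((isEnd_iff hγ).2 fun u => ?_) (h (γ ((a + b) / 2)))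
      have := hε ((b - a) / 2 + u)
      rwa [show a + ((b - a) / 2 + u) = (a + b) / 2 + u by ring,
        show b + -1 * ((b - a) / 2 + u) = (a + b) / 2 - u by ring] at this
  · have := (hper _).2 hn b
    rwa [add_sub_cancel] at this

variable (G) in
omit hγ in
/-- A compact connected curve with an end point is an arc. -/
theorem exists_geodesic_arc [ConnectedSpace T] [CompactSpace T] {x : T} (h : G.IsEnd x) :
    ∃ (γ : ℝ → T) (R : ℝ), 0 < R ∧ (∀ t, G.GeodesicAt γ t) ∧ γ '' Icc 0 R = univ ∧ InjOn γ (Icc 0 R) ∧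
      ∀ t ∈ Icc 0 R, G.IsEnd (γ t) ↔ t = 0 ∨ t = R := by
  obtain ⟨γ, hγ, h0⟩ := G.exists_geodesic x
  rw [← h0] at h
  obtain ⟨R', hR', hper⟩ := exists_period hγ (Or.inr h)
  have hev : ∀ u, γ u = γ (-u) := fun u => by simpa using (isEnd_iff hγ).1 h u
  -- The symmetry about `t` composed with that about `0` is the translation by `2 * t`. So the ends
  -- are at the multiples of half the period, and the arc has length `R' / 2`.
  have hend : ∀ t, G.IsEnd (γ t) ↔ ∃ n : ℤ, 2 * t = n * R' := fun t => by
    rw [isEnd_iff hγ, ← hper]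
    constructor
    · intro H u
      have h1 := H (u + t)
      rw [hev (t - (u + t))] at h1
      rw [show u + 2 * t = t + (u + t) by ring, h1]
      congr 1
      ring
    · intro H u
      have h1 := H (u - t)
      rw [hev (t - u), ← show u - t + 2 * t = t + u by ring, h1]
      congr 1
      ring
  refine ⟨γ, R' / 2, half_pos hR', hγ, ?_, ?_, fun t ht => ?_⟩
  · refine eq_univ_of_forall fun y => ?_
    obtain ⟨t, rfl⟩ := surjective hγ y
    set s := t - ⌊t / R'⌋ * R' with hs
    have hst : γ s = γ t := by
      have := (hper (⌊t / R'⌋ * R')).2 ⟨_, rfl⟩ s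
      rw [← this]
      congr 1
      rw [hs]
      ring
    have h1 := Int.floor_le (t / R')
    have h2 := Int.lt_floor_add_one (t / R')
    rw [le_div_iff₀ hR'] at h1
    rw [div_lt_iff₀ hR'] at h2
    rw [← hst]
    rcases le_total s (R' / 2) with h3 | h3
    · exact ⟨s, ⟨by linarith, h3⟩, rfl⟩
    · refine ⟨R' - s, ⟨by linarith, by linarith⟩, ?_⟩
      have := (hper R').2 ⟨1, by simp⟩ (-s)
      rw [hev s, ← this]
      congr 1
      ring
  · intro a ha b hb hab
    have hkey : (∃ n : ℤ, a - b = n * R') ∨ ∃ n : ℤ, a + b = n * R' := by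
      obtain ⟨ε, rfl | rfl, hε⟩ := eq_of_eq hγ hab
      · refine Or.inl ((hper _).1 fun u => ?_)
        have := hε (u - b)
        rwa [show a + (u - b) = u + (a - b) by ring, show b + 1 * (u - b) = u by ring] at this
      · refine Or.inr ((hper _).1 fun u => ?_)
        have := hε (u + b)
        rw [show a + (u + b) = u + (a + b) by ring, show b + -1 * (u + b) = -u by ring, ← hev] at this
        exact this
    rcases hkey with ⟨n, hn⟩ | ⟨n, hn⟩
    · have h1 : (n : ℝ) < 1 := by
        by_contra! hcon
        nlinarith [ha.2, hb.1]
      have h2 : (-1 : ℝ) < n := by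
        by_contra! hcon
        nlinarith [ha.1, hb.2]
      have h3 : n = 0 := by
        have h1' : n < 1 := by exact_mod_cast h1
        have h2' : -1 < n := by exact_mod_cast h2
        omega
      rw [h3] at hn
      simp at hn
      linarith
    · have h1 : (n : ℝ) < 2 := by
        by_contra! hcon
        nlinarith [ha.2, hb.2]
      have h2 : (-1 : ℝ) < n := by
        by_contra! hcon
        nlinarith [ha.1, hb.1]
      have h3 : n = 0 ∨ n = 1 := by
        have h1' : n < 2 := by exact_mod_cast h1
        have h2' : -1 < n := by exact_mod_cast h2
        omega
      rcases h3 with rfl | rfl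
      · simp at hn
        linarith [ha.1, hb.1]
      · simp at hn
        linarith [ha.2, hb.2]
  · rw [hend]
    constructor
    · rintro ⟨n, hn⟩
      have h1 : (n : ℝ) < 2 := by
        by_contra! hcon
        nlinarith [ht.2]
      have h2 : (-1 : ℝ) < n := by
        by_contra! hcon
        nlinarith [ht.1]
      have h3 : n = 0 ∨ n = 1 := by
        have h1' : n < 2 := by exact_mod_cast h1
        have h2' : -1 < n := by exact_mod_cast h2
        omega
      rcases h3 with rfl | rfl
      · left
        simpa using hn
      · right
        simp at hn
        linarith
    · rintro (rfl | rfl)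
      · exact ⟨0, by simp⟩
      · exact ⟨1, by simp; ring⟩

end GeodesicAtlas

end

section

open Set Filter MeasureTheory

/-! ### Isometric charts from smooth charts -/

/-- An atlas of smooth charts, centred at all points, on a one-dimensional space with end points. -/
structure CurveAtlas (T : Type*) [TopologicalSpace T] where
  IsEnd : T → Prop
  ε : T → ℝ
  V : T → Set T
  s : T → T → ℝ
  inv : T → ℝ → T
  ε_pos : ∀ z, 0 < ε z
  isOpen_V : ∀ z, IsOpen (V z)
  mem_V : ∀ z, z ∈ V z
  s_self : ∀ z, s z z = 0
  continuousOn_s : ∀ z, ContinuousOn (s z) (V z)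
  continuousOn_inv : ∀ z, ContinuousOn (inv z) {a | |a| < ε z ∧ (IsEnd z → 0 ≤ a)}
  s_mem : ∀ z, ∀ x ∈ V z, |s z x| < ε z ∧ (IsEnd z → 0 ≤ s z x)
  inv_s : ∀ z, ∀ x ∈ V z, inv z (s z x) = x
  inv_mem : ∀ z a, |a| < ε z → (IsEnd z → 0 ≤ a) → inv z a ∈ V z
  s_inv : ∀ z a, |a| < ε z → (IsEnd z → 0 ≤ a) → s z (inv z a) = a
  transition : ∀ z a y, |a| < ε z → (IsEnd z → 0 < a) → inv z a ∈ V y →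
    ContDiffAt ℝ ∞ (fun a => s y (inv z a)) a ∧ deriv (fun a => s y (inv z a)) a ≠ 0
  end_unique : ∀ z y, IsEnd z → z ∈ V y → y = z

/-- `U` is the length measured from the centre of a chart for the density `ρ`, and `A` recovers the
chart coordinate from the length. -/
theorem exists_primitive_inverse {ρ : ℝ → ℝ} {e : ℝ} (he : 0 < e) (hρ : ContDiffOn ℝ ∞ ρ (Ioo (-e) e))
    (hpos : ∀ a ∈ Ioo (-e) e, 0 < ρ a) :
    ∃ (U A : ℝ → ℝ) (r : ℝ), 0 < r ∧ U 0 = 0 ∧ (∀ a ∈ Ioo (-e) e, HasDerivAt U (ρ a) a) ∧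
      ContDiffOn ℝ ∞ U (Ioo (-e) e) ∧ ContinuousOn A (Ioo (-r) r) ∧
      (∀ h ∈ Ioo (-r) r, A h ∈ Ioo (-e) e ∧ U (A h) = h) ∧ ∀ᶠ a in 𝓝 0, A (U a) = a := by
  set U : ℝ → ℝ := fun a => ∫ x in (0 : ℝ)..a, ρ x with hU
  have hsub : ∀ a ∈ Ioo (-e) e, uIcc 0 a ⊆ Ioo (-e) e := fun a ha =>
    (ordConnected_Ioo (a := -e) (b := e)).uIcc_subset ⟨by linarith, he⟩ ha
  have hd : ∀ a ∈ Ioo (-e) e, HasDerivAt U (ρ a) a := fun a ha =>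
    intervalIntegral.integral_hasDerivAt_right ((hρ.continuousOn.mono (hsub a ha)).intervalIntegrable)
      (hρ.continuousOn.stronglyMeasurableAtFilter isOpen_Ioo a ha)
      (hρ.continuousOn.continuousAt (isOpen_Ioo.mem_nhds ha))
  have hsm : ContDiffOn ℝ ∞ U (Ioo (-e) e) := by
    rw [contDiffOn_infty_iff_deriv_of_isOpen isOpen_Ioo]
    exact ⟨fun a ha => (hd a ha).differentiableAt.differentiableWithinAt,
      hρ.congr fun a ha => (hd a ha).deriv⟩
  have hI : Icc (-(e / 2)) (e / 2) ⊆ Ioo (-e) e := fun a ha => ⟨by linarith [ha.1], by linarith [ha.2]⟩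
  have hm : StrictMonoOn U (Icc (-(e / 2)) (e / 2)) := by
    refine strictMonoOn_of_deriv_pos (convex_Icc _ _) (hsm.continuousOn.mono hI) fun a ha => ?_
    have h1 := hI (interior_subset ha)
    rw [(hd a h1).deriv]
    exact hpos a h1
  have h0 : U 0 = 0 := by simp [hU]
  have hz : (0 : ℝ) ∈ Icc (-(e / 2)) (e / 2) := ⟨by linarith, by linarith⟩
  have hm1 : U (-(e / 2)) < 0 := h0 ▸ hm ⟨le_rfl, by linarith⟩ hz (by linarith)
  have hm2 : 0 < U (e / 2) := by
    have := hm hz ⟨by linarith, le_rfl⟩ (by linarith)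
    rwa [h0] at this
  obtain ⟨A, hAc, hA, hAU⟩ := exists_continuousOn_inverse (by linarith : -(e / 2) ≤ e / 2)
    (hsm.continuousOn.mono hI) hm
  have hr : Ioo (-min (-U (-(e / 2))) (U (e / 2))) (min (-U (-(e / 2))) (U (e / 2))) ⊆
      Icc (U (-(e / 2))) (U (e / 2)) := fun h hh =>
    ⟨by linarith [hh.1, min_le_left (-U (-(e / 2))) (U (e / 2))],
      by linarith [hh.2, min_le_right (-U (-(e / 2))) (U (e / 2))]⟩
  refine ⟨U, A, min (-U (-(e / 2))) (U (e / 2)), lt_min (by linarith) hm2, h0, hd, hsm, hAc.mono hr,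
    fun h hh => ⟨hI (hA h (hr hh)).1, (hA h (hr hh)).2⟩, ?_⟩
  filter_upwards [Icc_mem_nhds (by linarith : -(e / 2) < 0) (by linarith : 0 < e / 2)] with a ha
  exact hAU a ha

/-- The folded chart at an end point is `h ↦ |h|`; away from the fold it has unit speed. -/
theorem eventually_abs_add_sub {u : ℝ} (hu : u ≠ 0) :
    ∃ ε : ℝ, (ε = 1 ∨ ε = -1) ∧ ∀ᶠ h in 𝓝 0, |u + h| - |u| = ε * h := by
  have hc : Tendsto (fun h : ℝ => u + h) (𝓝 0) (𝓝 u) :=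
    (by fun_prop : Continuous fun h : ℝ => u + h).tendsto' _ _ (by simp)
  rcases hu.lt_or_gt with h | h
  · refine ⟨-1, Or.inr rfl, ?_⟩
    filter_upwards [hc.eventually (gt_mem_nhds h)] with k hk
    rw [abs_of_neg hk, abs_of_neg h]
    ring
  · refine ⟨1, Or.inl rfl, ?_⟩
    filter_upwards [hc.eventually (lt_mem_nhds h)] with k hk
    rw [abs_of_pos hk, abs_of_pos h]
    ring

namespace CurveAtlas

variable {T : Type*} [TopologicalSpace T] (A : CurveAtlas T)

/-- The interior of the domain of a chart. -/
def dom (z : T) : Set ℝ := {a | |a| < A.ε z ∧ (A.IsEnd z → 0 < a)}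

variable {A}

theorem isOpen_dom (z : T) : IsOpen (A.dom z) := by
  refine (isOpen_lt continuous_abs continuous_const).inter (t := {a | A.IsEnd z → 0 < a}) ?_
  by_cases h : A.IsEnd z
  · rw [show {a : ℝ | A.IsEnd z → 0 < a} = Ioi 0 by ext; simp [h]]
    exact isOpen_Ioi
  · simp [h]

theorem dom_subset (z : T) : A.dom z ⊆ {a | |a| < A.ε z ∧ (A.IsEnd z → 0 ≤ a)} :=
  fun _ ha => ⟨ha.1, fun h => (ha.2 h).le⟩

theorem continuousAt_inv {z : T} {a : ℝ} (ha : a ∈ A.dom z) : ContinuousAt (A.inv z) a :=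
  (A.continuousOn_inv z).continuousAt (mem_of_superset ((isOpen_dom z).mem_nhds ha) (dom_subset z))

theorem s_inv_of_mem_dom {z : T} {a : ℝ} (ha : a ∈ A.dom z) : A.s z (A.inv z a) = a :=
  A.s_inv z a ha.1 (dom_subset z ha).2

theorem eventually_inv_mem {z y : T} {a : ℝ} (ha : a ∈ A.dom z) (hy : A.inv z a ∈ A.V y) :
    ∀ᶠ b in 𝓝 a, b ∈ A.dom z ∧ A.inv z b ∈ A.V y :=
  ((isOpen_dom z).eventually_mem ha).and ((continuousAt_inv ha).eventually ((A.isOpen_V y).mem_nhds hy))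

theorem inv_zero (z : T) : A.inv z 0 = z := by
  have := A.inv_s z z (A.mem_V z)
  rwa [A.s_self] at this

/-- An end point lies in no chart but its own, where it is the centre; hence points of the open part
of one chart lie in the open part of every chart that contains them. -/
theorem s_mem_dom {z y : T} {a : ℝ} (ha : a ∈ A.dom z) (hy : A.inv z a ∈ A.V y) :
    A.s y (A.inv z a) ∈ A.dom y := by
  obtain ⟨h1, h2⟩ := A.s_mem y _ hy
  refine ⟨h1, fun hend => (h2 hend).lt_of_ne fun h0 => ?_⟩
  have h3 := A.inv_s y _ hy
  rw [← h0, inv_zero] at h3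
  have h4 : y ∈ A.V z := by
    rw [h3]
    exact A.inv_mem z a ha.1 (dom_subset z ha).2
  obtain rfl := A.end_unique y z hend h4
  have h5 := s_inv_of_mem_dom ha
  rw [← h3, A.s_self] at h5
  exact (ha.2 hend).ne h5

theorem zero_mem_dom {z : T} (h : ¬ A.IsEnd z) : (0 : ℝ) ∈ A.dom z :=
  ⟨by simpa using A.ε_pos z, fun h' => absurd h' h⟩

variable (A) in
open scoped Classical in
/-- A cutoff function in the chart at `i`. -/
noncomputable def cutoff (i x : T) : ℝ :=
  if x ∈ A.V i then
    (⟨A.ε i / 4, A.ε i / 2, by linarith [A.ε_pos i], by linarith [A.ε_pos i]⟩ : ContDiffBump (0 : ℝ)) (A.s i x)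
  else 0

theorem cutoff_nonneg (i x : T) : 0 ≤ A.cutoff i x := by
  unfold cutoff
  split_ifs
  · exact ContDiffBump.nonneg _
  · exact le_rfl

theorem cutoff_eq_one {i x : T} (hx : x ∈ A.V i) (h : |A.s i x| ≤ A.ε i / 4) : A.cutoff i x = 1 := by
  rw [cutoff, if_pos hx]
  exact ContDiffBump.one_of_mem_closedBall _ (by simpa using h)

theorem cutoff_eventually_one (i : T) : ∀ᶠ x in 𝓝 i, A.cutoff i x = 1 := by
  have h1 := (A.continuousOn_s i).continuousAt ((A.isOpen_V i).mem_nhds (A.mem_V i))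
  have h2 : ∀ᶠ x in 𝓝 i, |A.s i x| < A.ε i / 4 :=
    h1.abs.eventually (gt_mem_nhds (by show |A.s i i| < _; rw [A.s_self, abs_zero]; linarith [A.ε_pos i]))
  filter_upwards [(A.isOpen_V i).mem_nhds (A.mem_V i), h2] with x hx hx'
  exact cutoff_eq_one hx hx'.le

/-- The cutoff is nonzero only on the image of a compact part of the chart domain, which is closed
in a Hausdorff space. So extension by zero outside the chart is harmless. -/
theorem cutoff_eventually_zero [T2Space T] {i x : T} (hx : x ∉ A.V i) : ∀ᶠ y in 𝓝 x, A.cutoff i y = 0 := by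
  set K := A.inv i '' (Metric.closedBall 0 (A.ε i / 2) ∩ {a | A.IsEnd i → 0 ≤ a}) with hK
  have hε := A.ε_pos i
  have hsub : Metric.closedBall 0 (A.ε i / 2) ∩ {a | A.IsEnd i → 0 ≤ a} ⊆
      {a | |a| < A.ε i ∧ (A.IsEnd i → 0 ≤ a)} := fun a ha => ⟨by
    have : |a| ≤ A.ε i / 2 := by simpa using ha.1
    linarith, ha.2⟩
  have hcl : IsClosed {a : ℝ | A.IsEnd i → 0 ≤ a} := by
    by_cases h : A.IsEnd i
    · rw [show {a : ℝ | A.IsEnd i → 0 ≤ a} = Ici 0 by ext; simp [h]]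
      exact isClosed_Ici
    · simp [h]
  have hKc : IsClosed K := (((isCompact_closedBall _ _).inter_right hcl).image_of_continuousOn
    ((A.continuousOn_inv i).mono hsub)).isClosed
  have hxK : x ∉ K := by
    rintro ⟨a, ha, rfl⟩
    exact hx (A.inv_mem i a (hsub ha).1 (hsub ha).2)
  filter_upwards [hKc.isOpen_compl.mem_nhds hxK] with y hy
  unfold cutoff
  split_ifs with hV
  · refine ContDiffBump.zero_of_le_dist _ ?_
    by_contra! hlt
    rw [dist_zero_right, Real.norm_eq_abs] at hlt
    refine hy ⟨A.s i y, ⟨by simpa using hlt.le, (A.s_mem i y hV).2⟩, A.inv_s i y hV⟩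
  · rfl

variable (A) in
/-- The density, in the chart at `z`, of the length element glued from the chosen charts. -/
noncomputable def density (F : Finset T) (z : T) (a : ℝ) : ℝ :=
  ∑ i ∈ F, A.cutoff i (A.inv z a) * |deriv (fun a => A.s i (A.inv z a)) a|

theorem contDiffAt_density [T2Space T] (F : Finset T) {z : T} {a : ℝ} (ha : a ∈ A.dom z) :
    ContDiffAt ℝ ∞ (A.density F z) a := by
  refine ContDiffAt.sum fun i _ => ?_
  by_cases hi : A.inv z a ∈ A.V i
  · obtain ⟨h1, h2⟩ := A.transition z a i ha.1 ha.2 hi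
    have h3 : ContDiffAt ℝ ∞ (deriv fun a => A.s i (A.inv z a)) a := by
      have := h1.fderiv_right (m := ∞) (by simp)
      exact this.clm_apply contDiffAt_const
    have hb := (⟨A.ε i / 4, A.ε i / 2, by linarith [A.ε_pos i], by linarith [A.ε_pos i]⟩ :
      ContDiffBump (0 : ℝ)).contDiff (n := ⊤)
    have h4 := (hb.contDiffAt.comp a h1).mul ((contDiffAt_abs h2).comp a h3)
    refine h4.congr_of_eventuallyEq ?_
    filter_upwards [eventually_inv_mem ha hi] with b hb
    rw [cutoff, if_pos hb.2]
    rfl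
  · refine contDiffAt_const.congr_of_eventuallyEq (f₁ := _) (f := fun _ => (0 : ℝ)) ?_
    filter_upwards [(continuousAt_inv ha).eventually (cutoff_eventually_zero hi)] with b hb
    rw [hb, zero_mul]

theorem density_pos {F : Finset T} (hF : ∀ x, ∃ i ∈ F, x ∈ A.V i ∧ |A.s i x| ≤ A.ε i / 4) {z : T} {a : ℝ}
    (ha : a ∈ A.dom z) : 0 < A.density F z a := by
  obtain ⟨i, hi, hV, hs⟩ := hF (A.inv z a)
  refine Finset.sum_pos' (fun j _ => mul_nonneg (cutoff_nonneg _ _) (abs_nonneg _)) ⟨i, hi, ?_⟩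
  rw [cutoff_eq_one hV hs, one_mul]
  exact abs_pos.2 (A.transition z a i ha.1 ha.2 hV).2

/-- By the chain rule each summand transforms by the absolute value of the derivative of the change
of chart, so the densities define one length element. -/
theorem density_transition (F : Finset T) {z y : T} {a : ℝ} (ha : a ∈ A.dom z) (hy : A.inv z a ∈ A.V y) :
    A.density F z a = A.density F y (A.s y (A.inv z a)) * |deriv (fun a => A.s y (A.inv z a)) a| := by
  unfold density
  rw [Finset.sum_mul]
  refine Finset.sum_congr rfl fun i _ => ?_
  rw [A.inv_s y _ hy, mul_assoc, ← abs_mul]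
  by_cases hi : A.inv z a ∈ A.V i
  · congr 2
    have hb := s_mem_dom ha hy
    have h1 := (A.transition z a y ha.1 ha.2 hy).1.differentiableAt (by simp)
    have h2 := (A.transition y _ i hb.1 hb.2 (by rwa [A.inv_s y _ hy])).1.differentiableAt (by simp)
    have h3 := h2.hasDerivAt.comp a h1.hasDerivAt
    refine (h3.congr_of_eventuallyEq ?_).deriv
    filter_upwards [eventually_inv_mem ha hy] with b hb
    simp only [Function.comp_apply]
    rw [A.inv_s y _ hb.2]
  · rw [cutoff, if_neg hi, zero_mul, zero_mul]

/-- An end point lies only in its own chart, so near it the other cutoffs vanish and its own is `1`.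
The chart coordinate is then already the length, which later identifies the leaf parameter with `σ`
at the tips of the disk. -/
theorem density_end [T2Space T] {F : Finset T} (hF : ∀ x, ∃ i ∈ F, x ∈ A.V i ∧ |A.s i x| ≤ A.ε i / 4) {z : T}
    (hz : A.IsEnd z) : ∃ r > 0, r ≤ A.ε z ∧ ∀ a ∈ Ioo 0 r, A.density F z a = 1 := by
  obtain ⟨i, hi, hV, -⟩ := hF z
  obtain rfl := A.end_unique z i hz hV
  have h1 : ∀ᶠ x in 𝓝 i, A.cutoff i x = 1 ∧ ∀ j ∈ F, j ≠ i → A.cutoff j x = 0 := by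
    refine (cutoff_eventually_one i).and ((F.eventually_all).2 fun j _ => ?_)
    by_cases hj : j = i
    · exact Eventually.of_forall fun x h => absurd hj h
    · exact (cutoff_eventually_zero (fun h => hj (A.end_unique i j hz h))).mono fun x hx _ => hx
  have h2 : Tendsto (A.inv i) (𝓝[{a | |a| < A.ε i ∧ (A.IsEnd i → 0 ≤ a)}] 0) (𝓝 i) := by
    have := A.continuousOn_inv i 0 ⟨by simpa using A.ε_pos i, fun _ => le_rfl⟩
    rwa [ContinuousWithinAt, inv_zero] at this
  obtain ⟨δ, hδ, hball⟩ := Metric.mem_nhdsWithin_iff.1 (h2.eventually h1)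
  refine ⟨min δ (A.ε i), lt_min hδ (A.ε_pos i), min_le_right _ _, fun a ha => ?_⟩
  have ha1 : a < δ := ha.2.trans_le (min_le_left _ _)
  have ha2 : a < A.ε i := ha.2.trans_le (min_le_right _ _)
  have hdom : a ∈ A.dom i := ⟨by rwa [abs_of_pos ha.1], fun _ => ha.1⟩
  obtain ⟨h3, h4⟩ := hball ⟨by simpa [abs_of_pos ha.1] using ha1, dom_subset i hdom⟩
  unfold density
  rw [Finset.sum_eq_single_of_mem i hi fun j hj hji => by rw [h4 j hj hji, zero_mul], h3, one_mul]
  have h5 : (fun a => A.s i (A.inv i a)) =ᶠ[𝓝 a] id := by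
    filter_upwards [(isOpen_dom i).mem_nhds hdom] with b hb
    exact s_inv_of_mem_dom hb
  rw [h5.deriv_eq, deriv_id, abs_one]

/-- The lengths measured in two charts agree up to sign. -/
theorem eventually_length_eq [T2Space T] {F : Finset T} {z y : T} {a : ℝ} (ha : a ∈ A.dom z)
    (hy : A.inv z a ∈ A.V y) {U W : ℝ → ℝ} (hU : ∀ᶠ b in 𝓝 a, HasDerivAt U (A.density F z b) b)
    (hW : ∀ b ∈ A.dom y, HasDerivAt W (A.density F y b) b) :
    ∃ ε : ℝ, (ε = 1 ∨ ε = -1) ∧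
      ∀ᶠ b in 𝓝 a, W (A.s y (A.inv z b)) - W (A.s y (A.inv z a)) = ε * (U b - U a) := by
  obtain ⟨h1, h2⟩ := A.transition z a y ha.1 ha.2 hy
  have hcont : ContinuousAt (deriv fun a => A.s y (A.inv z a)) a := by
    have := h1.fderiv_right (m := ∞) (by simp)
    exact (this.clm_apply contDiffAt_const).continuousAt
  obtain ⟨ε, hε, hsign⟩ : ∃ ε : ℝ, (ε = 1 ∨ ε = -1) ∧ ∀ᶠ b in 𝓝 a,
      deriv (fun a => A.s y (A.inv z a)) b = ε * |deriv (fun a => A.s y (A.inv z a)) b| := by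
    rcases h2.lt_or_gt with h | h
    · refine ⟨-1, Or.inr rfl, (hcont.eventually (gt_mem_nhds h)).mono fun b hb => ?_⟩
      rw [abs_of_neg hb]
      ring
    · refine ⟨1, Or.inl rfl, (hcont.eventually (lt_mem_nhds h)).mono fun b hb => ?_⟩
      rw [abs_of_pos hb]
      ring
  refine ⟨ε, hε, ?_⟩
  have hder : ∀ᶠ b in 𝓝 a, HasDerivAt (fun b => W (A.s y (A.inv z b)) - ε * U b) 0 b := by
    filter_upwards [hsign, hU, eventually_inv_mem ha hy] with b hb hbU hbd
    have h3 := (A.transition z b y hbd.1.1 hbd.1.2 hbd.2).1.differentiableAt (by simp)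
    have h4 := (hW _ (s_mem_dom hbd.1 hbd.2)).comp b h3.hasDerivAt
    refine (h4.sub (hbU.const_mul ε)).congr_deriv ?_
    rw [density_transition F hbd.1 hbd.2]
    nth_rewrite 1 [hb]
    ring
  obtain ⟨δ, hδ, hball⟩ := Metric.eventually_nhds_iff_ball.1 hder
  filter_upwards [Metric.ball_mem_nhds a hδ] with b hb
  have h5 := (convex_ball a δ).is_const_of_fderivWithin_eq_zero (𝕜 := ℝ)
    (f := fun b => W (A.s y (A.inv z b)) - ε * U b)
    (fun c hc => (hball c hc).differentiableAt.differentiableWithinAt) (fun c hc => by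
      rw [((hball c hc).hasFDerivAt.hasFDerivWithinAt).fderivWithin
        (Metric.isOpen_ball.uniqueDiffWithinAt hc)]
      ext
      simp) hb (Metric.mem_ball_self hδ)
  linarith

variable (A) in
/-- A compact curve has an atlas of isometric charts. -/
theorem exists_geodesicAtlas [T2Space T] [CompactSpace T] : ∃ G : GeodesicAtlas T, G.IsEnd = A.IsEnd ∧
    (∀ z, ¬ A.IsEnd z → ∃ U : ℝ → ℝ, ContDiffAt ℝ ∞ U 0 ∧ U 0 = 0 ∧ deriv U 0 ≠ 0 ∧
      ∀ᶠ x in 𝓝 z, x = G.c z (U (A.s z x))) ∧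
    ∀ z, A.IsEnd z → ∀ᶠ x in 𝓝 z, 0 ≤ A.s z x ∧ x = G.c z (A.s z x) := by
  obtain ⟨F, hF⟩ : ∃ F : Finset T, ∀ x, ∃ i ∈ F, x ∈ A.V i ∧ |A.s i x| ≤ A.ε i / 4 := by
    obtain ⟨F, hF⟩ := CompactSpace.elim_nhds_subcover (fun z => {x | x ∈ A.V z ∧ |A.s z x| ≤ A.ε z / 4})
      fun z => by
        have h1 := (A.continuousOn_s z).continuousAt ((A.isOpen_V z).mem_nhds (A.mem_V z))
        have h2 : ∀ᶠ x in 𝓝 z, |A.s z x| < A.ε z / 4 :=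
          h1.abs.eventually (gt_mem_nhds (by show |A.s z z| < _; rw [A.s_self, abs_zero]; linarith [A.ε_pos z]))
        filter_upwards [(A.isOpen_V z).mem_nhds (A.mem_V z), h2] with x hx hx'
        exact ⟨hx, hx'.le⟩
    refine ⟨F, fun x => ?_⟩
    obtain ⟨i, hi, h⟩ := mem_iUnion₂.1 (hF.ge (mem_univ x))
    exact ⟨i, hi, h⟩
  -- `U` goes from chart coordinate to length and `B` back. At an end point the length is the
  -- coordinate itself and `B` is the fold `abs`.
  have hchart : ∀ z, ∃ (U B : ℝ → ℝ) (r : ℝ), 0 < r ∧ U 0 = 0 ∧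
      (A.IsEnd z → r ≤ A.ε z ∧ (∀ a ∈ Ioo 0 r, A.density F z a = 1) ∧ U = id ∧ B = abs) ∧
      (¬ A.IsEnd z → (∀ a ∈ A.dom z, HasDerivAt U (A.density F z a) a) ∧ ContDiffAt ℝ ∞ U 0 ∧
        ContinuousOn B (Ioo (-r) r) ∧ (∀ h ∈ Ioo (-r) r, B h ∈ A.dom z ∧ U (B h) = h) ∧
        ∀ᶠ a in 𝓝 0, B (U a) = a) := by
    intro z
    by_cases hz : A.IsEnd z
    · obtain ⟨r, hr, hrε, h1⟩ := density_end hF hz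
      exact ⟨id, abs, r, hr, rfl, fun _ => ⟨hrε, h1, rfl, rfl⟩, fun h => absurd hz h⟩
    · have hdom : A.dom z = Ioo (-A.ε z) (A.ε z) := by
        ext a
        simp [dom, hz, abs_lt]
      obtain ⟨U, B, r, hr, h0, h1, h2, h3, h4, h5⟩ := exists_primitive_inverse (A.ε_pos z)
        (ρ := A.density F z) (fun a ha => (contDiffAt_density F (hdom ▸ ha)).contDiffWithinAt)
        fun a ha => density_pos hF (hdom ▸ ha)
      refine ⟨U, B, r, hr, h0, fun h => absurd h hz, fun _ => ⟨fun a ha => h1 a (hdom ▸ ha),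
        h2.contDiffAt (Ioo_mem_nhds (by linarith [A.ε_pos z]) (A.ε_pos z)), h3, fun h hh => ?_, h5⟩⟩
      rw [hdom]
      exact h4 h hh
  choose U B r hr hU0 hend hnon using hchart
  have hB0 : ∀ z, B z 0 = 0 := fun z => by
    by_cases hz : A.IsEnd z
    · rw [(hend z hz).2.2.2, abs_zero]
    · have := (hnon z hz).2.2.2.2.self_of_nhds
      rwa [hU0] at this
  -- the charts cover neighbourhoods
  have hcov : ∀ z, ∀ᶠ x in 𝓝 z, (A.IsEnd z → 0 ≤ A.s z x) ∧ x = A.inv z (B z (U z (A.s z x))) := fun z => by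
    by_cases hz : A.IsEnd z
    · filter_upwards [(A.isOpen_V z).mem_nhds (A.mem_V z)] with x hx
      refine ⟨(A.s_mem z x hx).2, ?_⟩
      rw [(hend z hz).2.2.1, (hend z hz).2.2.2, id, abs_of_nonneg ((A.s_mem z x hx).2 hz), A.inv_s z x hx]
    · have h1 := (A.continuousOn_s z).continuousAt ((A.isOpen_V z).mem_nhds (A.mem_V z))
      rw [ContinuousAt, A.s_self] at h1
      filter_upwards [(A.isOpen_V z).mem_nhds (A.mem_V z), h1.eventually (hnon z hz).2.2.2.2] with x hx h2
      exact ⟨fun h => absurd h hz, by rw [h2, A.inv_s z x hx]⟩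
  have hdomB : ∀ z u, |u| < r z → u ≠ 0 ∨ ¬ A.IsEnd z → B z u ∈ A.dom z := fun z u hu h => by
    by_cases hz : A.IsEnd z
    · rw [(hend z hz).2.2.2]
      refine ⟨by rw [abs_abs]; exact hu.trans_le (hend z hz).1, fun _ => abs_pos.2 ?_⟩
      exact h.resolve_right (not_not.2 hz)
    · exact ((hnon z hz).2.2.2.1 u (abs_lt.1 hu)).1
  -- the change of parameter at `u` runs with unit speed
  have hspeed : ∀ z u, |u| < r z → u ≠ 0 ∨ ¬ A.IsEnd z → ContinuousAt (B z) u ∧ ∃ W : ℝ → ℝ,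
      (∀ᶠ b in 𝓝 (B z u), HasDerivAt W (A.density F z b) b) ∧ ∃ ε : ℝ, (ε = 1 ∨ ε = -1) ∧
        ∀ᶠ h in 𝓝 0, W (B z (u + h)) - W (B z u) = ε * h := fun z u hu h => by
    have hdom := hdomB z u hu h
    by_cases hz : A.IsEnd z
    · obtain ⟨h1, h2, h3, h4⟩ := hend z hz
      have hu0 := h.resolve_right (not_not.2 hz)
      rw [h4]
      refine ⟨continuous_abs.continuousAt, id, ?_, eventually_abs_add_sub hu0⟩
      filter_upwards [isOpen_Ioo.mem_nhds (show |u| ∈ Ioo 0 (r z) from ⟨abs_pos.2 hu0, hu⟩)] with b hb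
      rw [h2 b hb]
      exact hasDerivAt_id b
    · obtain ⟨h1, -, h3, h4, -⟩ := hnon z hz
      refine ⟨h3.continuousAt (isOpen_Ioo.mem_nhds (abs_lt.1 hu)), U z, ?_, 1, Or.inl rfl, ?_⟩
      · filter_upwards [(isOpen_dom z).mem_nhds hdom] with b hb
        exact h1 b hb
      · have h6 : ∀ᶠ k in 𝓝 u, k ∈ Ioo (-r z) (r z) := isOpen_Ioo.mem_nhds (abs_lt.1 hu)
        filter_upwards [eventually_nhds_iff_add.1 h6] with h hh
        rw [(h4 _ hh).2, (h4 u (abs_lt.1 hu)).2]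
        ring
  have htrans : ∀ z u, |u| < r z → ∃ ε : ℝ, (ε = 1 ∨ ε = -1) ∧ ∀ᶠ h in 𝓝 0,
      A.inv z (B z (u + h)) = A.inv (A.inv z (B z u)) (B (A.inv z (B z u)) (ε * h)) := by
    intro z u hu
    by_cases hu0 : u ≠ 0 ∨ ¬ A.IsEnd z
    swap
    · push Not at hu0
      refine ⟨1, Or.inl rfl, Eventually.of_forall fun h => ?_⟩
      rw [hu0.1, hB0, inv_zero, zero_add, one_mul]
    have hdom := hdomB z u hu hu0
    obtain ⟨hcont, W, hW, ε₁, hε₁, e₁⟩ := hspeed z u hu hu0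
    set y := A.inv z (B z u) with hy
    have hyV := A.mem_V y
    have hyend : ¬ A.IsEnd y := fun hcon => by
      have h1 := (s_mem_dom hdom hyV).2 hcon
      rw [A.s_self] at h1
      exact lt_irrefl _ h1
    obtain ⟨h1, -, -, -, h5⟩ := hnon y hyend
    obtain ⟨ε₂, hε₂, e₂⟩ := eventually_length_eq hdom hyV hW h1
    rw [← hy, A.s_self, hU0] at e₂
    refine ⟨ε₂ * ε₁, by rcases hε₁ with rfl | rfl <;> rcases hε₂ with rfl | rfl <;> simp, ?_⟩
    have hB : Tendsto (fun h => B z (u + h)) (𝓝 0) (𝓝 (B z u)) :=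
      hcont.tendsto.comp ((by fun_prop : Continuous fun h : ℝ => u + h).tendsto' _ _ (by simp))
    have hs : Tendsto (fun b => A.s y (A.inv z b)) (𝓝 (B z u)) (𝓝 0) := by
      have := (A.transition z _ y hdom.1 hdom.2 hyV).1.continuousAt.tendsto
      rwa [← hy, A.s_self] at this
    filter_upwards [e₁, hB.eventually e₂, hB.eventually (eventually_inv_mem hdom hyV),
      (hs.comp hB).eventually h5] with h k1 k2 k3 k5
    rw [sub_zero, k1, ← mul_assoc] at k2
    simp only [Function.comp_apply] at k5
    rw [← k2, k5, A.inv_s y _ k3.2]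
  have hBI : ∀ z h, |h| < r z → |B z h| < A.ε z ∧ (A.IsEnd z → 0 ≤ B z h) := fun z h hh => by
    by_cases hz : A.IsEnd z
    · rw [(hend z hz).2.2.2, abs_abs]
      exact ⟨hh.trans_le (hend z hz).1, fun _ => abs_nonneg h⟩
    · exact dom_subset z ((hnon z hz).2.2.2.1 h (abs_lt.1 hh)).1
  have hsB : ∀ z h, |h| < r z → A.s z (A.inv z (B z h)) = B z h := fun z h hh =>
    A.s_inv z _ (hBI z h hh).1 (hBI z h hh).2
  refine ⟨⟨A.IsEnd, r, fun z h => A.inv z (B z h), hr, fun z => by rw [hB0, inv_zero], fun z => ?_,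
    fun z δ hδ => ?_, htrans, fun z hz u _ => ?_, fun z hz a ha b hb hab => ?_,
    fun z hz a ha b hb hab => ?_⟩, rfl, fun z hz => ⟨U z, (hnon z hz).2.1, hU0 z, ?_, ?_⟩, fun z hz => ?_⟩
  · refine (A.continuousOn_inv z).comp ?_ fun h hh => hBI z h (abs_lt.2 hh)
    by_cases hz : A.IsEnd z
    · rw [(hend z hz).2.2.2]
      exact continuous_abs.continuousOn
    · exact (hnon z hz).2.2.1
  · have h1 : ContinuousAt (fun x => U z (A.s z x)) z := by
      have h2 := (A.continuousOn_s z).continuousAt ((A.isOpen_V z).mem_nhds (A.mem_V z))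
      refine ContinuousAt.comp (g := U z) ?_ h2
      rw [A.s_self]
      by_cases hz : A.IsEnd z
      · rw [(hend z hz).2.2.1]
        exact continuousAt_id
      · exact (hnon z hz).2.1.continuousAt
    have h3 : ∀ᶠ x in 𝓝 z, U z (A.s z x) ∈ Ioo (-δ) δ :=
      h1.eventually (isOpen_Ioo.mem_nhds (by show U z (A.s z z) ∈ _; rw [A.s_self, hU0]; exact ⟨by linarith, hδ⟩))
    filter_upwards [hcov z, h3] with x hx hx3
    exact ⟨_, hx3, hx.2.symm⟩
  · show A.inv z (B z (-u)) = A.inv z (B z u)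
    rw [(hend z hz).2.2.2, abs_neg]
  · have h1 := congrArg (A.s z) hab
    simp only at h1
    rw [hsB z a (by rw [abs_of_nonneg ha.1]; exact ha.2), hsB z b (by rw [abs_of_nonneg hb.1]; exact hb.2),
      (hend z hz).2.2.2, abs_of_nonneg ha.1, abs_of_nonneg hb.1] at h1
    exact h1
  · have h1 := congrArg (A.s z) hab
    simp only at h1
    rw [hsB z a (abs_lt.2 ha), hsB z b (abs_lt.2 hb)] at h1
    rw [← ((hnon z hz).2.2.2.1 a ha).2, ← ((hnon z hz).2.2.2.1 b hb).2, h1]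
  · rw [((hnon z hz).1 0 (zero_mem_dom hz)).deriv]
    exact (density_pos hF (zero_mem_dom hz)).ne'
  · filter_upwards [hcov z] with x hx
    exact hx.2
  · filter_upwards [hcov z] with x hx
    refine ⟨hx.1 hz, ?_⟩
    have h1 := hx.2
    rw [(hend z hz).2.2.1] at h1
    exact h1

end CurveAtlas

end

section

open Set Filter MeasureTheory

/-! ### The space of leaves -/

namespace FlowSystem

variable {X : Type*} [TopologicalSpace X] [ChartedSpace (EuclideanHalfSpace 2) X] {D : FlowSystem X}

theorem IsLeaf.reverse {γ : ℝ → X} {a b : ℝ} (h : D.reverse.IsLeaf γ a b) :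
    D.IsLeaf (fun r => γ (-r)) (-b) (-a) := by
  have hneg : MapsTo (fun r : ℝ => -r) (Icc (-b) (-a)) (Icc a b) := fun r hr =>
    ⟨by linarith [hr.2], by linarith [hr.1]⟩
  refine ⟨h.1.comp continuous_neg.continuousOn hneg, fun r hr => ?_, fun p r hr hp => ?_⟩
  · have h1 : -D.f (γ (-r)) = -r := h.2.1 (-r) (hneg hr)
    linarith
  · have h1 := h.2.2 p (-r) (hneg hr) hp
    have h2 : Tendsto (fun r : ℝ => -r) (𝓝[Icc (-b) (-a)] r) (𝓝[Icc a b] (-r)) :=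
      continuous_neg.continuousWithinAt.tendsto_nhdsWithin hneg
    exact h2.eventually h1

theorem Below.of_reverse {x y : X} (h : D.reverse.Below x y) : D.Below y x := by
  obtain ⟨γ, h1, h2, h3, h4⟩ := h
  change D.reverse.IsLeaf γ (-D.f x) (-D.f y) at h1
  change γ (-D.f x) = x at h3
  change γ (-D.f y) = y at h4
  have h5 := h1.reverse
  rw [neg_neg, neg_neg] at h5
  exact ⟨_, h5, neg_le_neg_iff.1 h2, h4, h3⟩

theorem box_self (p : X) : (D.box p).t p = 0 ∧ (D.box p).σ p = 0 := by
  have h1 := (D.box p).t_κ _ (zero_mem_boxRegion (D.box p).kind (D.box p).ε_pos)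
  have h2 := (D.box p).σ_κ _ (zero_mem_boxRegion (D.box p).kind (D.box p).ε_pos)
  rw [(D.box p).κ_zero] at h1 h2
  exact ⟨h1, h2⟩

/-- A leaf that is a single point is the centre of a box at a tangency. -/
theorem isTop_and_isTop_reverse_iff {p x : X} (hx : x ∈ (D.box p).B) :
    D.IsTop x ∧ D.reverse.IsTop x ↔ (D.box p).kind = .tangent ∧ x = p := by
  constructor
  · rintro ⟨h1, h2⟩
    obtain ⟨k1, e1⟩ := (isTop_iff hx).1 h1
    obtain ⟨k2, e2⟩ := (isTop_iff (D := D.reverse) hx).1 h2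
    change (D.box p).kind.reverse.HasTop at k2
    change -(D.box p).t x = (D.box p).kind.reverse.topTime ((D.box p).σ x) at e2
    have hkind : (D.box p).kind = .tangent := by
      rcases k1 with hk | hk
      · rw [hk] at k2
        rcases k2 with h | h <;> exact absurd h (by simp [BoxKind.reverse])
      · exact hk
    have hreg := (D.box p).mapsTo x hx
    rw [hkind] at e1 e2 hreg
    change (D.box p).t x = √((D.box p).σ x) at e1
    change -(D.box p).t x = √((D.box p).σ x) at e2
    have ht : (D.box p).t x = 0 := by linarith
    have hσ : (D.box p).σ x = 0 := by
      rw [ht, eq_comm, Real.sqrt_eq_zero ((sq_nonneg _).trans hreg.1)] at e1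
      exact e1
    refine ⟨hkind, ?_⟩
    rw [← (D.box p).κ_tσ x hx, ht, hσ, (D.box p).κ_zero]
  · rintro ⟨hk, rfl⟩
    obtain ⟨h1, h2⟩ := box_self (D := D) x
    constructor
    · refine (isTop_iff hx).2 ⟨Or.inr hk, ?_⟩
      rw [h1, h2, hk]
      exact Real.sqrt_zero.symm
    · refine (isTop_iff (D := D.reverse) hx).2 ⟨?_, ?_⟩
      · change (D.box x).kind.reverse.HasTop
        rw [hk]
        exact Or.inr rfl
      · change -(D.box x).t x = (D.box x).kind.reverse.topTime ((D.box x).σ x)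
        rw [h1, h2, hk, neg_zero]
        exact Real.sqrt_zero.symm

variable (D) in
/-- The upper end points of leaves. -/
abbrev Tops : Type _ := {x : X // D.IsTop x}

theorem mem_topDomain_iff {z : D.Tops} {a : ℝ} : a ∈ (D.box z.1).kind.topDomain (D.box z.1).ε ↔
    |a| < (D.box z.1).ε ∧ ((D.box z.1).kind = .tangent → 0 ≤ a) := by
  rcases hasTop_of_isTop z.2 with hk | hk
  · rw [hk]
    change a ∈ Ioo _ _ ↔ _
    simp [abs_lt]
  · rw [hk]
    change a ∈ Ico _ _ ↔ _
    simp only [mem_Ico, forall_const]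
    constructor
    · rintro ⟨h1, h2⟩
      exact ⟨by rwa [abs_of_nonneg h1], h1⟩
    · rintro ⟨h1, h2⟩
      exact ⟨h2, by rwa [abs_of_nonneg h2] at h1⟩

open scoped Classical in
variable (D) in
/-- The inverse of the chart at `z` of the space of leaves. -/
noncomputable def topCurve (z : D.Tops) (a : ℝ) : D.Tops :=
  if h : a ∈ (D.box z.1).kind.topDomain (D.box z.1).ε then
    ⟨(D.box z.1).κ ((D.box z.1).kind.topTime a, a), isTop_κ (hasTop_of_isTop z.2) h⟩
  else z

theorem topCurve_eq {z : D.Tops} {a : ℝ} (h : a ∈ (D.box z.1).kind.topDomain (D.box z.1).ε) :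
    (D.topCurve z a).1 = (D.box z.1).κ ((D.box z.1).kind.topTime a, a) := by
  rw [topCurve, dif_pos h]

theorem topTime_mem {z : D.Tops} {a : ℝ} (h : a ∈ (D.box z.1).kind.topDomain (D.box z.1).ε) :
    ((D.box z.1).kind.topTime a, a) ∈ boxRegion (D.box z.1).kind (D.box z.1).ε :=
  (BoxKind.top_mem_iff (hasTop_of_isTop z.2) (D.box z.1).ε_pos).2 h

/-- The square root `topTime` is smooth except at `0`, which corresponds to the end point and is
excluded by `h2`. -/
theorem contMDiffAt_topCurve {z : D.Tops} {a : ℝ} (h1 : |a| < (D.box z.1).ε)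
    (h2 : (D.box z.1).kind = .tangent → 0 < a) :
    (∀ᶠ b in 𝓝 a, b ∈ (D.box z.1).kind.topDomain (D.box z.1).ε) ∧
    ContMDiffAt 𝓘(ℝ, ℝ) (𝓡∂ 2) ∞ (fun b => (D.topCurve z b).1) a := by
  have hev : ∀ᶠ b in 𝓝 a, b ∈ (D.box z.1).kind.topDomain (D.box z.1).ε := by
    have h3 : ∀ᶠ b in 𝓝 a, |b| < (D.box z.1).ε := (continuous_abs.tendsto a).eventually (gt_mem_nhds h1)
    by_cases hk : (D.box z.1).kind = .tangent
    · filter_upwards [h3, lt_mem_nhds (h2 hk)] with b hb hb'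
      exact mem_topDomain_iff.2 ⟨hb, fun _ => hb'.le⟩
    · filter_upwards [h3] with b hb
      exact mem_topDomain_iff.2 ⟨hb, fun h => absurd h hk⟩
  refine ⟨hev, ?_⟩
  obtain ⟨N, hN, hNo, haN⟩ := eventually_nhds_iff.1 hev
  have ht : ContDiffAt ℝ ∞ (D.box z.1).kind.topTime a := by
    rcases hasTop_of_isTop z.2 with hk | hk
    · rw [hk]
      exact contDiffAt_const
    · have := h2 hk
      rw [hk]
      exact Real.contDiffAt_sqrt this.ne'
  have h4 : ContMDiffWithinAt 𝓘(ℝ, ℝ) 𝓘(ℝ, ℝ × ℝ) ∞ (fun b => ((D.box z.1).kind.topTime b, b)) N a :=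
    (ht.prodMk contDiffAt_id).contMDiffAt.contMDiffWithinAt
  have h5 := ContMDiffWithinAt.comp (f := fun b => ((D.box z.1).kind.topTime b, b)) a
    ((D.box z.1).smooth_κ _ (topTime_mem (hN a haN))) h4 fun b hb => topTime_mem (hN b hb)
  refine (h5.contMDiffAt (hNo.mem_nhds haN)).congr_of_eventuallyEq ?_
  filter_upwards [hev] with b hb
  exact topCurve_eq hb

theorem topCurve_mem {z : D.Tops} {a : ℝ} (h : a ∈ (D.box z.1).kind.topDomain (D.box z.1).ε) :
    (D.topCurve z a).1 ∈ (D.box z.1).B := by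
  rw [topCurve_eq h]
  exact (D.box z.1).mapsTo_κ _ (topTime_mem h)

theorem σ_topCurve {z : D.Tops} {a : ℝ} (h : a ∈ (D.box z.1).kind.topDomain (D.box z.1).ε) :
    (D.box z.1).σ (D.topCurve z a).1 = a := by
  rw [topCurve_eq h]
  exact (D.box z.1).σ_κ _ (topTime_mem h)

theorem σ_mem_topDomain {z : D.Tops} {x : X} (hx : x ∈ (D.box z.1).B) :
    (D.box z.1).σ x ∈ (D.box z.1).kind.topDomain (D.box z.1).ε :=
  (BoxKind.mem_topDomain (hasTop_of_isTop z.2) ((D.box z.1).mapsTo x hx)).1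

variable (D) in
/-- The charts of the space of leaves. -/
noncomputable def topAtlas : CurveAtlas D.Tops where
  IsEnd z := (D.box z.1).kind = .tangent
  ε z := (D.box z.1).ε
  V z := {x | x.1 ∈ (D.box z.1).B}
  s z x := (D.box z.1).σ x.1
  inv := D.topCurve
  ε_pos z := (D.box z.1).ε_pos
  isOpen_V z := (D.box z.1).isOpen_B.preimage continuous_subtype_val
  mem_V z := (D.box z.1).mem_B
  s_self z := (box_self z.1).2
  continuousOn_s z := (D.box z.1).smooth_σ.continuousOn.comp continuous_subtype_val.continuousOn
    fun _ hx => hx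
  continuousOn_inv z := by
    refine Topology.IsInducing.subtypeVal.continuousOn_iff.2 ?_
    have h1 : ContinuousOn (fun a => (D.box z.1).κ ((D.box z.1).kind.topTime a, a))
        {a | |a| < (D.box z.1).ε ∧ ((D.box z.1).kind = .tangent → 0 ≤ a)} :=
      (D.box z.1).smooth_κ.continuousOn.comp
        ((D.box z.1).kind.continuous_topTime.prodMk continuous_id).continuousOn
        fun a ha => topTime_mem (mem_topDomain_iff.2 ha)
    exact h1.congr fun a ha => topCurve_eq (mem_topDomain_iff.2 ha)
  s_mem z x hx := mem_topDomain_iff.1 (σ_mem_topDomain hx)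
  inv_s z x hx := Subtype.ext (by
    rw [topCurve_eq (σ_mem_topDomain hx)]
    exact (x.2.eq_κ hx).symm)
  inv_mem z a h1 h2 := topCurve_mem (mem_topDomain_iff.2 ⟨h1, h2⟩)
  s_inv z a h1 h2 := σ_topCurve (mem_topDomain_iff.2 ⟨h1, h2⟩)
  transition z a y h1 h2 hy := by
    obtain ⟨h3, h4⟩ := contMDiffAt_topCurve h1 h2
    have h5 : ContMDiffAt (𝓡∂ 2) 𝓘(ℝ, ℝ) ∞ (D.box y.1).σ (D.topCurve z a).1 :=
      (D.box y.1).smooth_σ.contMDiffAt ((D.box y.1).isOpen_B.mem_nhds hy)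
    refine ⟨contMDiffAt_iff_contDiffAt.1 (h5.comp a h4), ?_⟩
    obtain ⟨h', hne, hd⟩ := differential_apply_ne_zero (D.box z.1) (γ := fun b => (D.topCurve z b).1)
      (F := (D.box y.1).σ) (h4.mdifferentiableAt (by simp)) (topCurve_mem h3.self_of_nhds)
      (h3.mono fun b hb => σ_topCurve hb) ((D.box y.1).mdifferentiableAt_σ hy)
      ((D.box y.1).fieldDeriv_σ _ hy) ((D.box y.1).mfderiv_σ_ne _ hy)
    rw [hd.deriv]
    exact hne
  -- A one-point leaf can lie only in a tangent box centred at it.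
  end_unique z y hz hy := by
    have h1 := (isTop_and_isTop_reverse_iff (D := D) (D.box z.1).mem_B).2 ⟨hz, rfl⟩
    exact Subtype.ext ((isTop_and_isTop_reverse_iff hy).1 h1).2.symm

variable (D) in
/-- The leaf of a point. -/
noncomputable def toTops [CompactSpace X] (x : X) : D.Tops := ⟨D.top x, isTop_top x⟩

theorem continuous_toTops [CompactSpace X] [T2Space X] : Continuous D.toTops :=
  continuous_top.subtype_mk _

theorem surjective_toTops [CompactSpace X] [T2Space X] : Function.Surjective D.toTops := fun z =>
  ⟨z.1, Subtype.ext z.2.top_eq⟩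

instance [CompactSpace X] [T2Space X] : CompactSpace D.Tops :=
  surjective_toTops.compactSpace continuous_toTops

instance [CompactSpace X] [T2Space X] [ConnectedSpace X] : ConnectedSpace D.Tops :=
  surjective_toTops.connectedSpace continuous_toTops

end FlowSystem

end

section

open Set Filter MeasureTheory

/-! ### Immersions of compact surfaces onto planar regions -/

/-- Cutoff and reflection extend the germ at a boundary point to the whole plane, which makes the
inverse function theorem available there. -/
theorem exists_extension_halfSpace {F : EuclideanSpace ℝ (Fin 2) → EuclideanSpace ℝ (Fin 2)}
    {a : EuclideanSpace ℝ (Fin 2)} {t : Set (EuclideanSpace ℝ (Fin 2))} {k : ℕ} (hF : ContDiffOn ℝ k F t)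
    (ht : t ∈ 𝓝[range (𝓡∂ 2)] a) :
    ∃ G : EuclideanSpace ℝ (Fin 2) → EuclideanSpace ℝ (Fin 2), ContDiff ℝ k G ∧
      G =ᶠ[𝓝[range (𝓡∂ 2)] a] F := by
  obtain ⟨δ, hδ, hball⟩ := Metric.mem_nhdsWithin_iff.1 ht
  let χ : ContDiffBump a := ⟨δ / 3, δ / 2, by linarith, by linarith⟩
  set L := scaledCoord 0 1 one_ne_zero with hL
  have hmem : ∀ z ∈ rightHalfPlane, L.symm z ∈ range (𝓡∂ 2) := fun z hz => by
    rw [mem_range_halfSpace]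
    have h1 : (L (L.symm z)).1 = 1 * (L.symm z) 0 := rfl
    rw [L.apply_symm_apply, one_mul] at h1
    rw [← h1]
    exact hz
  have hG : ContDiffOn ℝ k (fun z => χ (L.symm z) • F (L.symm z)) rightHalfPlane := by
    intro z hz
    by_cases hzb : L.symm z ∈ Metric.ball a δ
    · have h1 : ContDiffWithinAt ℝ k F (range (𝓡∂ 2)) (L.symm z) :=
        (hF _ (hball ⟨hzb, hmem z hz⟩)).mono_of_mem_nhdsWithin
          (mem_nhdsWithin.2 ⟨_, Metric.isOpen_ball, hzb, hball⟩)
      exact ((χ.contDiff.comp L.symm.contDiff).contDiffWithinAt).smul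
        (h1.comp z L.symm.contDiff.contDiffWithinAt hmem)
    · have h2 : ∀ᶠ w in 𝓝 z, L.symm w ∈ (Metric.closedBall a (δ / 2))ᶜ := by
        refine L.symm.continuous.continuousAt.eventually_mem
          (Metric.isClosed_closedBall.isOpen_compl.mem_nhds fun h => hzb ?_)
        exact Metric.closedBall_subset_ball (by linarith) h
      refine (contDiffAt_const (c := (0 : EuclideanSpace ℝ (Fin 2)))).contDiffWithinAt.congr_of_eventuallyEq_of_mem
        (nhdsWithin_le_nhds (h2.mono fun w hw => ?_)) hz
      have hw' : χ.rOut < dist (L.symm w) a := not_le.1 hw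
      show χ (L.symm w) • F (L.symm w) = 0
      rw [χ.zero_of_le_dist hw'.le, zero_smul]
  obtain ⟨G, hGs, hGe⟩ := exists_contDiff_extension hG
  refine ⟨G ∘ L, hGs.comp L.contDiff, ?_⟩
  filter_upwards [self_mem_nhdsWithin, nhdsWithin_le_nhds (Metric.closedBall_mem_nhds a (show 0 < δ / 3 by linarith))] with y hy hyb
  have h1 : L y ∈ rightHalfPlane := by
    show 0 ≤ 1 * y 0
    rw [one_mul]
    exact (mem_range_halfSpace y).1 hy
  rw [Function.comp_apply, hGe h1]
  simp only [L.symm_apply_apply]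
  rw [χ.one_of_mem_closedBall hyb, one_smul]

/-- Compactness makes `Φ` an embedding, so the inverse is continuous on `S`. For smoothness, each
`k` uses an extension `G` of `Φ` in a chart to a full neighbourhood; the inverse of `Φ` is, on `S`,
the restriction of the local inverse of `G`. -/
theorem isDiffeomorphicTo_of_immersion {X : Type*} [TopologicalSpace X] [CompactSpace X] [Nonempty X]
    [ChartedSpace (EuclideanHalfSpace 2) X] [IsManifold (𝓡∂ 2) ∞ X] {S : Set (EuclideanSpace ℝ (Fin 2))}
    {Φ : X → EuclideanSpace ℝ (Fin 2)}
    (hΦ : ContMDiff (𝓡∂ 2) 𝓘(ℝ, EuclideanSpace ℝ (Fin 2)) ∞ Φ) (hinj : Function.Injective Φ)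
    (hrange : range Φ = S)
    (hd : ∀ x, ∀ u : EuclideanSpace ℝ (Fin 2),
      (mfderiv (𝓡∂ 2) 𝓘(ℝ, EuclideanSpace ℝ (Fin 2)) Φ x u : EuclideanSpace ℝ (Fin 2)) = 0 → u = 0) :
    IsDiffeomorphicTo X S := by
  set Ψ := Function.invFun Φ with hΨ
  have hΨΦ : ∀ x, Ψ (Φ x) = x := Function.leftInverse_invFun hinj
  have hemb : Topology.IsEmbedding Φ := (hΦ.continuous.isClosedEmbedding hinj).isEmbedding
  refine ⟨Φ, Ψ, hΦ, ?_, fun x => hrange ▸ mem_range_self x, hΨΦ, fun y hy => ?_⟩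
  swap
  · obtain ⟨x, rfl⟩ := hrange ▸ hy
    rw [hΨΦ]
  rintro y hy
  obtain ⟨x, rfl⟩ := hrange ▸ hy
  have hcont : ContinuousWithinAt Ψ S (Φ x) := by
    rw [← hrange, ContinuousWithinAt, hΨΦ, ← hemb.map_nhds_eq, tendsto_map'_iff]
    exact tendsto_id.congr fun x => (hΨΦ x).symm
  set φ := extChartAt (𝓡∂ 2) x with hφ
  have key : ContDiffWithinAt ℝ ∞ (φ ∘ Ψ) S (Φ x) := by
    refine contDiffWithinAt_infty.2 fun k => ?_
    have hF : ContDiffOn ℝ (k + 1 : ℕ) (Φ ∘ φ.symm) φ.target := by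
      have h1 : ContMDiffOn 𝓘(ℝ, EuclideanSpace ℝ (Fin 2)) 𝓘(ℝ, EuclideanSpace ℝ (Fin 2)) ∞ (Φ ∘ φ.symm) φ.target :=
        hΦ.comp_contMDiffOn (contMDiffOn_extChartAt_symm x)
      exact (contMDiffOn_iff_contDiffOn.1 h1).of_le (by exact_mod_cast le_top)
    have htar : φ.target ∈ 𝓝[range (𝓡∂ 2)] (φ x) := extChartAt_target_mem_nhdsWithin x
    obtain ⟨G, hG, hGF⟩ := exists_extension_halfSpace hF htar
    have hxr : φ x ∈ range (𝓡∂ 2) := extChartAt_target_subset_range (I := 𝓡∂ 2) x (mem_extChartAt_target x)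
    have hGx : G (φ x) = Φ x := by
      rw [hGF.eq_of_nhdsWithin hxr]
      show Φ (φ.symm (φ x)) = Φ x
      rw [φ.left_inv (mem_extChartAt_source x)]
    have hder : fderiv ℝ G (φ x) = mfderiv (𝓡∂ 2) 𝓘(ℝ, EuclideanSpace ℝ (Fin 2)) Φ x := by
      rw [(hΦ.contMDiffAt.mdifferentiableAt (by simp)).mfderiv]
      have h1 : fderivWithin ℝ G (range (𝓡∂ 2)) (φ x) = fderiv ℝ G (φ x) :=
        fderivWithin_eq_fderiv (ModelWithCorners.uniqueDiffOn _ _ hxr) (hG.differentiable (by simp) _)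
      rw [← h1]
      exact hGF.fderivWithin_eq (hGF.eq_of_nhdsWithin hxr)
    have hker : LinearMap.ker (fderiv ℝ G (φ x)).toLinearMap = ⊥ :=
      LinearMap.ker_eq_bot'.2 fun u hu => hd x u (by rw [← hder]; exact hu)
    let e : EuclideanSpace ℝ (Fin 2) ≃L[ℝ] EuclideanSpace ℝ (Fin 2) :=
      (LinearEquiv.ofInjectiveEndo _ (LinearMap.ker_eq_bot.1 hker)).toContinuousLinearEquiv
    have he : HasFDerivAt G (e : EuclideanSpace ℝ (Fin 2) →L[ℝ] EuclideanSpace ℝ (Fin 2)) (φ x) := by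
      have h1 := (hG.differentiable (by simp) (φ x)).hasFDerivAt
      rwa [show (e : EuclideanSpace ℝ (Fin 2) →L[ℝ] EuclideanSpace ℝ (Fin 2)) = fderiv ℝ G (φ x) from
        ContinuousLinearMap.ext fun u => rfl]
    have hGc : ContDiffAt ℝ (k + 1 : ℕ) G (φ x) := hG.contDiffAt
    have hloc := hGc.to_localInverse he (by simp)
    have hleft := (hGc.hasStrictFDerivAt' he (by simp)).eventually_left_inverse
    have hloc' : ContDiffWithinAt ℝ k (hGc.localInverse he (by simp)) S (Φ x) := by
      rw [hGx] at hloc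
      exact (hloc.of_le (by norm_cast; omega)).contDiffWithinAt
    have hφc : Tendsto (φ ∘ Ψ) (𝓝[S] (Φ x)) (𝓝[range (𝓡∂ 2)] (φ x)) := by
      refine tendsto_nhdsWithin_of_tendsto_nhds_of_eventually_within _ ?_ ?_
      · have h1 : ContinuousAt φ (Ψ (Φ x)) := by
          rw [hΨΦ]
          exact continuousAt_extChartAt x
        have := h1.comp_continuousWithinAt hcont
        rwa [ContinuousWithinAt, Function.comp_apply, hΨΦ] at this
      · refine Eventually.of_forall fun y => ?_
        exact ⟨_, rfl⟩
    have hsrc : ∀ᶠ y in 𝓝[S] (Φ x), Ψ y ∈ φ.source := by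
      refine hcont.eventually ?_
      rw [hΨΦ]
      exact extChartAt_source_mem_nhds x
    refine hloc'.congr_of_eventuallyEq_of_mem ?_ hy
    filter_upwards [hφc.eventually hGF, (hφc.mono_right nhdsWithin_le_nhds).eventually hleft, hsrc, self_mem_nhdsWithin] with y h1 h2 h3 h4
    obtain ⟨x', rfl⟩ := hrange ▸ h4
    have h5 : G ((φ ∘ Ψ) (Φ x')) = Φ x' := by
      rw [h1]
      show Φ (φ.symm (φ (Ψ (Φ x')))) = Φ x'
      rw [φ.left_inv h3, hΨΦ]
    rw [h5] at h2
    exact h2.symm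
  rw [contMDiffWithinAt_iff]
  refine ⟨hcont, ?_⟩
  rw [hΨΦ]
  simp only [extChartAt_model_space_eq_id, PartialEquiv.refl_symm, PartialEquiv.refl_coe,
    Function.comp_id, preimage_id, modelWithCornersSelf_coe, range_id, inter_univ, id]
  exact key

end

/-! ### Lower end points and relative height on leaves -/

section

open Set Filter MeasureTheory

variable {X : Type*} [TopologicalSpace X] [ChartedSpace (EuclideanHalfSpace 2) X]
  {v : ∀ x : X, TangentSpace (𝓡∂ 2) x}

/-- `F` is smooth at `x`, with derivative `d` along the field. -/
def HasFieldDeriv (v : ∀ x : X, TangentSpace (𝓡∂ 2) x) (F : X → ℝ) (d : ℝ) (x : X) : Prop :=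
  ContMDiffAt (𝓡∂ 2) 𝓘(ℝ, ℝ) ∞ F x ∧ fieldDeriv v F x = d

namespace HasFieldDeriv

variable {F G : X → ℝ} {a b : ℝ} {x : X}

theorem mdifferentiableAt (h : HasFieldDeriv v F a x) : MDifferentiableAt (𝓡∂ 2) 𝓘(ℝ, ℝ) F x :=
  h.1.mdifferentiableAt (by simp)

theorem const (c : ℝ) (x : X) : HasFieldDeriv v (fun _ => c) 0 x :=
  ⟨contMDiffAt_const, fieldDeriv_const c x⟩

theorem add (hF : HasFieldDeriv v F a x) (hG : HasFieldDeriv v G b x) :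
    HasFieldDeriv v (fun y => F y + G y) (a + b) x :=
  ⟨hF.1.add hG.1, by
    rw [← hF.2, ← hG.2]
    exact fieldDeriv_add hF.mdifferentiableAt hG.mdifferentiableAt⟩

theorem mul (hF : HasFieldDeriv v F a x) (hG : HasFieldDeriv v G b x) :
    HasFieldDeriv v (fun y => F y * G y) (F x * b + G x * a) x :=
  ⟨hF.1.mul hG.1, by
    rw [← hF.2, ← hG.2]
    have h := (hF.mdifferentiableAt.hasMFDerivAt.mul hG.mdifferentiableAt.hasMFDerivAt).mfderiv
    exact congrArg (fun D => D (v x)) h⟩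

theorem comp {h : ℝ → ℝ} (hF : HasFieldDeriv v F a x) (hh : ContDiffAt ℝ ∞ h (F x)) :
    HasFieldDeriv v (fun y => h (F y)) (deriv h (F x) * a) x :=
  ⟨hh.comp_contMDiffAt hF.1, by
    rw [← hF.2]
    have h1 := differential_comp (hh.differentiableAt (by simp)).hasDerivAt hF.mdifferentiableAt
    exact congrArg (fun D => D (v x)) h1⟩

theorem congr (hF : HasFieldDeriv v F a x) (h : G =ᶠ[𝓝 x] F) : HasFieldDeriv v G a x :=
  ⟨hF.1.congr_of_eventuallyEq h, (fieldDeriv_congr h).trans hF.2⟩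

theorem const_mul (hF : HasFieldDeriv v F a x) (c : ℝ) : HasFieldDeriv v (fun y => c * F y) (c * a) x := by
  have := (const (v := v) c x).mul hF
  rwa [mul_zero, add_zero] at this

theorem neg (hF : HasFieldDeriv v F a x) : HasFieldDeriv v (fun y => -F y) (-a) x := by
  simpa using hF.const_mul (-1)

theorem sub (hF : HasFieldDeriv v F a x) (hG : HasFieldDeriv v G b x) :
    HasFieldDeriv v (fun y => F y - G y) (a - b) x := by
  simpa [sub_eq_add_neg] using hF.add hG.neg

theorem of_reverse (hF : HasFieldDeriv (reverseField v) F a x) : HasFieldDeriv v F (-a) x :=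
  ⟨hF.1, by rw [← hF.2, fieldDeriv_reverse, neg_neg]⟩

end HasFieldDeriv

namespace FlowSystem

variable {D : FlowSystem X}

theorem IsLeaf.to_reverse {γ : ℝ → X} {a b : ℝ} (h : D.IsLeaf γ a b) :
    D.reverse.IsLeaf (fun r => γ (-r)) (-b) (-a) := by
  have hneg : MapsTo (fun r : ℝ => -r) (Icc (-b) (-a)) (Icc a b) := fun r hr =>
    ⟨by linarith [hr.2], by linarith [hr.1]⟩
  refine ⟨h.1.comp continuous_neg.continuousOn hneg, fun r hr => ?_, fun p r hr hp => ?_⟩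
  · show -D.f (γ (-r)) = r
    rw [h.2.1 (-r) (hneg hr), neg_neg]
  · have h1 := h.2.2 p (-r) (hneg hr) hp
    have h2 : Tendsto (fun r : ℝ => -r) (𝓝[Icc (-b) (-a)] r) (𝓝[Icc a b] (-r)) :=
      continuous_neg.continuousWithinAt.tendsto_nhdsWithin hneg
    exact h2.eventually h1

theorem Below.to_reverse {x y : X} (h : D.Below x y) : D.reverse.Below y x := by
  obtain ⟨γ, h1, h2, h3, h4⟩ := h
  refine ⟨_, h1.to_reverse, neg_le_neg_iff.2 h2, ?_, ?_⟩
  · show γ (- -D.f y) = y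
    rwa [neg_neg]
  · show γ (- -D.f x) = x
    rwa [neg_neg]

variable (D) in
/-- The point is a leaf by itself. -/
def IsSingular (x : X) : Prop := (D.box x).kind = .tangent

theorem isSingular_iff {x : X} : D.IsSingular x ↔ D.IsTop x ∧ D.reverse.IsTop x := by
  rw [isTop_and_isTop_reverse_iff (D.box x).mem_B]
  simp [IsSingular]

variable [CompactSpace X] [T2Space X]

variable (D) in
/-- The lower end point of the leaf of `x`. -/
noncomputable def bot (x : X) : X := D.reverse.top x

theorem below_bot (x : X) : D.Below (D.bot x) x := (below_top (D := D.reverse) x).of_reverse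

theorem bot_eq_of_below {x y : X} (h : D.Below x y) : D.bot x = D.bot y :=
  (top_eq_top (D := D.reverse) h.to_reverse).symm

theorem below_of_top_eq {x y : X} (h : D.top x = D.top y) (hf : D.f x ≤ D.f y) : D.Below x y :=
  (below_top x).total_left (h ▸ below_top y) hf

theorem eq_of_top_eq {x y : X} (h : D.top x = D.top y) (hf : D.f x = D.f y) : x = y :=
  (below_of_top_eq h hf.le).eq_of_f_eq hf

theorem bot_eq_bot {x y : X} (h : D.top x = D.top y) : D.bot x = D.bot y := by
  rcases le_total (D.f x) (D.f y) with hf | hf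
  · exact bot_eq_of_below (below_of_top_eq h hf)
  · exact (bot_eq_of_below (below_of_top_eq h.symm hf)).symm

theorem top_top (x : X) : D.top (D.top x) = D.top x := (isTop_top x).top_eq

theorem top_bot (x : X) : D.top (D.bot x) = D.top x := top_eq_top (below_bot x)

theorem isSingular_top_iff {x : X} : D.IsSingular (D.top x) ↔ D.IsSingular x := by
  constructor
  · intro h
    have h1 := (isSingular_iff.1 h).2 _ (below_top x).to_reverse
    rwa [← h1] at h
  · intro h
    rwa [(isSingular_iff.1 h).1.top_eq]

theorem f_bot_lt_f_top {x : X} (h : ¬ D.IsSingular x) : D.f (D.bot x) < D.f (D.top x) := by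
  refine ((below_bot x).trans (below_top x)).lt fun heq => h ?_
  have h1 : D.bot x = x := (below_bot x).eq_of_f_eq
    (le_antisymm (below_bot x).le (heq ▸ (below_top x).le))
  refine isSingular_iff.2 ⟨?_, ?_⟩
  · rw [← h1, heq]
    exact isTop_top x
  · rw [← h1]
    exact isTop_top (D := D.reverse) x

/-- The top of a nonsingular leaf is the centre of an exit box, where the upper edge is `t = 0`. So
`g ∘ top` is a smooth function of the smooth label `σ ∘ top`; no square root intervenes. -/
theorem hasFieldDeriv_comp_top {x : X} (h : ¬ D.IsSingular x) {g : X → ℝ}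
    (hg : ContMDiff (𝓡∂ 2) 𝓘(ℝ, ℝ) ∞ g) : HasFieldDeriv D.v (fun y => g (D.top y)) 0 x := by
  rw [← isSingular_top_iff] at h
  set p := D.top x with hp
  obtain ⟨N, hN, hxN, hNB, hNs, hNd⟩ := topSmooth (D := D) (p := p) (x := x) (D.box p).mem_B
  have hk : (D.box p).kind = .exit := (hasTop_of_isTop (isTop_top x)).resolve_right h
  have hkt : (D.box p).kind.HasTop := Or.inl hk
  have hreg : ∀ s ∈ Ioo (-(D.box p).ε) (D.box p).ε, ((0 : ℝ), s) ∈ boxRegion (D.box p).kind (D.box p).ε :=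
    fun s hs => by
      rw [hk]
      exact ⟨⟨by linarith [(D.box p).ε_pos], le_rfl⟩, hs⟩
  have hκ : ContMDiffOn 𝓘(ℝ, ℝ) (𝓡∂ 2) ∞ (fun s => (D.box p).κ (0, s)) (Ioo (-(D.box p).ε) (D.box p).ε) :=
    (D.box p).smooth_κ.comp (ContDiff.contMDiff (by fun_prop)).contMDiffOn hreg
  have hs : (D.box p).σ (D.top x) ∈ Ioo (-(D.box p).ε) (D.box p).ε := by
    have h1 := (D.box p).mapsTo _ (hNB x hxN)
    rw [hk] at h1
    exact h1.2
  have hgκ : ContDiffAt ℝ ∞ (fun s => g ((D.box p).κ (0, s))) ((D.box p).σ (D.top x)) :=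
    ((hg.comp_contMDiffOn hκ).contMDiffAt (isOpen_Ioo.mem_nhds hs)).contDiffAt
  have h1 : HasFieldDeriv D.v (fun y => (D.box p).σ (D.top y)) 0 x :=
    ⟨hNs.contMDiffAt (hN.mem_nhds hxN), (hNd x hxN).1⟩
  have h2 := h1.comp hgκ
  rw [mul_zero] at h2
  refine h2.congr ?_
  filter_upwards [hN.mem_nhds hxN] with y hy
  have h3 := (isTop_top y).eq_κ (hNB y hy)
  rw [hk] at h3
  exact congrArg g h3

theorem hasFieldDeriv_comp_bot {x : X} (h : ¬ D.IsSingular x) {g : X → ℝ}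
    (hg : ContMDiff (𝓡∂ 2) 𝓘(ℝ, ℝ) ∞ g) : HasFieldDeriv D.v (fun y => g (D.bot y)) 0 x := by
  have h1 : ¬ D.reverse.IsSingular x := fun hr => h (by
    change (D.box x).kind.reverse = .tangent at hr
    unfold IsSingular
    cases hk : (D.box x).kind <;> rw [hk] at hr <;> first | rfl | exact absurd hr (by simp [BoxKind.reverse]))
  have h2 := (hasFieldDeriv_comp_top h1 hg).of_reverse
  rw [neg_zero] at h2
  exact h2

variable (D) in
/-- A smooth function that increases along the leaves. -/
structure IsHeight (g : X → ℝ) : Prop where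
  smooth : ContMDiff (𝓡∂ 2) 𝓘(ℝ, ℝ) ∞ g
  fieldDeriv_pos : ∀ x, 0 < fieldDeriv D.v g x
  lt_of_lt : ∀ x y, D.top x = D.top y → D.f x < D.f y → g x < g y

theorem isHeight_f : D.IsHeight D.f := ⟨D.smooth_f, D.fieldDeriv_pos, fun _ _ _ h => h⟩

theorem IsHeight.le_of_below {g : X → ℝ} (hg : D.IsHeight g) {x y : X} (h : D.Below x y) : g x ≤ g y := by
  by_cases hxy : x = y
  · rw [hxy]
  · exact (hg.lt_of_lt x y (top_eq_top h) (h.lt hxy)).le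

variable (D) in
/-- The relative height of a point on its leaf. -/
noncomputable def level (g : X → ℝ) (x : X) : ℝ := (g x - g (D.bot x)) / (g (D.top x) - g (D.bot x))

namespace IsHeight

variable {g : X → ℝ} (hg : D.IsHeight g)
include hg

theorem bot_lt_top {x : X} (h : ¬ D.IsSingular x) : g (D.bot x) < g (D.top x) :=
  hg.lt_of_lt _ _ (by rw [top_bot, top_top]) (f_bot_lt_f_top h)

theorem level_mem (x : X) : D.level g x ∈ Icc 0 1 := by
  have h1 := hg.le_of_below (below_bot x)
  have h2 := hg.le_of_below (below_top x)
  -- This covers singular points too, where the quotient is `0 / 0 = 0`.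
  exact ⟨div_nonneg (by linarith) (by linarith), div_le_one_of_le₀ (by linarith) (by linarith)⟩

theorem hasFieldDeriv_level {x : X} (h : ¬ D.IsSingular x) :
    ∃ d > 0, HasFieldDeriv D.v (D.level g) d x := by
  have hlt := hg.bot_lt_top h
  have h1 := hasFieldDeriv_comp_top h hg.smooth
  have h2 := hasFieldDeriv_comp_bot h hg.smooth
  have h3 : HasFieldDeriv D.v g (fieldDeriv D.v g x) x := ⟨hg.smooth.contMDiffAt, rfl⟩
  have h4 := (h3.sub h2).mul ((h1.sub h2).comp (h := fun t => t⁻¹) (contDiffAt_inv ℝ (by linarith)))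
  refine ⟨(g (D.top x) - g (D.bot x))⁻¹ * fieldDeriv D.v g x,
    mul_pos (inv_pos.2 (by linarith)) (hg.fieldDeriv_pos x), ?_⟩
  simp only [sub_zero, mul_zero, zero_add] at h4
  exact h4.congr (Eventually.of_forall fun y => div_eq_mul_inv _ _)

theorem level_lt {x y : X} (h : ¬ D.IsSingular x) (ht : D.top x = D.top y) (hf : D.f x < D.f y) :
    D.level g x < D.level g y := by
  have hlt := hg.bot_lt_top h
  unfold level
  rw [← ht, ← bot_eq_bot ht]
  have := hg.lt_of_lt x y ht hf
  exact div_lt_div_of_pos_right (by linarith) (by linarith)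

theorem eq_of_level_eq {x y : X} (h : ¬ D.IsSingular x) (ht : D.top x = D.top y)
    (hl : D.level g x = D.level g y) : x = y := by
  have h' : ¬ D.IsSingular y := by rwa [← isSingular_top_iff, ← ht, isSingular_top_iff]
  rcases lt_trichotomy (D.f x) (D.f y) with hf | hf | hf
  · exact absurd hl (hg.level_lt h ht hf).ne
  · exact eq_of_top_eq ht hf
  · exact absurd hl (hg.level_lt h' ht.symm hf).ne'

theorem exists_level_eq {z : X} (hz : D.IsTop z) (h : ¬ D.IsSingular z) {ρ : ℝ} (hρ : ρ ∈ Icc (0 : ℝ) 1) :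
    ∃ x, D.top x = z ∧ D.level g x = ρ := by
  have hlt := hg.bot_lt_top h
  rw [hz.top_eq] at hlt
  obtain ⟨γ, hγ, hle, h0, h1⟩ := below_bot (D := D) z
  have hc : ContinuousOn (fun r => g (γ r)) (Icc (D.f (D.bot z)) (D.f z)) :=
    hg.smooth.continuous.comp_continuousOn hγ.1
  have hmem : g (D.bot z) + ρ * (g z - g (D.bot z)) ∈ Icc (g (γ (D.f (D.bot z)))) (g (γ (D.f z))) := by
    rw [h0, h1]
    constructor <;> nlinarith [hρ.1, hρ.2]
  obtain ⟨r, hr, hgr⟩ := intermediate_value_Icc hle hc hmem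
  have hb := hγ.below hr.1 hr.2 le_rfl
  rw [h1] at hb
  have ht : D.top (γ r) = z := by rw [top_eq_top hb, hz.top_eq]
  refine ⟨γ r, ht, ?_⟩
  have hbot : D.bot (γ r) = D.bot z := bot_eq_of_below hb
  unfold level
  simp only at hgr
  rw [ht, hbot, hgr, div_eq_iff (by linarith)]
  ring

end IsHeight

end FlowSystem

end

/-! ### Maps to the plane, and the annulus -/

section

open Set Filter MeasureTheory

variable {X : Type*} [TopologicalSpace X] [ChartedSpace (EuclideanHalfSpace 2) X]

/-- The map to the plane with given coordinates. -/
noncomputable def planeMap (a b : X → ℝ) (x : X) : EuclideanSpace ℝ (Fin 2) :=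
  a x • EuclideanSpace.single 0 1 + b x • EuclideanSpace.single 1 1

theorem planeMap_zero (a b : X → ℝ) (x : X) : planeMap a b x 0 = a x := by simp [planeMap]

theorem planeMap_one (a b : X → ℝ) (x : X) : planeMap a b x 1 = b x := by simp [planeMap]

theorem norm_sq_planeMap (a b : X → ℝ) (x : X) : ‖planeMap a b x‖ ^ 2 = a x ^ 2 + b x ^ 2 := by
  rw [EuclideanSpace.norm_sq_eq, Fin.sum_univ_two, planeMap_zero, planeMap_one, Real.norm_eq_abs,
    Real.norm_eq_abs, sq_abs, sq_abs]

theorem contMDiff_planeMap {a b : X → ℝ} (ha : ContMDiff (𝓡∂ 2) 𝓘(ℝ, ℝ) ∞ a)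
    (hb : ContMDiff (𝓡∂ 2) 𝓘(ℝ, ℝ) ∞ b) :
    ContMDiff (𝓡∂ 2) 𝓘(ℝ, EuclideanSpace ℝ (Fin 2)) ∞ (planeMap a b) :=
  (ha.smul contMDiff_const).add (hb.smul contMDiff_const)

theorem differential_coord {Φ : X → EuclideanSpace ℝ (Fin 2)} {x : X}
    (hΦ : MDifferentiableAt (𝓡∂ 2) 𝓘(ℝ, EuclideanSpace ℝ (Fin 2)) Φ x) (i : Fin 2)
    (u : EuclideanSpace ℝ (Fin 2))
    (hu : (mfderiv (𝓡∂ 2) 𝓘(ℝ, EuclideanSpace ℝ (Fin 2)) Φ x u : EuclideanSpace ℝ (Fin 2)) = 0) :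
    differential (fun y => Φ y i) x u = 0 := by
  have h1 := ((EuclideanSpace.proj (𝕜 := ℝ) i).hasFDerivAt (x := Φ x)).hasMFDerivAt.comp x hΦ.hasMFDerivAt
  have h2 : differential (fun y => Φ y i) x u = (EuclideanSpace.proj (𝕜 := ℝ) i)
      (mfderiv (𝓡∂ 2) 𝓘(ℝ, EuclideanSpace ℝ (Fin 2)) Φ x u : EuclideanSpace ℝ (Fin 2)) :=
    congrArg (fun D => D u) h1.mfderiv
  exact h2.trans ((congrArg (EuclideanSpace.proj (𝕜 := ℝ) i) hu).trans (map_zero _))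

theorem isDiffeomorphicTo_planeMap [CompactSpace X] [Nonempty X] [IsManifold (𝓡∂ 2) ∞ X]
    {S : Set (EuclideanSpace ℝ (Fin 2))} {a b : X → ℝ} (ha : ContMDiff (𝓡∂ 2) 𝓘(ℝ, ℝ) ∞ a)
    (hb : ContMDiff (𝓡∂ 2) 𝓘(ℝ, ℝ) ∞ b) (hinj : ∀ x y, a x = a y → b x = b y → x = y)
    (hmem : ∀ x, planeMap a b x ∈ S) (hsurj : ∀ y ∈ S, ∃ x, a x = y 0 ∧ b x = y 1)
    (hd : ∀ x u, differential a x u = 0 → differential b x u = 0 → u = 0) : IsDiffeomorphicTo X S := by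
  have hΦ := contMDiff_planeMap ha hb
  refine isDiffeomorphicTo_of_immersion hΦ (fun x y hxy => hinj x y ?_ ?_) ?_ fun x u hu => ?_
  · rw [← planeMap_zero a b x, hxy, planeMap_zero]
  · rw [← planeMap_one a b x, hxy, planeMap_one]
  · refine (range_subset_iff.2 hmem).antisymm fun y hy => ?_
    obtain ⟨x, h0, h1⟩ := hsurj y hy
    refine ⟨x, ?_⟩
    ext i
    fin_cases i
    · exact (planeMap_zero a b x).trans h0
    · exact (planeMap_one a b x).trans h1
  · have hm : MDifferentiableAt (𝓡∂ 2) 𝓘(ℝ, EuclideanSpace ℝ (Fin 2)) (planeMap a b) x :=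
      hΦ.contMDiffAt.mdifferentiableAt (by simp)
    refine hd x u ?_ ?_
    · have := differential_coord hm 0 u hu
      simpa only [planeMap_zero] using this
    · have := differential_coord hm 1 u hu
      simpa only [planeMap_one] using this

/-- Vectors killed by the differentials of a function constant along `v` and of one increasing along `v`. -/
theorem eq_zero_of_differential_eq_zero {v : ∀ x : X, TangentSpace (𝓡∂ 2) x} {θ h : X → ℝ} {x : X}
    (hθ : fieldDeriv v θ x = 0) (hθ0 : differential θ x ≠ 0) (hh : 0 < fieldDeriv v h x)
    {u : EuclideanSpace ℝ (Fin 2)} (h1 : differential θ x u = 0) (h2 : differential h x u = 0) : u = 0 := by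
  have hv0 : v x ≠ 0 := fun h0 => by
    have : fieldDeriv v h x = 0 := by
      unfold fieldDeriv
      rw [h0]
      exact map_zero _
    linarith
  obtain ⟨c, hc⟩ := exists_eq_smul_of_apply_eq_zero hθ0 hv0 hθ h1
  have h3 : differential h x (c • v x) = c * fieldDeriv v h x := map_smul (differential h x) c (v x)
  rw [hc] at h2
  rcases mul_eq_zero.1 (h3.symm.trans h2) with h4 | h4
  · rw [hc, h4]
    exact zero_smul ℝ (v x)
  · exact absurd h4 hh.ne'

namespace FlowSystem

variable {D : FlowSystem X} [CompactSpace X] [T2Space X]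

/-- A smooth parameter on the leaves near a nonsingular point. -/
theorem exists_parameter {G : GeodesicAtlas D.Tops}
    (hG : ∀ z : D.Tops, ¬ D.IsSingular z.1 → ∃ U : ℝ → ℝ, ContDiffAt ℝ ∞ U 0 ∧ U 0 = 0 ∧ deriv U 0 ≠ 0 ∧
      ∀ᶠ x in 𝓝 z, x = G.c z (U ((D.box z.1).σ x.1)))
    {γ : ℝ → D.Tops} {x : X} {t : ℝ} (hγ : G.GeodesicAt γ t) (ht : D.toTops x = γ t)
    (hx : ¬ D.IsSingular x) : ∃ θ : X → ℝ, HasFieldDeriv D.v θ 0 x ∧ θ x = t ∧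
      (∀ᶠ y in 𝓝 x, D.toTops y = γ (θ y)) ∧ differential θ x ≠ 0 := by
  obtain ⟨ε, hε, he⟩ := hγ
  rw [← ht] at he
  set z := D.toTops x with hz
  have hzx : z.1 = D.top x := rfl
  obtain ⟨U, hU, hU0, hUd, hUc⟩ := hG z (by rw [hzx, isSingular_top_iff]; exact hx)
  obtain ⟨N, hN, hxN, hNB, hNs, hNd⟩ := topSmooth (D := D) (p := z.1) (x := x) (D.box z.1).mem_B
  have hσx : (D.box z.1).σ (D.top x) = 0 := (box_self z.1).2
  have h1 : HasFieldDeriv D.v (fun y => (D.box z.1).σ (D.top y)) 0 x :=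
    ⟨hNs.contMDiffAt (hN.mem_nhds hxN), (hNd x hxN).1⟩
  have hh : ContDiffAt ℝ ∞ (fun s => t + ε * U s) ((D.box z.1).σ (D.top x)) := by
    rw [hσx]
    exact contDiffAt_const.add (contDiffAt_const.mul hU)
  have hhd : deriv (fun s => t + ε * U s) 0 = ε * deriv U 0 :=
    (((hU.differentiableAt (by simp)).hasDerivAt.const_mul ε).const_add t).deriv
  -- The parameter is `t + ε * U (σ (top y))`: the label of the leaf converted to length, with the
  -- sign of the direction in which `γ` runs.
  have h2 := h1.comp hh
  rw [mul_zero] at h2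
  refine ⟨_, h2, ?_, ?_, ?_⟩
  · rw [hσx, hU0, mul_zero, add_zero]
  · have h3 := continuous_toTops.continuousAt.eventually (f := D.toTops) hUc
    have h4 : Tendsto (fun y => ε * U ((D.box z.1).σ (D.top y))) (𝓝 x) (𝓝 0) := by
      have h5 : ContinuousAt U ((D.box z.1).σ (D.top x)) := by
        rw [hσx]
        exact hU.continuousAt
      have h6 := (h5.comp (f := fun y => (D.box z.1).σ (D.top y)) h1.1.continuousAt).const_mul ε
      simpa [ContinuousAt, hσx, hU0] using h6
    filter_upwards [h3, h4.eventually he] with y hy1 hy2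
    rw [hy2, hy1, ← mul_assoc]
    rcases hε with rfl | rfl
    · simp [toTops]
    · simp [toTops]
  · have h3 := differential_comp (F := fun y => (D.box z.1).σ (D.top y)) (hh.differentiableAt (by simp)).hasDerivAt h1.mdifferentiableAt
    rw [h3, hσx, hhd]
    refine smul_ne_zero (mul_ne_zero ?_ hUd) (hNd x hxN).2
    rcases hε with rfl | rfl <;> norm_num

/-- A surface swept out by a circle of leaves is an annulus. -/
theorem isDiffeomorphicTo_closedAnnulus [ConnectedSpace X] [IsManifold (𝓡∂ 2) ∞ X]
    (h : ∀ x, ¬ D.IsSingular x) : IsDiffeomorphicTo X closedAnnulus := by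
  obtain ⟨G, hGE, hG, -⟩ := D.topAtlas.exists_geodesicAtlas
  have hend : ∀ z, ¬ G.IsEnd z := fun z => by
    rw [hGE]
    exact h z.1
  obtain ⟨γ, R, hR, hγ, hsurj, hper⟩ := G.exists_closed_geodesic hend
  -- The lift `w` to the line need not be continuous. It is determined modulo `R`, so its cosine and
  -- sine are well defined and agree locally with those of a smooth parameter.
  choose w hw using hsurj
  have hf := isHeight_f (D := D)
  set H : X → ℝ := fun x => 1 + D.level D.f x with hH
  set C : X → ℝ := fun x => Real.cos (2 * Real.pi / R * w (D.toTops x)) with hC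
  set S : X → ℝ := fun x => Real.sin (2 * Real.pi / R * w (D.toTops x)) with hS
  have hHmem : ∀ x, 1 ≤ H x ∧ H x ≤ 2 := fun x => by
    have := hf.level_mem x
    constructor <;> simp only [hH] <;> linarith [this.1, this.2]
  have hangle : ∀ a b, γ a = γ b → ∃ n : ℤ, 2 * Real.pi / R * a = 2 * Real.pi / R * b + n * (2 * Real.pi) :=
    fun a b hab => by
      obtain ⟨n, hn⟩ := (hper a b).1 hab
      refine ⟨n, ?_⟩
      rw [show a = b + n * R by linarith]
      field_simp
  -- local description
  have hloc : ∀ x, ∃ θ : X → ℝ, HasFieldDeriv D.v θ 0 x ∧ differential θ x ≠ 0 ∧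
      C =ᶠ[𝓝 x] (fun y => Real.cos (2 * Real.pi / R * θ y)) ∧
      S =ᶠ[𝓝 x] (fun y => Real.sin (2 * Real.pi / R * θ y)) := fun x => by
    obtain ⟨θ, h1, -, h3, h4⟩ := exists_parameter (fun z hz => hG z hz) (hγ _) (hw (D.toTops x)).symm (h x)
    refine ⟨θ, h1, h4, ?_, ?_⟩ <;> filter_upwards [h3] with y hy
    · obtain ⟨n, hn⟩ := hangle (w (D.toTops y)) (θ y) ((hw _).trans hy)
      simp only [hC]
      rw [hn, Real.cos_add_int_mul_two_pi]
    · obtain ⟨n, hn⟩ := hangle (w (D.toTops y)) (θ y) ((hw _).trans hy)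
      simp only [hS]
      rw [hn, Real.sin_add_int_mul_two_pi]
  have hHd : ∀ x, ∃ d > 0, HasFieldDeriv D.v H d x := fun x => by
    obtain ⟨d, hd, h1⟩ := hf.hasFieldDeriv_level (h x)
    have := (HasFieldDeriv.const (v := D.v) 1 x).add h1
    rw [zero_add] at this
    exact ⟨d, hd, this⟩
  -- derivatives in all directions
  have hdir : ∀ (v : ∀ x : X, TangentSpace (𝓡∂ 2) x) (x : X) (θ : X → ℝ),
      ContMDiffAt (𝓡∂ 2) 𝓘(ℝ, ℝ) ∞ θ x →
      C =ᶠ[𝓝 x] (fun y => Real.cos (2 * Real.pi / R * θ y)) →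
      S =ᶠ[𝓝 x] (fun y => Real.sin (2 * Real.pi / R * θ y)) →
      HasFieldDeriv v (fun y => H y * C y) (H x * (-S x * (2 * Real.pi / R * fieldDeriv v θ x)) +
        C x * fieldDeriv v H x) x ∧
      HasFieldDeriv v (fun y => H y * S y) (H x * (C x * (2 * Real.pi / R * fieldDeriv v θ x)) +
        S x * fieldDeriv v H x) x := by
    intro v x θ hθ hCθ hSθ
    obtain ⟨d, -, hHs, -⟩ := hHd x
    have h1 : HasFieldDeriv v (fun y => 2 * Real.pi / R * θ y) (2 * Real.pi / R * fieldDeriv v θ x) x :=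
      HasFieldDeriv.const_mul ⟨hθ, rfl⟩ _
    have h2 := (h1.comp (h := Real.cos) Real.contDiff_cos.contDiffAt).congr hCθ
    have h3 := (h1.comp (h := Real.sin) Real.contDiff_sin.contDiffAt).congr hSθ
    rw [Real.deriv_cos, ← hSθ.eq_of_nhds] at h2
    rw [Real.deriv_sin, ← hCθ.eq_of_nhds] at h3
    have h4 : HasFieldDeriv v H (fieldDeriv v H x) x := ⟨hHs, rfl⟩
    exact ⟨h4.mul h2, h4.mul h3⟩
  have hsmooth : ContMDiff (𝓡∂ 2) 𝓘(ℝ, ℝ) ∞ (fun y => H y * C y) ∧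
      ContMDiff (𝓡∂ 2) 𝓘(ℝ, ℝ) ∞ (fun y => H y * S y) := by
    constructor <;> intro x <;> obtain ⟨θ, h1, -, h3, h4⟩ := hloc x
    · exact (hdir D.v x θ h1.1 h3 h4).1.1
    · exact (hdir D.v x θ h1.1 h3 h4).2.1
  have hCS : ∀ x, C x ^ 2 + S x ^ 2 = 1 := fun x => Real.cos_sq_add_sin_sq _
  have hsum : ∀ x, (H x * C x) ^ 2 + (H x * S x) ^ 2 = H x ^ 2 := fun x => by
    have := hCS x
    calc _ = H x ^ 2 * (C x ^ 2 + S x ^ 2) := by ring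
      _ = _ := by rw [this, mul_one]
  refine isDiffeomorphicTo_planeMap hsmooth.1 hsmooth.2 (fun x y h1 h2 => ?_) (fun x => ?_)
    (fun y hy => ?_) fun x u h1 h2 => ?_
  · have h3 : H x = H y := by
      have h4 : H x ^ 2 = H y ^ 2 := by rw [← hsum x, ← hsum y, h1, h2]
      have := hHmem x
      have := hHmem y
      nlinarith
    have h0 : H x ≠ 0 := by linarith [(hHmem x).1]
    rw [← h3] at h1 h2
    have h5 := Real.Angle.cos_sin_inj (mul_left_cancel₀ h0 h1) (mul_left_cancel₀ h0 h2)
    obtain ⟨k, hk⟩ := Real.Angle.angle_eq_iff_two_pi_dvd_sub.1 h5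
    have h6 : w (D.toTops x) - w (D.toTops y) = k * R := by
      have hpi := Real.pi_pos
      field_simp at hk
      linarith
    have h7 := (hper _ _).2 ⟨k, h6⟩
    rw [hw, hw] at h7
    have h8 : D.top x = D.top y := congrArg Subtype.val h7
    refine hf.eq_of_level_eq (h x) h8 ?_
    simp only [hH] at h3
    linarith
  · have h1 := norm_sq_planeMap (fun y => H y * C y) (fun y => H y * S y) x
    simp only [hsum] at h1
    have h2 : ‖planeMap (fun y => H y * C y) (fun y => H y * S y) x‖ = H x :=
      (pow_left_inj₀ (norm_nonneg _) (by linarith [(hHmem x).1]) two_ne_zero).1 h1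
    show 1 ≤ _ ∧ _ ≤ 2
    rw [h2]
    exact hHmem x
  · set ζ : ℂ := ⟨y 0, y 1⟩ with hζ
    have hn : ‖ζ‖ = ‖y‖ := by
      rw [EuclideanSpace.norm_eq, Fin.sum_univ_two, Complex.norm_eq_sqrt_sq_add_sq]
      simp [hζ]
    have hy' : 1 ≤ ‖ζ‖ ∧ ‖ζ‖ ≤ 2 := by
      rw [hn]
      exact hy
    set t := ζ.arg * R / (2 * Real.pi) with ht
    obtain ⟨x, hx1, hx2⟩ := hf.exists_level_eq (γ t).2 (h _)
      (show ‖ζ‖ - 1 ∈ Icc (0 : ℝ) 1 from ⟨by linarith, by linarith⟩)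
    have hHx : H x = ‖ζ‖ := by
      simp only [hH, hx2]
      ring
    obtain ⟨n, hn'⟩ := hangle (w (D.toTops x)) t ((hw _).trans (Subtype.ext hx1))
    have harg : 2 * Real.pi / R * t = ζ.arg := by
      have hpi := Real.pi_pos
      rw [ht]
      field_simp
    rw [harg] at hn'
    refine ⟨x, ?_, ?_⟩
    · show H x * Real.cos _ = y 0
      rw [hHx, hn', Real.cos_add_int_mul_two_pi, Complex.norm_mul_cos_arg]
    · show H x * Real.sin _ = y 1
      rw [hHx, hn', Real.sin_add_int_mul_two_pi, Complex.norm_mul_sin_arg]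
  · obtain ⟨θ, k1, k2, k3, k4⟩ := hloc x
    -- The formulas hold for arbitrary fields; with the constant field `u`, the derivative along the
    -- field at `x` is the differential applied to `u`. Rotating the two equations back by the angle
    -- separates the radial part `B` from the angular part `H x * A`.
    obtain ⟨e1, e2⟩ := hdir (fun _ => u) x θ k1.1 k3 k4
    obtain ⟨d, hd, k5⟩ := hHd x
    set A := 2 * Real.pi / R * fieldDeriv (fun _ => u) θ x with hA
    set B := fieldDeriv (fun _ => u) H x with hB
    have e3 : H x * (-S x * A) + C x * B = 0 := e1.2.symm.trans h1
    have e4 : H x * (C x * A) + S x * B = 0 := e2.2.symm.trans h2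
    have h0 : H x ≠ 0 := by linarith [(hHmem x).1]
    have hB0 : B = 0 := by
      calc B = (C x ^ 2 + S x ^ 2) * B := by rw [hCS, one_mul]
        _ = C x * (H x * (-S x * A) + C x * B) + S x * (H x * (C x * A) + S x * B) := by ring
        _ = 0 := by rw [e3, e4]; ring
    have hA0 : H x * A = 0 := by
      calc H x * A = (C x ^ 2 + S x ^ 2) * (H x * A) := by rw [hCS, one_mul]
        _ = -S x * (H x * (-S x * A) + C x * B) + C x * (H x * (C x * A) + S x * B) := by ring
        _ = 0 := by rw [e3, e4]; ring
    have hθ0 : fieldDeriv (fun _ => u) θ x = 0 := by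
      rcases mul_eq_zero.1 ((mul_eq_zero.1 hA0).resolve_left h0) with h3 | h3
      · exact absurd h3 (by positivity)
      · exact h3
    exact eq_zero_of_differential_eq_zero k1.2 k2 (by rw [k5.2]; exact hd) hθ0 hB0

end FlowSystem

end

/-! ### The arc of leaves and the normalization of heights near its ends -/

section

open Set Filter MeasureTheory

theorem add_mul_sub_pos {a b c : ℝ} (h0 : 0 ≤ c) (h1 : c ≤ 1) (ha : 0 < a) (hb : 0 < b) :
    0 < a + c * (b - a) := by
  rcases h0.eq_or_lt with rfl | h
  · simpa using ha
  · nlinarith [mul_pos h hb, mul_nonneg (sub_nonneg.2 h1) ha.le]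

variable {X : Type*} [TopologicalSpace X] [ChartedSpace (EuclideanHalfSpace 2) X]

namespace FlowSystem

variable {D : FlowSystem X} [CompactSpace X] [T2Space X]

theorem σ_top_eq {q y : X} (hq : D.IsSingular q) (hy : y ∈ (D.box q).B) :
    (D.box q).σ (D.top y) = (D.box q).σ y := by
  have hk : (D.box q).kind.HasTop := Or.inr hq
  rw [top_eq_κ hk hy]
  exact (D.box q).σ_κ _ ((BoxKind.top_mem_iff hk (D.box q).ε_pos).2 (below_κ hk hy).1)

theorem IsSingular.eq_of_top_eq {x y : X} (hx : D.IsSingular x) (h : D.top x = D.top y) : x = y := by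
  have hy : D.IsSingular y := by rwa [← isSingular_top_iff, ← h, isSingular_top_iff]
  rw [← (isSingular_iff.1 hx).1.top_eq, h, (isSingular_iff.1 hy).1.top_eq]

variable (D) in
/-- A parameter on the leaves of a surface whose leaf space is an arc. -/
structure IsArcParameter (R : ℝ) (w : X → ℝ) : Prop where
  pos : 0 < R
  mem : ∀ x, w x ∈ Icc 0 R
  eq_iff : ∀ x y, w x = w y ↔ D.top x = D.top y
  surj : ∀ t ∈ Icc 0 R, ∃ x, w x = t
  hasFieldDeriv : ∀ x, HasFieldDeriv D.v w 0 x
  differential_ne : ∀ x, differential w x ≠ 0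
  isSingular_iff : ∀ x, D.IsSingular x ↔ w x = 0 ∨ w x = R
  eventually_zero : ∀ q, w q = 0 → ∀ᶠ y in 𝓝 q, y ∈ (D.box q).B ∧ w y = (D.box q).σ y
  eventually_last : ∀ q, w q = R → ∀ᶠ y in 𝓝 q, y ∈ (D.box q).B ∧ R - w y = (D.box q).σ y

/-- `w` inverts the geodesic arc. Away from the ends it agrees locally with a smooth parameter of
`exists_parameter`; near an end the isometric chart is `σ` itself, so `w` is `σ` at the first end
and `R - σ` at the last. -/
theorem exists_isArcParameter [ConnectedSpace X] {x : X} (hx : D.IsSingular x) :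
    ∃ R w, D.IsArcParameter R w := by
  obtain ⟨G, hGE, hG, hG'⟩ := D.topAtlas.exists_geodesicAtlas
  have hEnd : ∀ x, G.IsEnd (D.toTops x) ↔ D.IsSingular x := fun x => by
    rw [hGE]
    exact isSingular_top_iff
  obtain ⟨γ, R, hR, hγ, himage, hinj, hends⟩ := G.exists_geodesic_arc ((hEnd x).2 hx)
  have hsurj : ∀ z, ∃ t ∈ Icc 0 R, γ t = z := fun z => himage.ge (mem_univ z)
  choose W hW hγW using hsurj
  set w : X → ℝ := fun x => W (D.toTops x) with hw
  have hwγ : ∀ x t, t ∈ Icc 0 R → D.toTops x = γ t → w x = t := fun x t ht h =>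
    hinj (hW _) ht ((hγW _).trans h)
  have hsing : ∀ x, D.IsSingular x ↔ w x = 0 ∨ w x = R := fun x => by
    rw [← hEnd, ← hends _ (hW _), hγW]
  -- The sign `e` is free because the chart at an end point is even; it is chosen to point into `[0,
  -- R]`.
  have hcurve : ∀ (q : X) (e : ℝ), D.IsSingular q → (e = 1 ∨ e = -1) →
      ∀ᶠ y in 𝓝 q, y ∈ (D.box q).B ∧ 0 ≤ (D.box q).σ y ∧ (D.box q).σ y ≤ R ∧
        D.toTops y = γ (w q + e * (D.box q).σ y) := by
    intro q e hq he
    have htq : D.top q = q := (FlowSystem.isSingular_iff.1 hq).1.top_eq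
    set z := D.toTops q with hz
    have hzq : z.1 = q := htq
    have h1 := continuous_toTops.continuousAt.eventually (f := D.toTops) (hG' z (by rw [← hGE]; exact (hEnd q).2 hq))
    obtain ⟨ε, hε, he'⟩ := hγ (w q)
    rw [show γ (w q) = z from hγW z] at he'
    have hσ : ContinuousAt (D.box q).σ q :=
      (D.box q).smooth_σ.continuousOn.continuousAt ((D.box q).isOpen_B.mem_nhds (D.box q).mem_B)
    have hσ0 : (D.box q).σ q = 0 := (box_self q).2
    have h2 : Tendsto (fun y => e * (D.box q).σ y) (𝓝 q) (𝓝 0) := by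
      have := hσ.const_mul e
      simpa [ContinuousAt, hσ0] using this
    have h3 : ∀ᶠ y in 𝓝 q, |(D.box q).σ y| < min (G.r z) R :=
      hσ.abs.eventually (gt_mem_nhds (by
        show |(D.box q).σ q| < _
        rw [hσ0, abs_zero]
        exact lt_min (G.r_pos z) hR))
    filter_upwards [h1, h2.eventually he', h3, (D.box q).isOpen_B.mem_nhds (D.box q).mem_B] with y k1 k2 k3 k4
    have k5 : (D.topAtlas.s z) (D.toTops y) = (D.box q).σ y := by
      show (D.box z.1).σ (D.top y) = _
      rw [hzq]
      exact σ_top_eq hq k4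
    rw [k5] at k1
    obtain ⟨k6, k7⟩ := lt_min_iff.1 k3
    refine ⟨k4, k1.1, (le_abs_self _).trans k7.le, ?_⟩
    rw [k2, k1.2]
    have hend : G.IsEnd z := (hEnd q).2 hq
    rcases hε with rfl | rfl <;> rcases he with rfl | rfl <;>
      simp only [one_mul, neg_mul, neg_neg] <;> exact (G.even z hend _ k6).symm
  have hzero : ∀ q, w q = 0 → ∀ᶠ y in 𝓝 q, y ∈ (D.box q).B ∧ w y = (D.box q).σ y := fun q hq => by
    filter_upwards [hcurve q 1 ((hsing q).2 (Or.inl hq)) (Or.inl rfl)] with y ⟨k1, k2, k3, k4⟩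
    refine ⟨k1, hwγ _ _ ⟨k2, k3⟩ ?_⟩
    rw [k4, hq, zero_add, one_mul]
  have hlast : ∀ q, w q = R → ∀ᶠ y in 𝓝 q, y ∈ (D.box q).B ∧ R - w y = (D.box q).σ y := fun q hq => by
    filter_upwards [hcurve q (-1) ((hsing q).2 (Or.inr hq)) (Or.inr rfl)] with y ⟨k1, k2, k3, k4⟩
    refine ⟨k1, ?_⟩
    rw [hwγ y (R - (D.box q).σ y) ⟨by linarith, by linarith⟩ (by rw [k4, hq]; congr 1; ring)]
    ring
  have hbox : ∀ q, HasFieldDeriv D.v (D.box q).σ 0 q ∧ differential (D.box q).σ q ≠ 0 := fun q =>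
    ⟨⟨(D.box q).smooth_σ.contMDiffAt ((D.box q).isOpen_B.mem_nhds (D.box q).mem_B),
      (D.box q).fieldDeriv_σ q (D.box q).mem_B⟩, (D.box q).mfderiv_σ_ne q (D.box q).mem_B⟩
  have hderiv : ∀ x, HasFieldDeriv D.v w 0 x ∧ differential w x ≠ 0 := fun x => by
    by_cases h : D.IsSingular x
    · obtain ⟨h1, h2⟩ := hbox x
      rcases (hsing x).1 h with h0 | h0
      · have h3 : w =ᶠ[𝓝 x] (D.box x).σ := (hzero x h0).mono fun y hy => hy.2
        exact ⟨h1.congr h3, by rwa [differential_congr h3]⟩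
      · have h3 : w =ᶠ[𝓝 x] fun y => R - (D.box x).σ y := (hlast x h0).mono fun y hy => by
          show w y = R - (D.box x).σ y
          linarith [hy.2]
        have h4 := (HasFieldDeriv.const (v := D.v) R x).sub h1
        rw [sub_zero] at h4
        refine ⟨h4.congr h3, ?_⟩
        rw [differential_congr h3, differential_comp (h := fun s => R - s)
          ((hasDerivAt_id _).const_sub R) h1.mdifferentiableAt]
        exact smul_ne_zero (by norm_num) h2
    · obtain ⟨θ, h1, h2, h3, h4⟩ := exists_parameter (fun z hz => hG z hz) (hγ (w x)) (hγW _).symm h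
      have h5 : θ x ∈ Ioo 0 R := by
        rw [h2]
        have h6 := mt (hsing x).2 h
        push Not at h6
        exact ⟨(hW (D.toTops x)).1.lt_of_ne (Ne.symm h6.1), (hW (D.toTops x)).2.lt_of_ne h6.2⟩
      have h6 : w =ᶠ[𝓝 x] θ := by
        filter_upwards [h3, h1.1.continuousAt.eventually (isOpen_Ioo.mem_nhds h5)] with y hy hy'
        exact hwγ _ _ (Ioo_subset_Icc_self hy') hy
      exact ⟨h1.congr h6, by rwa [differential_congr h6]⟩
  refine ⟨R, w, hR, fun x => hW _, fun x y => ⟨fun h => ?_, fun h => ?_⟩, fun t ht => ?_,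
    fun x => (hderiv x).1, fun x => (hderiv x).2, hsing, hzero, hlast⟩
  · have h1 := congrArg γ h
    simp only [hw, hγW] at h1
    exact congrArg Subtype.val h1
  · exact congrArg W (Subtype.ext h : D.toTops x = D.toTops y)
  · exact ⟨(γ t).1, hwγ _ _ ht (Subtype.ext (γ t).2.top_eq)⟩

/-- A function that increases along the leaves can be made equal to the time of a flow box near a singular
point. -/
theorem IsHeight.exists_eq_time {g m : X → ℝ} (hg : D.IsHeight g) {q : X}
    (hm : ∀ x, HasFieldDeriv D.v m 0 x) (hml : ∀ x y, D.top x = D.top y → m x = m y) (hm0 : ∀ x, 0 ≤ m x)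
    (hmq : ∀ x, m x = 0 → x = q) (hev : ∀ᶠ y in 𝓝 q, y ∈ (D.box q).B ∧ m y = (D.box q).σ y) {e : ℝ}
    (he : 0 < e) : ∃ g', D.IsHeight g' ∧ (∀ x, e ≤ m x → g' x = g x) ∧ ∃ δ > 0, ∀ x, m x < δ →
      x ∈ (D.box q).B ∧ m x = (D.box q).σ x ∧ g' x = (D.box q).t x := by
  have hmc : Continuous m := continuous_iff_continuousAt.2 fun x => (hm x).1.continuousAt
  -- `m` vanishes only at `q`, so it has a positive minimum on the compact complement of a
  -- neighbourhood of `q`; its small sublevel sets lie in that neighbourhood.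
  obtain ⟨δ₁, hδ₁, hN⟩ : ∃ δ₁ > 0, ∀ x, m x < δ₁ → x ∈ (D.box q).B ∧ m x = (D.box q).σ x := by
    obtain ⟨N, hN, hNo, hqN⟩ := eventually_nhds_iff.1 hev
    rcases (Nᶜ).eq_empty_or_nonempty with hemp | hne
    · exact ⟨1, one_pos, fun x _ => hN x (by
        by_contra hx
        exact (hemp ▸ hx : x ∈ (∅ : Set X)))⟩
    · obtain ⟨x₀, hx₀, hmin⟩ := hNo.isClosed_compl.isCompact.exists_isMinOn hne hmc.continuousOn
      refine ⟨m x₀, (hm0 x₀).lt_of_ne fun h0 => hx₀ (hmq x₀ h0.symm ▸ hqN), fun x hx => hN x ?_⟩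
      by_contra hxN
      exact absurd (hmin hxN) (not_le.2 hx)
  set δ := min δ₁ e with hδ
  have hδpos : 0 < δ := lt_min hδ₁ he
  let χ : ContDiffBump (0 : ℝ) := ⟨δ / 3, δ / 2, by linarith, by linarith⟩
  have hχ0 : ∀ x, δ / 2 ≤ m x → χ (m x) = 0 := fun x hx =>
    χ.zero_of_le_dist (by simpa [abs_of_nonneg (hm0 x)] using hx)
  have hχs : ContDiff ℝ ∞ χ := χ.contDiff (n := ⊤)
  have hχm : ContMDiff (𝓡∂ 2) 𝓘(ℝ, ℝ) ∞ (fun x => χ (m x)) := hχs.comp_contMDiff fun x => (hm x).1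
  have hsupp : tsupport (fun x => χ (m x)) ⊆ (D.box q).B := by
    have h1 : tsupport (fun x => χ (m x)) ⊆ {x | m x ≤ δ / 2} := by
      refine closure_minimal (fun x hx => ?_) (isClosed_le hmc continuous_const)
      by_contra hcon
      exact hx (hχ0 x (not_le.1 hcon).le)
    exact fun x hx => (hN x (by
      have h2 : m x ≤ δ / 2 := h1 hx
      linarith [min_le_left δ₁ e])).1
  -- The weight `χ (m x)` is constant on leaves, so along the field the derivative of `g'` is a
  -- convex combination of those of `g` and of the box time, both positive.
  set g' : X → ℝ := fun x => g x + χ (m x) * ((D.box q).t x - g x) with hg'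
  have hg'eq : ∀ x, δ / 2 ≤ m x → g' x = g x := fun x hx => by
    simp only [hg', hχ0 x hx, zero_mul, add_zero]
  refine ⟨g', ⟨?_, fun x => ?_, fun x y ht hf => ?_⟩, fun x hx => hg'eq x ?_, δ / 3, by linarith,
    fun x hx => ?_⟩
  · exact hg.smooth.add (contMDiff_cutoff_mul hχm hsupp (D.box q).isOpen_B
      ((D.box q).smooth_t.sub hg.smooth.contMDiffOn))
  · have hgd : HasFieldDeriv D.v g (fieldDeriv D.v g x) x := ⟨hg.smooth.contMDiffAt, rfl⟩
    have hpos := hg.fieldDeriv_pos x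
    rcases lt_or_ge (m x) δ₁ with hx | hx
    · have hB := (hN x hx).1
      have htd : HasFieldDeriv D.v (D.box q).t (fieldDeriv D.v (D.box q).t x) x :=
        ⟨(D.box q).smooth_t.contMDiffAt ((D.box q).isOpen_B.mem_nhds hB), rfl⟩
      have h1 := hgd.add (((hm x).comp hχs.contDiffAt).mul (htd.sub hgd))
      have h2 := (D.box q).fieldDeriv_t_pos x hB
      have h3 := χ.nonneg (x := m x)
      have h4 := χ.le_one (x := m x)
      rw [h1.2, mul_zero, mul_zero, add_zero]
      exact add_mul_sub_pos h3 h4 hpos h2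
    · have h1 : g' =ᶠ[𝓝 x] g := by
        filter_upwards [hmc.continuousAt.eventually (lt_mem_nhds (show δ / 2 < m x by
          linarith [min_le_left δ₁ e]))] with y hy
        exact hg'eq y hy.le
      rw [fieldDeriv_congr h1]
      exact hpos
  · have hlt := hg.lt_of_lt x y ht hf
    have hmxy := hml x y ht
    rcases lt_or_ge (m x) (δ / 2) with hx | hx
    · obtain ⟨hxB, hxσ⟩ := hN x (by linarith [min_le_left δ₁ e])
      obtain ⟨hyB, hyσ⟩ := hN y (by linarith [min_le_left δ₁ e])
      have h1 := (f_lt_f_iff (D.box q) hxB hyB (by rw [← hxσ, ← hyσ, hmxy])).1 hf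
      have h3 := χ.nonneg (x := m x)
      have h4 := χ.le_one (x := m x)
      have h5 := add_mul_sub_pos h3 h4 (sub_pos.2 hlt) (sub_pos.2 h1)
      simp only [hg', ← hmxy]
      linarith
    · rw [hg'eq x hx, hg'eq y (hmxy ▸ hx)]
      exact hlt
  · linarith [min_le_right δ₁ e]
  · obtain ⟨h1, h2⟩ := hN x (by linarith [min_le_left δ₁ e])
    refine ⟨h1, h2, ?_⟩
    simp only [hg']
    rw [χ.one_of_mem_closedBall (by simpa [abs_of_nonneg (hm0 x)] using hx.le)]
    ring

/-- The relative height near a singular point. -/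
theorem level_mul_sqrt {g m : X → ℝ} {q : X} (hq : D.IsSingular q) {δ : ℝ}
    (hml : ∀ x y, D.top x = D.top y → m x = m y)
    (hδ : ∀ x, m x < δ → x ∈ (D.box q).B ∧ m x = (D.box q).σ x ∧ g x = (D.box q).t x) {x : X}
    (hx : m x < δ) : (2 * D.level g x - 1) * √(m x) = (D.box q).t x := by
  obtain ⟨hB, hσ, hgt⟩ := hδ x hx
  have hk : (D.box q).kind = .tangent := hq
  have hreg := (D.box q).mapsTo x hB
  rw [hk] at hreg
  have hsq : (D.box q).t x ^ 2 ≤ m x := hσ ▸ hreg.1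
  have hm0 : 0 ≤ m x := (sq_nonneg _).trans hsq
  have hmt : m (D.top x) = m x := hml _ _ (top_top x)
  have hmb : m (D.bot x) = m x := hml _ _ (top_bot x)
  obtain ⟨htB, htσ, htt⟩ := hδ (D.top x) (hmt ▸ hx)
  obtain ⟨hbB, hbσ, hbt⟩ := hδ (D.bot x) (hmb ▸ hx)
  -- In the parabolic box the leaf with label `m` runs from time `-√m` to time `√m`, so its centred
  -- relative height is `t / √m`.
  have h1 := ((isTop_iff htB).1 (isTop_top x)).2
  have h2 := ((isTop_iff (D := D.reverse) (p := q) hbB).1 (isTop_top (D := D.reverse) x)).2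
  change -(D.box q).t (D.bot x) = (D.box q).kind.reverse.topTime ((D.box q).σ (D.bot x)) at h2
  rw [hk] at h1 h2
  change (D.box q).t (D.top x) = √((D.box q).σ (D.top x)) at h1
  change -(D.box q).t (D.bot x) = √((D.box q).σ (D.bot x)) at h2
  rw [← htσ, hmt] at h1
  rw [← hbσ, hmb] at h2
  rcases hm0.eq_or_lt with h0 | hpos
  · rw [← h0, Real.sqrt_zero, mul_zero]
    rw [← h0] at hsq
    nlinarith [sq_nonneg ((D.box q).t x)]
  · have hs := Real.sqrt_pos.2 hpos
    unfold level
    rw [hgt, htt, hbt, h1, show (D.box q).t (D.bot x) = -√(m x) by linarith]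
    field_simp
    ring

end FlowSystem

end

/-! ### The disk -/

section

open Set Filter MeasureTheory

variable {X : Type*} [TopologicalSpace X] [ChartedSpace (EuclideanHalfSpace 2) X]

namespace FlowSystem

variable {D : FlowSystem X} [CompactSpace X] [T2Space X]

/-- A surface swept out by an arc of leaves is a disk. -/
theorem isDiffeomorphicTo_closedDisk [ConnectedSpace X] [IsManifold (𝓡∂ 2) ∞ X] {x₀ : X}
    (hx₀ : D.IsSingular x₀) : IsDiffeomorphicTo X closedDisk := by
  obtain ⟨R, w, hw⟩ := exists_isArcParameter hx₀
  have hR := hw.pos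
  obtain ⟨q, hq⟩ := hw.surj 0 ⟨le_rfl, hR.le⟩
  obtain ⟨q', hq'⟩ := hw.surj R ⟨hR.le, le_rfl⟩
  have hqs : D.IsSingular q := (hw.isSingular_iff q).2 (Or.inl hq)
  have hqs' : D.IsSingular q' := (hw.isSingular_iff q').2 (Or.inr hq')
  have hl : ∀ x y, D.top x = D.top y → w x = w y := fun x y => (hw.eq_iff x y).2
  have hm' : ∀ x, HasFieldDeriv D.v (fun y => R - w y) 0 x := fun x => by
    have := (HasFieldDeriv.const (v := D.v) R x).sub (hw.hasFieldDeriv x)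
    rwa [sub_zero] at this
  have hl' : ∀ x y, D.top x = D.top y → R - w x = R - w y := fun x y h => by rw [hl x y h]
  obtain ⟨g₁, hg₁, -, δ, hδ, hδ'⟩ := (isHeight_f (D := D)).exists_eq_time hw.hasFieldDeriv hl
    (fun x => (hw.mem x).1) (fun x hx => (hqs.eq_of_top_eq ((hw.eq_iff _ _).1 (hq.trans hx.symm))).symm)
    (hw.eventually_zero q hq) one_pos
  -- With the threshold `R / 2` the second correction leaves the first one intact on the half `w ≤ R
  -- / 2` of the surface.
  obtain ⟨g, hg, hgg, η, hη, hη'⟩ := hg₁.exists_eq_time hm' hl' (fun x => sub_nonneg.2 (hw.mem x).2)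
    (fun x hx => (hqs'.eq_of_top_eq ((hw.eq_iff _ _).1 (hq'.trans (sub_eq_zero.1 hx)))).symm)
    (hw.eventually_last q' hq') (half_pos hR)
  have hnear : ∀ x, w x < min δ (R / 2) → x ∈ (D.box q).B ∧ w x = (D.box q).σ x ∧ g x = (D.box q).t x :=
    fun x hx => by
      obtain ⟨h1, h2, h3⟩ := hδ' x (hx.trans_le (min_le_left _ _))
      exact ⟨h1, h2, by rw [hgg x (by linarith [min_le_right δ (R / 2)]), h3]⟩
  set ν : X → ℝ := fun x => 2 * D.level g x - 1 with hν
  have hνmem : ∀ x, -1 ≤ ν x ∧ ν x ≤ 1 := fun x => by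
    have := hg.level_mem x
    constructor <;> simp only [hν] <;> linarith [this.1, this.2]
  -- The chord of the unit disk over `a` has half length `√(1 - a ^ 2)`, and `ν` runs over `[-1, 1]`
  -- along the leaf.
  set a : X → ℝ := fun x => 2 / R * w x + -1 with ha
  set b : X → ℝ := fun x => ν x * √(1 - a x ^ 2) with hb
  have hfac : ∀ x, 1 - a x ^ 2 = w x * (4 / R ^ 2 * (R - w x)) := fun x => by
    simp only [ha]
    field_simp
    ring
  have had : ∀ x, HasFieldDeriv D.v a 0 x := fun x => by
    have := ((hw.hasFieldDeriv x).const_mul (2 / R)).add (HasFieldDeriv.const (v := D.v) (-1) x)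
    rwa [mul_zero, add_zero] at this
  have hpos : ∀ x, ¬ D.IsSingular x → 0 < 1 - a x ^ 2 := fun x hx => by
    have h1 := mt (hw.isSingular_iff x).2 hx
    push Not at h1
    rw [hfac]
    have h2 : 0 < w x := (hw.mem x).1.lt_of_ne (Ne.symm h1.1)
    have h3 : 0 < R - w x := sub_pos.2 ((hw.mem x).2.lt_of_ne h1.2)
    positivity
  have hzero : ∀ x, D.IsSingular x → 1 - a x ^ 2 = 0 := fun x hx => by
    rw [hfac]
    rcases (hw.isSingular_iff x).1 hx with h | h <;> rw [h] <;> ring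
  have hnonneg : ∀ x, 0 ≤ 1 - a x ^ 2 := fun x => by
    by_cases hx : D.IsSingular x
    · exact (hzero x hx).ge
    · exact (hpos x hx).le
  -- behaviour near a singular point
  have hsing : ∀ (p x : X) (m : X → ℝ) (r : ℝ), D.IsSingular p → 0 < r →
      (∀ x y, D.top x = D.top y → m x = m y) → (∀ x, HasFieldDeriv D.v m 0 x) →
      (∀ x, 0 ≤ m x) → (∀ x, 1 - a x ^ 2 = m x * (4 / R ^ 2 * (R - m x))) →
      (∀ x, m x < r → x ∈ (D.box p).B ∧ m x = (D.box p).σ x ∧ g x = (D.box p).t x) → m x = 0 →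
      ∃ d > 0, HasFieldDeriv D.v b d x := by
    intro p x m r hp hr hml hmd hm0 hma hmr hx
    have hB := (hmr x (by linarith)).1
    have htd : HasFieldDeriv D.v (D.box p).t (fieldDeriv D.v (D.box p).t x) x :=
      ⟨(D.box p).smooth_t.contMDiffAt ((D.box p).isOpen_B.mem_nhds hB), rfl⟩
    have h1 : ContDiffAt ℝ ∞ (fun s => √(4 / R ^ 2 * (R - s))) (m x) := by
      refine ContDiffAt.sqrt (by fun_prop) ?_
      rw [hx, sub_zero]
      positivity
    have h2 := htd.mul ((hmd x).comp h1)
    refine ⟨√(4 / R ^ 2 * R) * fieldDeriv D.v (D.box p).t x,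
      mul_pos (Real.sqrt_pos.2 (by positivity)) ((D.box p).fieldDeriv_t_pos x hB), ?_⟩
    rw [mul_zero, mul_zero, zero_add, hx, sub_zero] at h2
    refine h2.congr ?_
    filter_upwards [(hmd x).1.continuousAt.eventually (gt_mem_nhds (show m x < r by linarith))] with y hy
    simp only [hb]
    -- The factor `√m` of the half chord cancels the denominator of `ν`: near the singular point `b`
    -- is the box time times a smooth positive function of `m`.
    rw [hma, Real.sqrt_mul (hm0 y), ← mul_assoc, level_mul_sqrt hp hml hmr hy]
  have hbd : ∀ x, ∃ d > 0, HasFieldDeriv D.v b d x := fun x => by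
    by_cases hx : D.IsSingular x
    · rcases (hw.isSingular_iff x).1 hx with h | h
      · exact hsing q x w _ hqs (lt_min hδ (half_pos hR)) hl hw.hasFieldDeriv (fun x => (hw.mem x).1) hfac
          hnear h
      · refine hsing q' x (fun y => R - w y) η hqs' hη hl' hm' (fun x => sub_nonneg.2 (hw.mem x).2)
          (fun x => ?_) hη' (sub_eq_zero.2 h.symm)
        rw [hfac]
        ring
    · obtain ⟨d, hd, h1⟩ := hg.hasFieldDeriv_level hx
      have h2 := (h1.const_mul 2).sub (HasFieldDeriv.const (v := D.v) 1 x)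
      have h3 : ContDiffAt ℝ ∞ (fun s => √(1 - s ^ 2)) (a x) :=
        ContDiffAt.sqrt (by fun_prop) (hpos x hx).ne'
      have h4 := h2.mul ((had x).comp h3)
      rw [mul_zero, mul_zero, zero_add, sub_zero] at h4
      exact ⟨_, mul_pos (Real.sqrt_pos.2 (hpos x hx)) (by linarith), h4⟩
  have hbsq : ∀ x, b x ^ 2 = ν x ^ 2 * (1 - a x ^ 2) := fun x => by
    simp only [hb]
    rw [mul_pow, Real.sq_sqrt (hnonneg x)]
  refine isDiffeomorphicTo_planeMap (a := a) (b := b) (fun x => (had x).1)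
    (fun x => (hbd x).choose_spec.2.1) (fun x y h1 h2 => ?_) (fun x => ?_) (fun y hy => ?_)
    fun x u h1 h2 => ?_
  · have h3 : w x = w y := by
      simp only [ha] at h1
      have h4 : 2 / R * w x = 2 / R * w y := by linarith
      exact mul_left_cancel₀ (by positivity) h4
    have ht := (hw.eq_iff x y).1 h3
    by_cases hx : D.IsSingular x
    · exact hx.eq_of_top_eq ht
    · refine hg.eq_of_level_eq hx ht ?_
      simp only [hb] at h2
      rw [h1] at h2
      have h5 := mul_right_cancel₀ (Real.sqrt_pos.2 (h1 ▸ hpos x hx)).ne' h2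
      simp only [hν] at h5
      linarith
  · have h1 := norm_sq_planeMap a b x
    rw [hbsq] at h1
    have h2 := hnonneg x
    have h3 : ν x ^ 2 ≤ 1 := by
      rw [sq_le_one_iff_abs_le_one, abs_le]
      exact hνmem x
    show _ ≤ (1 : ℝ)
    rw [← sq_le_one_iff₀ (norm_nonneg _), h1]
    nlinarith
  · have h1 : y 0 ^ 2 + y 1 ^ 2 ≤ 1 := by
      have h2 : ‖y‖ ^ 2 ≤ 1 := (sq_le_one_iff₀ (norm_nonneg _)).2 hy
      rwa [EuclideanSpace.norm_sq_eq, Fin.sum_univ_two, Real.norm_eq_abs, Real.norm_eq_abs, sq_abs,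
        sq_abs] at h2
    have h2 : -1 ≤ y 0 ∧ y 0 ≤ 1 := abs_le.1 (sq_le_one_iff_abs_le_one _ |>.1 (by nlinarith [sq_nonneg (y 1)]))
    obtain ⟨z', hz'⟩ := hw.surj (R / 2 * (y 0 + 1)) ⟨by nlinarith, by nlinarith⟩
    set z := D.top z' with hz
    have hwz : ∀ x, D.top x = z → a x = y 0 := fun x hx => by
      have h3 := hl x z' hx
      simp only [ha]
      rw [h3, hz']
      field_simp
      ring
    -- Over a singular leaf the chord is the single point with `y 1 = 0`, whatever value the
    -- relative height takes there.
    by_cases hs : D.IsSingular z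
    · have h3 := hwz z (top_top z')
      refine ⟨z, h3, ?_⟩
      have h4 := hzero z hs
      have h5 : y 1 ^ 2 = 0 := by
        rw [h3] at h4
        nlinarith [sq_nonneg (y 1)]
      simp only [hb]
      rw [h4, Real.sqrt_zero, mul_zero, pow_eq_zero_iff two_ne_zero |>.1 h5]
    · have h3 := hpos z hs
      rw [hwz z (top_top z')] at h3
      have hsq := Real.sqrt_pos.2 h3
      have h4 : |y 1 / √(1 - y 0 ^ 2)| ≤ 1 := by
        rw [abs_div, abs_of_pos hsq, div_le_one hsq]
        exact Real.abs_le_sqrt (by linarith)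
      obtain ⟨h5, h6⟩ := abs_le.1 h4
      obtain ⟨x, hx1, hx2⟩ := hg.exists_level_eq (isTop_top z') hs
        (show (1 + y 1 / √(1 - y 0 ^ 2)) / 2 ∈ Icc (0 : ℝ) 1 from ⟨by linarith, by linarith⟩)
      refine ⟨x, hwz x hx1, ?_⟩
      simp only [hb, hν]
      rw [hx2, hwz x hx1]
      field_simp
      ring
  · obtain ⟨d, hd, h3⟩ := hbd x
    refine eq_zero_of_differential_eq_zero (had x).2 ?_ (by rw [h3.2]; exact hd) h1 h2
    have h4 : HasDerivAt (fun s => 2 / R * s + -1) (2 / R) (w x) := by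
      simpa using ((hasDerivAt_id (w x)).const_mul (2 / R)).add_const (-1)
    rw [show a = fun y => (fun s => 2 / R * s + -1) (w y) from rfl,
      differential_comp h4 (hw.hasFieldDeriv x).mdifferentiableAt]
    exact smul_ne_zero (by positivity) (hw.differential_ne x)

end FlowSystem

end

theorem lemma4p1 {X : Type*} [TopologicalSpace X] [T2Space X] [CompactSpace X] [ConnectedSpace X]
    [ChartedSpace (EuclideanHalfSpace 2) X] [IsManifold (𝓡∂ 2) ∞ X]
    (hX : ((𝓡∂ 2).boundary X).Nonempty)
    (v : ∀ x : X, TangentSpace (𝓡∂ 2) x) (hv : IsSmoothField v)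
    (hv_ne : ∀ x, v x ≠ 0) (hv_grad : IsGradientLike v) (hv_conv : IsBoundaryConvex v) :
    IsDiffeomorphicTo X closedDisk ∨ IsDiffeomorphicTo X closedAnnulus := by
  have hbox := nonempty_flowBox hv hv_ne hv_conv
  obtain ⟨f, hf, hfv⟩ := exists_lyapunov hv hbox hv_grad
  let D : FlowSystem X := ⟨v, f, hf, hfv, fun p => (hbox p).some⟩
  by_cases h : ∃ x, D.IsSingular x
  · obtain ⟨x, hx⟩ := h
    exact Or.inl (FlowSystem.isDiffeomorphicTo_closedDisk hx)
  · exact Or.inr (FlowSystem.isDiffeomorphicTo_closedAnnulus fun x hx => h ⟨x, hx⟩)
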